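/- **Theorem 3.5.** Let $k$ be an algebraically closed field, $q\in k^*$, and fix a square root $q^{1/2}$ of $q$ in $k$. Let $R$ be an irreducible (reduced, crystallographic) root system with a set $\Delta$ of simple roots, $W_0$ its Weyl group, $P$ its weight lattice, and $W=W_0\ltimes P$ the extended affine Weyl group, with length function $l$. Let $S$ be the set of simple reflections of the affine Weyl group $W_a=W_0\ltimes\mathbb ZR\subseteq W$. Let $H$ be the Hecke algebra of $(W,S)$ over $k$ with parameter $q$: it has a basis $T_w$ $(w\in W)$ with $T_wT_u=T_{wu}$ if $l(wu)=l(w)+l(u)$, and $(T_s-q)(T_s+1)=0$ for $s\in S$. Let $w_0$ be the longest element of $W_0$ and let $$C=C_{w_0},\quad C'=C'_{w_0},\qquad C_w=q^{-\frac{l(w)}2}\sum_{y\le w}P_{y,w}(q)T_y,\quad C'_w=q^{\frac{l(w)}2}\sum_{y\le w}(-1)^{l(w)-l(y)}q^{-l(y)}P_{y,w}(q^{-1})T_y,$$ where $\le$ is the Bruhat order and $P_{y,w}$ are the Kazhdan–Lusztig polynomials. For $x\in P$ put $\theta_x=q^{-l(y)/2}T_y\,q^{l(z)/2}T_z^{-1}$,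 where $y,z$ are dominant weights with $x=yz^{-1}$ ($P$ written multiplicatively), and let $\Theta$ be the span of the $\theta_x$; the $\theta_x$ form a basis of $\Theta$, and $\Theta$ contains the center $Z(H)$. Let $T=\mathrm{Hom}(P,k^*)$; for $t\in T$ write $x(t)$ for the value of $t$ at $x\in P$, and let $\phi_t:\Theta\to k$ be the linear map $\theta_x\mapsto x(t)$. Let $H_t$ be the quotient of $H$ by the two-sided ideal generated by all $z-\phi_t(z)$, $z\in Z(H)$. The images of $C$, $C'$ in $H_t$ are denoted by the same letters, and $CH_tC'=\{ChC' : h\in H_t\}$. Let $t\in T$ be such that $\alpha(t)=q$ for every simple root $\alpha\in\Delta$. (a) If $\sum_{w\in W_0}q^{l(w)}\neq0$, then $CH_tC'$ and $C'H_tC$ are two-sided ideals of $H_t$ of dimension $1$ over $k$. They realize one-dimensional representations of $H$: on $CH_tC'$ the algebra $H$ acts by left multiplication through a $k$-algebra homomorphism $\chi:H\to k$ with $\chi(T_s)=q$ for all $s\in S$, and by right multiplication through a $k$-algebra homomorphism $\chi':H\to k$ with $\chi'(T_s)=-1$ for all $s\in S$; on $C'H_tC$ it acts in the same way by left and right multiplication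 through $k$-algebra homomorphisms $H\to k$ that map every $T_s$, $s\in S$, to $-1$ and to $q$ respectively. (b) If $\sum_{w\in W_0}q^{l(w)}=0$, then $CH_tC'=0$. -/

import Mathlib

open scoped Polynomial LaurentPolynomial

namespace AffineHecke

noncomputable section

section RootData

variable {ι V V' : Type*} [AddCommGroup V] [Module ℝ V] [AddCommGroup V'] [Module ℝ V']
  {R : RootPairing ι ℝ V V'}

variable (R) in
/-- The weight lattice `P` of a root system in `V`: the vectors that pair integrally with every
coroot. -/
def weightLattice : AddSubgroup V where
  carrier := {x | ∀ i, ∃ n : ℤ, R.coroot' i x = n}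
  zero_mem' := fun _ => ⟨0, by simp⟩
  add_mem' := by
    intro x y hx hy i
    obtain ⟨m, hm⟩ := hx i
    obtain ⟨n, hn⟩ := hy i
    exact ⟨m + n, by simp only [map_add, hm, hn]; push_cast; rfl⟩
  neg_mem' := by
    intro x hx i
    obtain ⟨m, hm⟩ := hx i
    exact ⟨-m, by simp only [map_neg, hm]; push_cast; rfl⟩

/-- The integer `⟨x, αᵢ^∨⟩` for a weight `x`. -/
def pair (x : weightLattice R) (i : ι) : ℤ := (x.2 i).choose

theorem pair_spec (x : weightLattice R) (i : ι) : R.coroot' i (x : V) = (pair x i : ℝ) :=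
  (x.2 i).choose_spec

variable (R) in
/-- A root, seen as a weight. -/
def rootWeight [R.IsCrystallographic] (i : ι) : weightLattice R :=
  ⟨R.root i, fun j => ⟨R.pairingIn ℤ i j, by
    rw [R.root_coroot'_eq_pairing, ← R.algebraMap_pairingIn ℤ]; rfl⟩⟩

theorem coroot'_smul (w : R.weylGroup) (i : ι) (x : V) :
    R.coroot' i (w • x) = R.coroot' ((R.weylGroupToPerm w).symm i) x := by
  obtain ⟨g, hg⟩ := w
  have h := LinearMap.congr_fun (LinearMap.congr_fun g.weight_coweight_transpose (R.coroot i)) x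
  have h2 := congrFun g.coroot_coweightMap i
  simp only [Function.comp_apply] at h2
  change R.toLinearMap (g.weightMap x) (R.coroot i) = R.toLinearMap x (R.coroot _)
  rw [show (R.weylGroupToPerm ⟨g, hg⟩).symm i = g.indexEquiv.symm i from rfl, ← h2]
  simpa using h

theorem smul_mem_weightLattice (w : R.weylGroup) {x : V} (hx : x ∈ weightLattice R) :
    w • x ∈ weightLattice R := fun i => by
  rw [coroot'_smul]
  exact hx _

/-- The Weyl group acts on the weight lattice (by restriction of its action on `V`). -/
instance : DistribMulAction R.weylGroup (weightLattice R) where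
  smul w x := ⟨w • (x : V), smul_mem_weightLattice w x.2⟩
  one_smul x := Subtype.ext (one_smul _ (x : V))
  mul_smul g h x := Subtype.ext (mul_smul g h (x : V))
  smul_zero g := Subtype.ext (smul_zero g)
  smul_add g x y := Subtype.ext (smul_add g (x : V) (y : V))

instance [Finite ι] [R.IsRootSystem] : Finite R.weylGroup := by
  have hinj : Function.Injective R.weylGroupToPerm := by
    intro g h hgh
    apply Subtype.ext
    apply RootPairing.Equiv.weightHom_injective R
    apply LinearEquiv.toLinearMap_injective
    apply LinearMap.ext_on_range (v := R.root) RootPairing.IsRootSystem.span_root_eq_top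
    intro i
    have h1 := R.weylGroup_apply_root g i
    have h2 := R.weylGroup_apply_root h i
    rw [hgh, ← h2] at h1
    exact h1
  exact Finite.of_injective _ hinj

instance [Finite ι] [R.IsRootSystem] : Fintype R.weylGroup := Fintype.ofFinite _

variable (R) in
/-- The action of `W₀` on `P`, as a homomorphism to the automorphisms of `P` written
multiplicatively. -/
def weylAction : R.weylGroup →* MulAut (Multiplicative (weightLattice R)) where
  toFun w := AddEquiv.toMultiplicative (DistribMulAction.toAddEquiv (weightLattice R) w)
  map_one' := by
    refine MulEquiv.ext fun x => ?_
    change Multiplicative.ofAdd ((1 : R.weylGroup) • x.toAdd) = x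
    rw [one_smul]; rfl
  map_mul' g h := by
    refine MulEquiv.ext fun x => ?_
    change Multiplicative.ofAdd ((g * h) • x.toAdd) = Multiplicative.ofAdd (g • h • x.toAdd)
    rw [mul_smul]

variable (R) in
/-- The extended affine Weyl group `W = W₀ ⋉ P`. The pair `⟨x, w⟩` is the product of the
translation by the weight `x` with `w ∈ W₀`. -/
abbrev ExtAffineWeyl : Type _ := Multiplicative (weightLattice R) ⋊[weylAction R] R.weylGroup

/-- The translation by `x ∈ P` as an element of `W`. -/
def transl (x : weightLattice R) : ExtAffineWeyl R := SemidirectProduct.inl (Multiplicative.ofAdd x)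

/-- The inclusion `W₀ ⊆ W`. -/
def fin (w : R.weylGroup) : ExtAffineWeyl R := SemidirectProduct.inr w

open Classical in
/-- The length function of `W`. For `g = transl x * fin w` it is the number of affine hyperplanes
`{v | ⟨v, α^∨⟩ = n}` (`α` a positive root, `n` an integer) that separate the fundamental alcove
(in the dominant chamber, with the origin in its closure) from its image under `g`: the values of
`α^∨` on that image fill the unit interval that starts at `⟨x, α^∨⟩` if `w⁻¹ α` is positive, and at
`⟨x, α^∨⟩ - 1` if `w⁻¹ α` is negative. On `W_a = W₀ ⋉ ℤR` it is the Coxeter length. -/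
def len [Finite ι] (b : R.Base) (g : ExtAffineWeyl R) : ℕ :=
  ∑ᶠ i ∈ {i : ι | b.IsPos i},
    (pair g.left.toAdd i -
      if b.IsPos (g.right⁻¹ • i) then 0 else 1).natAbs

/-- `αᵢ^∨` is the highest coroot. -/
def IsHighestCoroot (b : R.Base) (i : ι) : Prop :=
  ∀ j, R.coroot i - R.coroot j ∈ AddSubmonoid.closure (R.coroot '' b.support)

/-- The set `S` of simple reflections of `W_a = W₀ ⋉ ℤR`: the simple reflections of `W₀`, and the
reflection `s₀ : v ↦ v - (⟨v, β^∨⟩ - 1) β`, where `β^∨` is the highest coroot. -/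
def simpleReflections [R.IsCrystallographic] (b : R.Base) : Set (ExtAffineWeyl R) :=
  {g | (∃ i ∈ b.support, g = fin (RootPairing.weylGroup.ofIdx R i)) ∨
    ∃ i, IsHighestCoroot b i ∧
      g = transl (rootWeight R i) * fin (RootPairing.weylGroup.ofIdx R i)}

/-- The Bruhat order of `W`: the reflexive and transitive relation generated by `y ≤ y r`, for
`r` a reflection (a conjugate of a simple reflection) with `l(y) < l(y r)`. -/
def BruhatLE [Finite ι] [R.IsCrystallographic] (b : R.Base) :
    ExtAffineWeyl R → ExtAffineWeyl R → Prop :=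
  Relation.ReflTransGen fun y z =>
    (∃ s ∈ simpleReflections b, ∃ g, z = y * (g * s * g⁻¹)) ∧ len b y < len b z

/-- The longest element `w₀` of `W₀`. -/
def longest [Finite ι] [R.IsRootSystem] (b : R.Base) : R.weylGroup :=
  (Finite.exists_max fun w : R.weylGroup => len b (fin w)).choose

theorem len_le_longest [Finite ι] [R.IsRootSystem] (b : R.Base) (w : R.weylGroup) :
    len b (fin w) ≤ len b (fin (longest b)) :=
  (Finite.exists_max fun w : R.weylGroup => len b (fin w)).choose_spec w

/-- A weight is dominant if it pairs non-negatively with all simple coroots. -/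
def IsDominant (b : R.Base) (x : weightLattice R) : Prop := ∀ i ∈ b.support, 0 ≤ pair x i

/-- Every family of integers indexed by the simple roots is the family of the pairings of a weight
with the simple coroots. -/
theorem exists_weight [Finite ι] [R.IsRootSystem] (b : R.Base) (n : ι → ℤ) :
    ∃ y : weightLattice R, ∀ i ∈ b.support, pair y i = n i := by
  obtain ⟨y, hy⟩ := R.toPerfPair.surjective (b.toCoweightBasis.constr ℝ fun i => (n i : ℝ))
  have hs (i : ι) (hi : i ∈ b.support) : R.coroot' i y = n i := by
    have h := LinearMap.congr_fun hy (R.coroot i)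
    have h2 := b.toCoweightBasis.constr_basis ℝ (fun i => (n i : ℝ)) ⟨i, hi⟩
    rw [b.toCoweightBasis_apply] at h2
    exact h.trans h2
  have hmem : y ∈ weightLattice R := by
    intro j
    have hj := b.coroot_mem_span_int j
    have key : ∀ c ∈ Submodule.span ℤ (R.coroot '' b.support),
        ∃ m : ℤ, R.toLinearMap y c = m := by
      intro c hc
      induction hc using Submodule.span_induction with
      | mem c hc =>
        obtain ⟨i, hi, rfl⟩ := hc
        exact ⟨n i, hs i hi⟩
      | zero => exact ⟨0, by simp⟩
      | add c d _ _ hc hd =>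
        obtain ⟨m, hm⟩ := hc
        obtain ⟨m', hm'⟩ := hd
        exact ⟨m + m', by simp only [map_add, hm, hm']; push_cast; rfl⟩
      | smul a c _ hc =>
        obtain ⟨m, hm⟩ := hc
        exact ⟨a * m, by simp [hm]⟩
    exact key _ hj
  refine ⟨⟨y, hmem⟩, fun i hi => ?_⟩
  have h := pair_spec (⟨y, hmem⟩ : weightLattice R) i
  rw [hs i hi] at h
  exact_mod_cast h.symm

theorem exists_dominant_sub [Finite ι] [R.IsRootSystem] (b : R.Base) (x : weightLattice R) :
    ∃ yz : weightLattice R × weightLattice R,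
      IsDominant b yz.1 ∧ IsDominant b yz.2 ∧ x = yz.1 - yz.2 := by
  obtain ⟨z, hz⟩ := exists_weight b fun i => |pair x i|
  refine ⟨(x + z, z), fun i hi => ?_, fun i hi => ?_, by simp⟩
  · have h1 := pair_spec (x + z) i
    rw [AddSubgroup.coe_add, map_add, pair_spec, pair_spec] at h1
    have h2 : pair x i + pair z i = pair (x + z) i := by exact_mod_cast h1
    have h3 := neg_abs_le (pair x i)
    have h4 := hz i hi
    change 0 ≤ pair (x + z) i
    linarith
  · change 0 ≤ pair z i
    rw [hz i hi]
    exact abs_nonneg _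

end RootData

section HeckeAlgebra

variable {ι V V' : Type*} [AddCommGroup V] [Module ℝ V] [AddCommGroup V'] [Module ℝ V']
  {R : RootPairing ι ℝ V V'} [Finite ι] [R.IsCrystallographic]

/-- The defining relations of the Hecke algebra of `(W, S)` with parameter `q`. -/
inductive HeckeRel (b : R.Base) (A : Type*) [CommRing A] (q : A) :
    FreeAlgebra A (ExtAffineWeyl R) → FreeAlgebra A (ExtAffineWeyl R) → Prop
  | one : HeckeRel b A q (FreeAlgebra.ι A 1) 1
  | mul (w u : ExtAffineWeyl R) (h : len b (w * u) = len b w + len b u) :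
      HeckeRel b A q (FreeAlgebra.ι A w * FreeAlgebra.ι A u) (FreeAlgebra.ι A (w * u))
  | quad (s : ExtAffineWeyl R) (hs : s ∈ simpleReflections b) :
      HeckeRel b A q
        ((FreeAlgebra.ι A s - algebraMap A _ q) * (FreeAlgebra.ι A s + 1)) 0

/-- The Hecke algebra `H` of `(W, S)` over the commutative ring `A` with parameter `q`: the
`A`-algebra generated by the `T_w` (`w ∈ W`) with the relations `T_1 = 1`, `T_w T_u = T_{wu}` if
`l(wu) = l(w) + l(u)`, and `(T_s - q)(T_s + 1) = 0` for `s ∈ S`. -/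
abbrev Hecke (b : R.Base) (A : Type*) [CommRing A] (q : A) : Type _ := RingQuot (HeckeRel b A q)

/-- The standard basis element `T_w`. -/
def T (b : R.Base) (A : Type*) [CommRing A] (q : A) (w : ExtAffineWeyl R) : Hecke b A q :=
  RingQuot.mkAlgHom A (HeckeRel b A q) (FreeAlgebra.ι A w)

/-- The characterization of the family of Kazhdan–Lusztig polynomials `P_{y,w}` (`w` fixed, `y` in
`W`). In the Hecke algebra over `ℤ[v, v⁻¹]` with parameter `v²`, the element
`v^{-l(w)} ∑_y P_{y,w}(v²) T_y` is fixed by the bar involution, which is the ring automorphism with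
`v ↦ v⁻¹` and `T_y ↦ (T_{y⁻¹})⁻¹`. -/
structure IsKLFamily (b : R.Base) (w : ExtAffineWeyl R) (P : ExtAffineWeyl R →₀ ℤ[X]) :
    Prop where
  self : P w = 1
  support : ∀ y, P y ≠ 0 → BruhatLE b y w
  degree : ∀ y, P y ≠ 0 → y ≠ w → 2 * (P y).natDegree + len b y + 1 ≤ len b w
  bar :
    (P.sum fun y p => (LaurentPolynomial.T (-(len b w : ℤ)) *
        Polynomial.aeval (LaurentPolynomial.T 2 : ℤ[T;T⁻¹]) p) •
          T b ℤ[T;T⁻¹] (LaurentPolynomial.T 2) y) =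
      P.sum fun y p => (LaurentPolynomial.T (len b w : ℤ) *
        Polynomial.aeval (LaurentPolynomial.T (-2) : ℤ[T;T⁻¹]) p) •
          Ring.inverse (T b ℤ[T;T⁻¹] (LaurentPolynomial.T 2) y⁻¹)

/-- The Kazhdan–Lusztig polynomials: `klPoly b w y` is `P_{y,w}`. By the theorem of Kazhdan and
Lusztig there is exactly one family with the characterizing properties, and this is it. -/
def klPoly (b : R.Base) (w : ExtAffineWeyl R) : ExtAffineWeyl R →₀ ℤ[X] :=
  Classical.epsilon (IsKLFamily b w)

variable {k : Type*} [Field k]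

/-- `C_w = q^{-l(w)/2} ∑_{y ≤ w} P_{y,w}(q) T_y`, where `v` is the chosen square root of `q`. -/
def C (b : R.Base) (q v : k) (w : ExtAffineWeyl R) : Hecke b k q :=
  (v⁻¹ ^ len b w) • (klPoly b w).sum fun y p => (Polynomial.aeval q p) • T b k q y

/-- `C'_w = q^{l(w)/2} ∑_{y ≤ w} (-1)^{l(w)-l(y)} q^{-l(y)} P_{y,w}(q⁻¹) T_y`. -/
def C' (b : R.Base) (q v : k) (w : ExtAffineWeyl R) : Hecke b k q :=
  (v ^ len b w) • (klPoly b w).sum fun y p =>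
    ((-1) ^ (len b w - len b y) * q⁻¹ ^ len b y * Polynomial.aeval q⁻¹ p) • T b k q y

/-- `θ_x = q^{-l(y)/2} T_y q^{l(z)/2} T_z⁻¹`, where `y`, `z` are dominant weights with
`x = y - z` (it does not depend on their choice). -/
def theta [R.IsRootSystem] (b : R.Base) (q v : k) (x : weightLattice R) : Hecke b k q :=
  let y := (exists_dominant_sub b x).choose.1
  let z := (exists_dominant_sub b x).choose.2
  (v⁻¹ ^ len b (transl y) * v ^ len b (transl z)) •
    (T b k q (transl y) * Ring.inverse (T b k q (transl z)))

/-- The two-sided ideal of `H` generated by all `z - φ_t(z)`, for `z` in the center of `H`. Here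
`t` is a point of the torus `T = Hom(P, kˣ)`, the center of `H` lies in the span `Θ` of the `θ_x`
(which are linearly independent), and `φ_t : Θ → k` maps `θ_x` to `x(t)`. A finitely supported
family `f` of scalars stands for the element `∑ₓ f x • θ_x` of `Θ`. -/
def centralIdeal [R.IsRootSystem] (b : R.Base) (q v : k)
    (t : Multiplicative (weightLattice R) →* kˣ) : TwoSidedIdeal (Hecke b k q) :=
  TwoSidedIdeal.span {h | ∃ f : weightLattice R →₀ k,
    (f.sum fun x a => a • theta b q v x) ∈ Subalgebra.center k (Hecke b k q) ∧
    h = (f.sum fun x a => a • theta b q v x) -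
      algebraMap k _ (f.sum fun x a => a * (t (Multiplicative.ofAdd x) : k))}

/-- The quotient algebra `H_t`. -/
abbrev HeckeAt [R.IsRootSystem] (b : R.Base) (q v : k)
    (t : Multiplicative (weightLattice R) →* kˣ) : Type _ :=
  (centralIdeal b q v t).ringCon.Quotient

/-- The canonical map `H → H_t`. -/
def toHeckeAt [R.IsRootSystem] (b : R.Base) (q v : k)
    (t : Multiplicative (weightLattice R) →* kˣ) (h : Hecke b k q) : HeckeAt b q v t :=
  (centralIdeal b q v t).ringCon.mk' h

end HeckeAlgebra

/-- The subspace `c A d = {c a d | a ∈ A}` of an algebra `A`. -/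
def sandwich (k : Type*) {A : Type*} [Field k] [Ring A] [Algebra k A] (c d : A) : Submodule k A :=
  LinearMap.range (LinearMap.mulLeftRight k (c, d))

/-- The subspace `I` of the algebra `A` is a two-sided ideal. -/
def IsTwoSidedIdeal {k A : Type*} [Field k] [Ring A] [Algebra k A] (I : Submodule k A) : Prop :=
  ∀ a, ∀ x ∈ I, a * x ∈ I ∧ x * a ∈ I

end

end AffineHecke

set_option linter.unusedSectionVars false

namespace AffineHecke

noncomputable section

-- Let `a`, `c` be the two eigenvalues `q`, `-1` of the generators, in either order. The symmetrizer
-- `X = symm b q (-c⁻¹)` of the finite Hecke algebra satisfies `T_s X = X T_s = a X`, and `X' = symm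
-- b q (-a⁻¹)` is its counterpart with eigenvalue `c`. The Kazhdan–Lusztig polynomials of `w₀` are
-- all `1` on `W₀`, so `C` and `C'` are nonzero multiples of the two symmetrizers, and the theorem
-- is about `X H_t X'`.
--
-- The Bernstein relation (`T_mul_Theta`) gives `X H = X Θ`. The map `f ↦ X Θ(f)` on `k[P]` is
-- injective, and right multiplication by `T_s` becomes a Demazure–Lusztig operator. Summing these
-- operators over `W₀` produces a Weyl character formula (`psiSum_self`, `psiSum_other`): `X Θ(f)
-- X'` is a nonzero scalar times `X Θ(Q · nrm f)`, where `Q = qprod b c a` and `nrm f` is the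
-- alternating sum of `f` divided by the Weyl denominator. As `nrm f` is invariant, `Θ(nrm f)` is
-- central and becomes the number `ev t (nrm f)` in `H_t`; by the Pittie–Steinberg theorem
-- (`exists_steinberg_expansion`) this number is nonzero for some `f`. Hence `X H_t X'` is spanned
-- by `X Θ(Q)`. The same computation from the other side shows that this element is a multiple of
-- `Θ(Q') X'` with `Q' = qprod b a c`. The first shape shows that `T_s` acts on the left by `a`, the
-- second that it acts on the right by `c`.
--
-- For the action of `Θ`, let `I` be the ideal of `k[P]` generated by the `z - z(t)`, `z` invariant.
-- At a point `τ` with `α(τ) = -a/c` for all simple `α`, every Demazure–Lusztig operator evaluates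
-- to multiplication by `a`, so the value at `τ` of `nrm (Q' f)` is a nonzero multiple of `P ·
-- f(τ)`, where `P = ∑ (-a/c)^{l(w)}` (`ev_nrm_qprod`). Therefore all coefficients of `Q' (f -
-- f(τ))` in Steinberg's basis vanish at `τ`, and `Q' f ≡ f(τ) Q'` modulo `I` if `τ` and `t` agree
-- on invariants. For the two orders of `q`, `-1` the required points are `t` and `w₀ t`. So the
-- line is a two-sided ideal on which `H` acts by characters.
--
-- If `P = 0`, the same argument puts `Q` itself into `I`, and the generator dies. If `P ≠ 0` and `X
-- Θ(Q)` vanished in `H_t`, then multiplication by `X`, where `X² = P X`, and injectivity would give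
-- `Q ∈ I`. That is impossible: `nrm` sends `I` to functions vanishing at the special point, but
-- `nrm Q` does not vanish there.
--
-- The supporting facts are the description of the length by inversions of affine coroots, the
-- regular representation of `H`, which makes coordinates in the `T_w` available, and the
-- computation of Steinberg's determinant.

local notation "σ" => RootPairing.weylGroup.ofIdx

/-! ### Pairings, opposite roots and reflections -/

section Roots

variable {ι V V' : Type*} [AddCommGroup V] [Module ℝ V] [AddCommGroup V'] [Module ℝ V']
  {R : RootPairing ι ℝ V V'}

theorem pair_eq_iff {x : weightLattice R} {i : ι} {n : ℤ} :
    pair x i = n ↔ R.coroot' i (x : V) = n := by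
  rw [pair_spec]; exact_mod_cast Iff.rfl

@[simp] theorem pair_zero (i : ι) : pair (0 : weightLattice R) i = 0 := by
  rw [pair_eq_iff]; simp

@[simp] theorem pair_add (x y : weightLattice R) (i : ι) :
    pair (x + y) i = pair x i + pair y i := by
  rw [pair_eq_iff]; push_cast; rw [map_add, pair_spec, pair_spec]

@[simp] theorem pair_neg (x : weightLattice R) (i : ι) : pair (-x) i = -pair x i := by
  rw [pair_eq_iff]; push_cast; rw [map_neg, pair_spec]

@[simp] theorem pair_sub (x y : weightLattice R) (i : ι) :
    pair (x - y) i = pair x i - pair y i := by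
  rw [sub_eq_add_neg, pair_add, pair_neg, sub_eq_add_neg]

@[simp] theorem pair_zsmul (n : ℤ) (x : weightLattice R) (i : ι) :
    pair (n • x) i = n * pair x i := by
  rw [pair_eq_iff]; push_cast; rw [map_zsmul, pair_spec]; simp

@[simp] theorem pair_nsmul (n : ℕ) (x : weightLattice R) (i : ι) :
    pair (n • x) i = n * pair x i := by
  rw [pair_eq_iff]; push_cast; rw [map_nsmul, pair_spec]; simp

@[simp] theorem pair_sum {κ : Type*} (s : Finset κ) (f : κ → weightLattice R) (i : ι) :
    pair (∑ j ∈ s, f j) i = ∑ j ∈ s, pair (f j) i := by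
  classical
  induction s using Finset.induction_on with
  | empty => simp
  | insert a s ha ih => rw [Finset.sum_insert ha, Finset.sum_insert ha, pair_add, ih]

@[simp] theorem coe_smul (w : R.weylGroup) (x : weightLattice R) :
    ((w • x : weightLattice R) : V) = w • (x : V) := rfl

@[simp] theorem pair_smul (w : R.weylGroup) (x : weightLattice R) (i : ι) :
    pair (w • x) i = pair x (w⁻¹ • i) := by
  rw [pair_eq_iff, coe_smul, coroot'_smul, pair_spec]; rfl

theorem weyl_smul_root (w : R.weylGroup) (i : ι) : w • R.root i = R.root (w • i) :=
  R.weylGroup_apply_root w i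

variable (R) in
/-- The index of the opposite root. -/
def opp (i : ι) : ι := R.reflectionPerm i i

@[simp] theorem root_opp (i : ι) : R.root (opp R i) = -R.root i := by
  simp [opp]

@[simp] theorem coroot_opp (i : ι) : R.coroot (opp R i) = -R.coroot i := by
  simp [opp]

theorem opp_eq_iff {i j : ι} : opp R i = j ↔ R.root j = -R.root i := by
  rw [← root_opp, R.root.injective.eq_iff, eq_comm]

@[simp] theorem opp_opp (i : ι) : opp R (opp R i) = i := by
  rw [opp_eq_iff, root_opp, neg_neg]

theorem opp_injective : Function.Injective (opp R) :=
  Function.LeftInverse.injective opp_opp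

theorem coroot'_eq (i : ι) (x : V) : R.coroot' i x = R.toLinearMap x (R.coroot i) := rfl

@[simp] theorem pair_opp (x : weightLattice R) (i : ι) : pair x (opp R i) = -pair x i := by
  rw [pair_eq_iff, coroot'_eq, coroot_opp, map_neg, ← coroot'_eq, pair_spec]; simp

@[simp] theorem smul_opp (w : R.weylGroup) (i : ι) : w • opp R i = opp R (w • i) := by
  apply R.root.injective
  rw [← weyl_smul_root, root_opp, root_opp, ← weyl_smul_root, smul_neg]

@[simp] theorem refl_smul_idx (i j : ι) : σ R i • j = R.reflectionPerm i j := rfl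

theorem refl_smul_self (i : ι) : σ R i • i = opp R i := rfl

@[simp] theorem refl_mul_self (i : ι) : σ R i * σ R i = 1 :=
  Subtype.ext (by
    change RootPairing.Equiv.reflection R i * RootPairing.Equiv.reflection R i = 1
    rw [mul_eq_one_iff_inv_eq, RootPairing.Equiv.reflection_inv])

@[simp] theorem refl_inv (i : ι) : (σ R i)⁻¹ = σ R i :=
  inv_eq_of_mul_eq_one_left (refl_mul_self i)

theorem weyl_ext [R.IsRootSystem] {g h : R.weylGroup} (H : ∀ i : ι, g • i = h • i) : g = h := by
  apply Subtype.ext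
  apply RootPairing.Equiv.weightHom_injective R
  apply LinearEquiv.toLinearMap_injective
  apply LinearMap.ext_on_range (v := R.root) RootPairing.IsRootSystem.span_root_eq_top
  intro i
  have h1 := weyl_smul_root g i
  rw [H, ← weyl_smul_root] at h1
  exact h1

theorem weyl_ext_vec [R.IsRootSystem] {g h : R.weylGroup} (H : ∀ x : V, g • x = h • x) : g = h :=
  weyl_ext fun i => R.root.injective (by rw [← weyl_smul_root, ← weyl_smul_root, H])

theorem refl_smul_vec (i : ι) (x : V) : σ R i • x = x - R.coroot' i x • R.root i := by
  rw [RootPairing.weylGroup.ofIdx_smul, RootPairing.Equiv.reflection_smul,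
    RootPairing.reflection_apply]

theorem weyl_conj_refl [R.IsRootSystem] (w : R.weylGroup) (i : ι) :
    w * σ R i * w⁻¹ = σ R (w • i) := by
  apply weyl_ext_vec
  intro x
  rw [mul_smul, mul_smul, refl_smul_vec, refl_smul_vec, smul_sub, smul_inv_smul,
    ← weyl_smul_root, coroot'_smul]
  congr 1
  have : (R.weylGroupToPerm w⁻¹).symm i = w • i := by
    rw [map_inv]; rfl
  rw [this]
  exact smul_comm (w : R.Aut) (R.coroot' (w • i) x) (R.root i)

theorem refl_opp [R.IsRootSystem] (i : ι) : σ R (opp R i) = σ R i := by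
  have := weyl_conj_refl (R := R) (σ R i) i
  rw [refl_smul_self] at this
  rw [← this]; simp

variable [R.IsCrystallographic]

@[simp] theorem coe_rootWeight (i : ι) : ((rootWeight R i : weightLattice R) : V) = R.root i := rfl

theorem pair_rootWeight (i j : ι) : pair (rootWeight R i) j = R.pairingIn ℤ i j := by
  rw [pair_eq_iff, coe_rootWeight, R.root_coroot'_eq_pairing, ← R.algebraMap_pairingIn ℤ]; rfl

@[simp] theorem pair_rootWeight_self (i : ι) : pair (rootWeight R i) i = 2 := by
  rw [pair_rootWeight, R.pairingIn_same]

theorem refl_smul (i : ι) (x : weightLattice R) :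
    σ R i • x = x - pair x i • rootWeight R i := by
  apply Subtype.ext
  rw [coe_smul, refl_smul_vec, pair_spec]
  push_cast
  rw [coe_rootWeight, Int.cast_smul_eq_zsmul]

@[simp] theorem smul_rootWeight (w : R.weylGroup) (i : ι) :
    w • rootWeight R i = rootWeight R (w • i) :=
  Subtype.ext (by rw [coe_smul, coe_rootWeight, coe_rootWeight, weyl_smul_root])

@[simp] theorem rootWeight_opp (i : ι) : rootWeight R (opp R i) = -rootWeight R i :=
  Subtype.ext (by push_cast; rw [coe_rootWeight, coe_rootWeight, root_opp])

end Roots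

/-! ### Positive roots and words in the simple reflections -/

section Positive

variable {ι V V' : Type*} [AddCommGroup V] [Module ℝ V] [AddCommGroup V'] [Module ℝ V']
  {R : RootPairing ι ℝ V V'} (b : R.Base)

@[simp] theorem isPos_opp (i : ι) : b.IsPos (opp R i) ↔ ¬ b.IsPos i :=
  RootPairing.Base.IsPos.neg_iff_not b i

theorem isPos_simple {i : ι} (hi : i ∈ b.support) : b.IsPos i := b.isPos_of_mem_support hi

variable [Finite ι] [R.IsRootSystem] [R.IsCrystallographic] [R.IsReduced]

theorem isPos_refl {i j : ι} (hi : i ∈ b.support) (hij : j ≠ i) (hj : b.IsPos j) :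
    b.IsPos (σ R i • j) :=
  RootPairing.Base.IsPos.reflectionPerm hj hi hij

theorem isPos_refl_iff {i j : ι} (hi : i ∈ b.support) (hij : j ≠ i) (hij' : j ≠ opp R i) :
    b.IsPos (σ R i • j) ↔ b.IsPos j := by
  refine ⟨fun h => ?_, isPos_refl b hi hij⟩
  by_contra hj
  rw [← isPos_opp] at hj
  have := isPos_refl b hi (fun h => hij' (by rw [← h, opp_opp])) hj
  rw [smul_opp, isPos_opp] at this
  exact this h

/-- Every root is reached from the simple ones by sign changes and simple reflections, and both
notions of positivity react to these in the same way. Facts about sums of positive roots thereby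
carry over to coroots. -/
theorem isPos_flip_iff (i : ι) : b.flip.IsPos i ↔ b.IsPos i := by
  refine b.induction_reflect i (p := fun i => b.flip.IsPos i ↔ b.IsPos i) ?_ ?_ ?_
  · intro i h
    have h1 := isPos_opp b i
    have h2 := isPos_opp b.flip i
    unfold opp at h1 h2
    rw [h1, ← h, ← h2]; rfl
  · intro i hi
    exact ⟨fun _ => isPos_simple b hi, fun _ => isPos_simple b.flip hi⟩
  · intro i j h hj
    have h1 := isPos_opp b j
    have h2 := isPos_opp b.flip j
    have hjs := isPos_simple b hj
    have hjs' := isPos_simple b.flip hj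
    by_cases e1 : i = j
    · subst e1
      unfold opp at h1 h2
      rw [h1, ← h, ← h2]; rfl
    · by_cases e2 : i = opp R j
      · have e3 : R.reflectionPerm j i = j := by
          rw [e2]; simp [opp]
        rw [e3]; exact ⟨fun _ => hjs, fun _ => hjs'⟩
      · have h3 := isPos_refl_iff b hj e1 e2
        have h4 := isPos_refl_iff b.flip hj e1 e2
        rw [refl_smul_idx] at h3 h4
        rw [h3, ← h, ← h4]; rfl

theorem pair_nonneg {x : weightLattice R} (hx : IsDominant b x) {j : ι} (hj : b.IsPos j) :
    0 ≤ pair x j := by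
  rw [← isPos_flip_iff] at hj
  refine hj.induction_on_add (p := fun j => 0 ≤ pair x j) hx ?_
  intro i j k hk hi hj
  have : pair x k = pair x i + pair x j := by
    rw [pair_eq_iff, coroot'_eq, show R.coroot k = R.coroot i + R.coroot j from hk, map_add]
    push_cast
    rw [← pair_spec, ← pair_spec]; rfl
  rw [this]
  have := hx j hj
  linarith

theorem weight_ext {x y : weightLattice R} (h : ∀ i ∈ b.support, pair x i = pair y i) : x = y := by
  apply Subtype.ext
  apply R.toPerfPair.injective
  refine b.toCoweightBasis.ext fun i => ?_
  rw [b.toCoweightBasis_apply]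
  change R.coroot' i (x : V) = R.coroot' i (y : V)
  rw [pair_spec, pair_spec, h i i.2]

/-- The product of the simple reflections of a word. -/
def wordProd (R : RootPairing ι ℝ V V') (L : List ι) : R.weylGroup := (L.map fun i => σ R i).prod

theorem wordProd_cons (i : ι) (L : List ι) : wordProd R (i :: L) = σ R i * wordProd R L := by
  simp [wordProd]

theorem wordProd_append (L M : List ι) : wordProd R (L ++ M) = wordProd R L * wordProd R M := by
  simp [wordProd]

/-- The deletion step of the exchange condition. -/
theorem exists_shorter_word (L : List ι) (hL : ∀ i ∈ L, i ∈ b.support) {j : ι}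
    (hj : j ∈ b.support) (h : ¬ b.IsPos (wordProd R L • j)) :
    ∃ L' : List ι, (∀ i ∈ L', i ∈ b.support) ∧ L'.length + 1 = L.length ∧
      wordProd R L * σ R j = wordProd R L' := by
  induction L with
  | nil =>
    exfalso; apply h
    simpa [wordProd] using isPos_simple b hj
  | cons i M ih =>
    have hM : ∀ i ∈ M, i ∈ b.support := fun k hk => hL k (List.mem_cons_of_mem _ hk)
    have hi : i ∈ b.support := hL i List.mem_cons_self
    by_cases h' : b.IsPos (wordProd R M • j)
    · refine ⟨M, hM, rfl, ?_⟩
      -- A simple reflection makes only its own positive root negative, so the root that changes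
      -- sign at this letter is `i`. Then `σ R i` is conjugate to `σ R j` under the remaining word
      -- and cancels on the right.
      have hβ : wordProd R M • j = i := by
        by_contra hne
        apply h
        rw [wordProd_cons, mul_smul]
        exact isPos_refl b hi hne h'
      have := weyl_conj_refl (wordProd R M) j
      rw [hβ] at this
      rw [wordProd_cons, ← this]
      have h2 : σ R j * σ R j = 1 := refl_mul_self j
      simp only [mul_assoc, inv_mul_cancel_left, h2, mul_one]
    · obtain ⟨M', h1, h2, h3⟩ := ih hM h'
      refine ⟨i :: M', ?_, ?_, ?_⟩
      · intro k hk
        rcases List.mem_cons.1 hk with rfl | hk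
        · exact hi
        · exact h1 k hk
      · simp [← h2]
      · rw [wordProd_cons, wordProd_cons, mul_assoc, h3]

theorem refl_mem_closure (i : ι) :
    ∃ w : R.weylGroup, w ∈ Subgroup.closure (Set.range fun i : b.support => σ R i) ∧
      ∃ j ∈ b.support, i = w • j := by
  refine b.induction_reflect i (p := fun i => ∃ w : R.weylGroup,
    w ∈ Subgroup.closure (Set.range fun i : b.support => σ R i) ∧ ∃ j ∈ b.support, i = w • j) ?_ ?_ ?_
  · rintro i ⟨w, hw, j, hj, rfl⟩
    refine ⟨w * σ R j, mul_mem hw (Subgroup.subset_closure ⟨⟨j, hj⟩, rfl⟩), j, hj, ?_⟩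
    rw [mul_smul, refl_smul_self, smul_opp]; rfl
  · exact fun i hi => ⟨1, one_mem _, i, hi, by simp⟩
  · rintro i j ⟨w, hw, k, hk, rfl⟩ hj
    exact ⟨σ R j * w, mul_mem (Subgroup.subset_closure ⟨⟨j, hj⟩, rfl⟩) hw, k, hk, by
      rw [mul_smul]; rfl⟩

theorem exists_weyl_smul_simple (i : ι) : ∃ w : R.weylGroup, ∃ j ∈ b.support, i = w • j := by
  obtain ⟨w, -, h⟩ := refl_mem_closure b i
  exact ⟨w, h⟩

theorem closure_simple :
    Subgroup.closure (Set.range fun i : b.support => σ R i) = ⊤ := by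
  rw [eq_top_iff]
  rintro ⟨w, hw⟩ -
  induction hw using RootPairing.weylGroup.induction with
  | mem i =>
    obtain ⟨u, hu, j, hj, rfl⟩ := refl_mem_closure b i
    change σ R (u • j) ∈ _
    rw [← weyl_conj_refl]
    exact mul_mem (mul_mem hu (Subgroup.subset_closure ⟨⟨j, hj⟩, rfl⟩)) (inv_mem hu)
  | one => exact one_mem _
  | mul x y hx hy h1 h2 => exact mul_mem h1 h2

theorem exists_word (w : R.weylGroup) :
    ∃ L : List ι, (∀ i ∈ L, i ∈ b.support) ∧ wordProd R L = w := by
  have hw : w ∈ Subgroup.closure (Set.range fun i : b.support => σ R i) := by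
    rw [closure_simple]; trivial
  induction hw using Subgroup.closure_induction'' with
  | mem x hx =>
    obtain ⟨i, rfl⟩ := hx
    exact ⟨[i], by simp, by simp [wordProd]⟩
  | inv_mem x hx =>
    obtain ⟨i, rfl⟩ := hx
    exact ⟨[i], by simp, by simp [wordProd]⟩
  | one => exact ⟨[], by simp, by simp [wordProd]⟩
  | mul x y hx hy h1 h2 =>
    obtain ⟨L, hL, rfl⟩ := h1
    obtain ⟨M, hM, rfl⟩ := h2
    refine ⟨L ++ M, ?_, wordProd_append L M⟩
    intro i hi
    rcases List.mem_append.1 hi with hi | hi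
    exacts [hL i hi, hM i hi]

/-- The Weyl group acts simply transitively on bases: only `1` preserves positivity. -/
theorem eq_one_of_isPos {u : R.weylGroup} (h : ∀ i ∈ b.support, b.IsPos (u • i)) : u = 1 := by
  classical
  by_contra hu
  have hex : ∃ n, ∃ L : List ι, (∀ i ∈ L, i ∈ b.support) ∧ wordProd R L = u ∧ L.length = n := by
    obtain ⟨L, h1, h2⟩ := exists_word b u
    exact ⟨_, L, h1, h2, rfl⟩
  obtain ⟨L, h1, h2, h3⟩ := Nat.find_spec hex
  have hmin := fun m hm => Nat.find_min hex (m := m) hm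
  rcases List.eq_nil_or_concat L with rfl | ⟨M, j, rfl⟩
  · exact hu (by rw [← h2]; simp [wordProd])
  · have hj : j ∈ b.support := h1 j (by simp)
    have hM : ∀ i ∈ M, i ∈ b.support := fun i hi => h1 i (by simp [hi])
    have e : u = wordProd R M * σ R j := by
      rw [← h2, List.concat_eq_append, wordProd_append]; simp [wordProd]
    -- The word is shortest and ends in `j`. Positivity of `u • j` makes `wordProd R M • j`
    -- negative, and the deletion step then yields a shorter word.
    have h4 := h j hj
    rw [e, mul_smul, refl_smul_self, smul_opp, isPos_opp] at h4
    obtain ⟨L', h5, h6, h7⟩ := exists_shorter_word b M hM hj h4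
    refine hmin L'.length ?_ ⟨L', h5, by rw [e, h7], rfl⟩
    rw [← h3]; simp; omega

theorem weyl_induction {p : R.weylGroup → Prop} (one : p 1)
    (mul : ∀ i ∈ b.support, ∀ w, p w → p (σ R i * w)) (w : R.weylGroup) : p w := by
  obtain ⟨L, hL, rfl⟩ := exists_word b w
  induction L with
  | nil => simpa [wordProd] using one
  | cons i L ih =>
    rw [wordProd_cons]
    exact mul i (hL i (by simp)) _ (ih fun j hj => hL j (by simp [hj]))

end Positive

/-! ### The highest coroot and the weight ρ -/

section Highest

variable {ι V V' : Type*} [AddCommGroup V] [Module ℝ V] [AddCommGroup V'] [Module ℝ V']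
  {R : RootPairing ι ℝ V V'} (b : R.Base)
  [Finite ι] [R.IsRootSystem] [R.IsCrystallographic] [R.IsReduced]

theorem exists_root_sum_nonneg {i : ι} (hi : b.IsPos i) :
    ∃ f : ι → ℤ, (∀ j, 0 ≤ f j) ∧ R.root i = ∑ j ∈ b.support, f j • R.root j := by
  obtain ⟨f, -, h1, h2⟩ := b.exists_root_eq_sum_int i
  refine ⟨f, ?_, h2⟩
  rcases h1 with h1 | h1
  · exact fun j => h1.le j
  · exfalso
    have := RootPairing.Base.height_eq_sum h2
    rw [RootPairing.Base.isPos_iff, this] at hi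
    exact absurd hi (not_lt.2 (Finset.sum_nonpos fun j _ => h1.le j))

theorem exists_coroot_sum_nonneg {i : ι} (hi : b.IsPos i) :
    ∃ f : ι → ℤ, (∀ j, 0 ≤ f j) ∧ R.coroot i = ∑ j ∈ b.support, f j • R.coroot j := by
  rw [← isPos_flip_iff] at hi
  exact exists_root_sum_nonneg b.flip hi

theorem coroot_mem_closure {i : ι} (hi : b.IsPos i) :
    R.coroot i ∈ AddSubmonoid.closure (R.coroot '' b.support) := by
  obtain ⟨f, h1, h2⟩ := exists_coroot_sum_nonneg b hi
  rw [h2]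
  refine sum_mem fun j hj => ?_
  obtain ⟨n, hn⟩ := Int.eq_ofNat_of_zero_le (h1 j)
  rw [hn, natCast_zsmul]
  have hj' : R.coroot j ∈ AddSubmonoid.closure (R.coroot '' b.support) :=
    AddSubmonoid.subset_closure ⟨j, hj, rfl⟩
  exact nsmul_mem hj' n

/-- `β^∨` has maximal height among the coroots that dominate it. -/
def IsMaxCoroot (β : ι) : Prop :=
  ∀ δ, R.coroot δ - R.coroot β ∈ AddSubmonoid.closure (R.coroot '' b.support) →
    b.flip.height δ ≤ b.flip.height β

theorem exists_isMaxCoroot (γ : ι) : ∃ β, IsMaxCoroot b β ∧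
    R.coroot β - R.coroot γ ∈ AddSubmonoid.closure (R.coroot '' b.support) := by
  have hne : {δ | R.coroot δ - R.coroot γ ∈
      AddSubmonoid.closure (R.coroot '' b.support)}.Nonempty := ⟨γ, by simp⟩
  obtain ⟨β, hβ, hmax⟩ := Set.exists_max_image _ (fun δ => b.flip.height δ) (Set.toFinite _) hne
  refine ⟨β, fun δ hδ => hmax δ ?_, hβ⟩
  have := add_mem hδ hβ
  rwa [sub_add_sub_cancel] at this

variable {b}

theorem IsMaxCoroot.isPos {β : ι} (hβ : IsMaxCoroot b β) : b.IsPos β := by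
  by_contra h
  have h' : b.IsPos (opp R β) := by rwa [isPos_opp]
  have h1 := hβ (opp R β) (by
    have := coroot_mem_closure b h'
    have := add_mem this this
    rw [coroot_opp] at this ⊢
    rwa [sub_eq_add_neg])
  rw [← isPos_flip_iff] at h h'
  rw [RootPairing.Base.isPos_iff] at h h'
  linarith

theorem IsMaxCoroot.add_notMem {β i : ι} (hβ : IsMaxCoroot b β) (hi : i ∈ b.support) :
    R.coroot β + R.coroot i ∉ Set.range R.coroot := by
  rintro ⟨δ, hδ⟩
  have h1 := hβ δ (by
    rw [hδ, add_sub_cancel_left]; exact AddSubmonoid.subset_closure ⟨i, hi, rfl⟩)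
  have h2 := b.flip.height_add (i := β) (j := i) (k := δ) hδ
  have h3 := RootPairing.Base.height_one_of_mem_support (b := b.flip) (i := i) hi
  rw [h2, h3] at h1
  linarith

theorem pairingIn_flip (i j : ι) : R.flip.pairingIn ℤ i j = R.pairingIn ℤ j i := by
  have h1 := R.flip.algebraMap_pairingIn ℤ i j
  have h2 := R.algebraMap_pairingIn ℤ j i
  rw [RootPairing.pairing_flip, ← h2] at h1
  exact_mod_cast h1

theorem IsMaxCoroot.pairingIn_nonneg {β i : ι} (hβ : IsMaxCoroot b β) (hi : i ∈ b.support) :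
    0 ≤ R.pairingIn ℤ i β := by
  by_contra! h
  rw [← pairingIn_flip] at h
  refine hβ.add_notMem hi (R.flip.root_add_root_mem_of_pairingIn_neg h ?_)
  intro h2
  have h3 : opp R i = β := by
    rw [← R.coroot.injective.eq_iff, coroot_opp]; exact h2.symm
  have h4 := hβ.isPos
  rw [← h3, isPos_opp] at h4
  exact h4 (isPos_simple b hi)

theorem pairingIn_eq_sum {i j : ι} {f : ι → ℤ}
    (h : R.coroot j = ∑ l ∈ b.support, f l • R.coroot l) :
    R.pairingIn ℤ i j = ∑ l ∈ b.support, f l * R.pairingIn ℤ i l := by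
  have : (R.pairing i j) = ∑ l ∈ b.support, f l * R.pairing i l := by
    rw [← R.root_coroot_eq_pairing, h, map_sum]
    refine Finset.sum_congr rfl fun l _ => ?_
    rw [map_zsmul, R.root_coroot_eq_pairing, zsmul_eq_mul]
  simp only [← R.algebraMap_pairingIn ℤ] at this
  simp only [eq_intCast] at this
  exact_mod_cast this

/-- A simple root whose coefficient is zero pairs with `β^∨` to a sum of nonpositive terms, while
maximality makes the pairing nonnegative; so it is orthogonal to all simple coroots that do occur.
The span of those is then stable under all simple reflections, and irreducibility makes it the whole
space. -/
theorem IsMaxCoroot.full_support [R.IsIrreducible] {β : ι} (hβ : IsMaxCoroot b β) {f : ι → ℤ}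
    (hf : ∀ j, 0 ≤ f j) (h : R.coroot β = ∑ l ∈ b.support, f l • R.coroot l) :
    ∀ i ∈ b.support, 0 < f i := by
  set S : Set ι := {i | i ∈ b.support ∧ 0 < f i} with hS
  have horth : ∀ j ∈ b.support, j ∉ S → ∀ i ∈ S, R.pairingIn ℤ j i = 0 := by
    intro j hj hjS
    have hj0 : f j = 0 := by
      by_contra hne
      exact hjS ⟨hj, lt_of_le_of_ne (hf j) (Ne.symm hne)⟩
    have hterm : ∀ l ∈ b.support, f l * R.pairingIn ℤ j l ≤ 0 := by
      intro l hl
      by_cases hlj : l = j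
      · rw [hlj, hj0, zero_mul]
      · exact mul_nonpos_of_nonneg_of_nonpos (hf l)
          (b.pairingIn_le_zero_of_ne (Ne.symm hlj) hj hl)
    have hsum := pairingIn_eq_sum (i := j) h
    have hnn := hβ.pairingIn_nonneg hj
    have hz : ∑ l ∈ b.support, f l * R.pairingIn ℤ j l = 0 :=
      le_antisymm (Finset.sum_nonpos hterm) (hsum ▸ hnn)
    rw [Finset.sum_eq_zero_iff_of_nonpos hterm] at hz
    intro i hi
    exact (mul_eq_zero.1 (hz i hi.1)).resolve_left hi.2.ne'
  set q : Submodule ℝ V' := Submodule.span ℝ (R.coroot '' S) with hq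
  have hinv : ∀ i ∈ b.flip.support, q ∈ Module.End.invtSubmodule (R.flip.reflection i) := by
    intro j hj
    by_cases hjS : j ∈ S
    · exact Submodule.mem_invtSubmodule_reflection_of_mem _ _
        (Submodule.subset_span ⟨j, hjS, rfl⟩)
    · rw [Module.End.mem_invtSubmodule]
      rw [hq, Submodule.span_le]
      rintro _ ⟨i, hi, rfl⟩
      change R.flip.reflection j (R.coroot i) ∈ q
      have h1 : R.flip.reflection j (R.coroot i) = R.coroot i := by
        have := R.flip.reflection_apply_root' ℤ (i := j) (j := i)
        rw [pairingIn_flip, horth j hj hjS i hi, zero_smul, sub_zero] at this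
        exact this
      rw [h1]
      exact Submodule.subset_span ⟨i, hi, rfl⟩
  have hne : q ≠ ⊥ := by
    intro hbot
    have : R.coroot β ∈ q := by
      rw [h]
      refine sum_mem fun l hl => ?_
      by_cases hl0 : f l = 0
      · rw [hl0, zero_smul]; exact zero_mem _
      · have hl' : R.coroot l ∈ q :=
          Submodule.subset_span ⟨l, ⟨hl, lt_of_le_of_ne (hf l) (Ne.symm hl0)⟩, rfl⟩
        exact zsmul_mem hl' _
    rw [hbot, Submodule.mem_bot] at this
    exact R.ne_zero' β this
  have htop : q = ⊤ := RootPairing.IsIrreducible.eq_top_of_invtSubmodule_reflection (P := R.flip) q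
    ((b.flip.forall_mem_support_invtSubmodule_iff q).1 hinv) hne
  intro i hi
  by_contra hcon
  have hiS : i ∉ S := fun h => hcon h.2
  have hmem : R.coroot i ∈ Submodule.span ℝ (R.coroot '' S) := by
    rw [← hq, htop]; trivial
  have hsub : insert i S ⊆ (b.support : Set ι) :=
    Set.insert_subset hi fun j hj => hj.1
  exact (b.linearIndepOn_coroot.mono hsub).notMem_span_of_insert hiS hmem

/-- Two different maximal coroots would pair positively, because one of them has full support and
the other pairs nonnegatively with all simple coroots. Their difference would be a coroot, so one
would lie strictly above the other. -/
theorem IsMaxCoroot.unique [R.IsIrreducible] {β γ : ι} (hβ : IsMaxCoroot b β)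
    (hγ : IsMaxCoroot b γ) : β = γ := by
  by_contra hne
  obtain ⟨f, hf, hsum⟩ := exists_coroot_sum_nonneg b hγ.isPos
  have hfull := hγ.full_support hf hsum
  have hpos : 0 < R.pairingIn ℤ β γ := by
    rw [pairingIn_eq_sum hsum]
    have hnn : ∀ i ∈ b.support, 0 ≤ R.pairingIn ℤ β i := by
      intro i hi
      by_contra! h
      rw [R.pairingIn_lt_zero_iff ℤ] at h
      exact absurd (hβ.pairingIn_nonneg hi) (not_le.2 h)
    obtain ⟨j, hj, hj0⟩ := hβ.isPos.exists_mem_support_pos_pairingIn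
    rw [R.zero_lt_pairingIn_iff' ℤ] at hj0
    exact Finset.sum_pos' (fun i hi => mul_nonneg (hf i) (hnn i hi))
      ⟨j, hj, mul_pos (hfull j hj) hj0⟩
  rw [← pairingIn_flip] at hpos
  obtain ⟨δ, hδ⟩ := R.flip.root_sub_root_mem_of_pairingIn_pos hpos (Ne.symm hne)
  have hδ' : R.coroot δ = R.coroot γ - R.coroot β := hδ
  by_cases h : b.IsPos δ
  · have h1 := hβ γ (by rw [← hδ']; exact coroot_mem_closure b h)
    have h2 := b.flip.height_sub hδ
    rw [← isPos_flip_iff, RootPairing.Base.isPos_iff] at h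
    linarith
  · have h1 := hγ β (by
      rw [← isPos_opp] at h
      have := coroot_mem_closure b h
      rwa [coroot_opp, hδ', neg_sub] at this)
    have h2 := b.flip.height_sub hδ
    rw [← isPos_flip_iff, RootPairing.Base.isPos_iff] at h
    have h3 := b.flip.height_ne_zero δ
    omega

variable (b) in
theorem exists_isHighestCoroot [R.IsIrreducible] : ∃ β, IsHighestCoroot b β := by
  have : Nontrivial V := RootPairing.IsIrreducible.nontrivial R
  have : Nonempty ι := by
    by_contra h
    rw [not_nonempty_iff] at h
    have h1 := RootPairing.IsRootSystem.span_root_eq_top (P := R)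
    rw [Set.range_eq_empty, Submodule.span_empty] at h1
    exact bot_ne_top h1
  obtain ⟨β, hβ, -⟩ := exists_isMaxCoroot b (Classical.arbitrary ι)
  refine ⟨β, fun γ => ?_⟩
  obtain ⟨β', hβ', h⟩ := exists_isMaxCoroot b γ
  rwa [hβ.unique hβ']

variable (b) in
/-- The weight that pairs to `1` with every simple coroot. -/
def rho : weightLattice R := (exists_weight b fun _ => 1).choose

theorem pair_rho {i : ι} (hi : i ∈ b.support) : pair (rho b) i = 1 :=
  (exists_weight b fun _ => 1).choose_spec i hi

theorem pair_coroot_add {i j k : ι} {n : ℤ} (x : weightLattice R)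
    (h : R.coroot k = R.coroot i + n • R.coroot j) : pair x k = pair x i + n * pair x j := by
  rw [pair_eq_iff, coroot'_eq, h, map_add, map_zsmul, zsmul_eq_mul]
  push_cast
  rw [← pair_spec, ← pair_spec]; rfl

theorem one_le_pair {x : weightLattice R} (hx : ∀ i ∈ b.support, 1 ≤ pair x i) {j : ι}
    (hj : b.IsPos j) : 1 ≤ pair x j := by
  rw [← isPos_flip_iff] at hj
  refine hj.induction_on_add (p := fun j => 1 ≤ pair x j) hx ?_
  intro _ j k hk hi hj
  rw [pair_coroot_add (n := 1) x (by rw [one_smul]; exact hk)]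
  have := hx j hj
  linarith

theorem one_le_pair_rho {j : ι} (hj : b.IsPos j) : 1 ≤ pair (rho b) j :=
  one_le_pair (fun _ hi => (pair_rho hi).ge) hj

theorem isPos_iff_pair_rho {j : ι} : b.IsPos j ↔ 0 < pair (rho b) j := by
  refine ⟨fun h => one_le_pair_rho h, fun h => ?_⟩
  by_contra hj
  rw [← isPos_opp] at hj
  have := one_le_pair_rho hj
  rw [pair_opp] at this
  linarith

theorem refl_smul_rho {i : ι} (hi : i ∈ b.support) : σ R i • rho b = rho b - rootWeight R i := by
  rw [refl_smul, pair_rho hi, one_smul]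

theorem eq_zero_or_pos_of_mem_closure {c : V'}
    (hc : c ∈ AddSubmonoid.closure (R.coroot '' b.support)) :
    c = 0 ∨ 0 < R.toLinearMap (rho b : V) c := by
  induction hc using AddSubmonoid.closure_induction with
  | mem c hc =>
    obtain ⟨i, hi, rfl⟩ := hc
    right
    rw [← coroot'_eq, pair_spec, pair_rho hi]; norm_num
  | zero => exact Or.inl rfl
  | add c d _ _ h1 h2 =>
    rcases h1 with rfl | h1
    · rwa [zero_add]
    · rcases h2 with rfl | h2
      · rw [add_zero]; exact Or.inr h1
      · right; rw [map_add]; linarith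

theorem coroot_refl (i j : ι) :
    R.coroot (σ R i • j) = R.coroot j + (-pair (rootWeight R i) j) • R.coroot i := by
  rw [refl_smul_idx, R.coroot_reflectionPerm, R.coreflection_apply_coroot, neg_smul,
    ← sub_eq_add_neg, pair_rootWeight, ← Int.cast_smul_eq_zsmul ℝ, ← R.algebraMap_pairingIn ℤ]
  rfl

theorem pair_refl (x : weightLattice R) (i j : ι) :
    pair x (σ R i • j) = pair x j - pair (rootWeight R i) j * pair x i := by
  rw [pair_coroot_add x (coroot_refl i j)]; ring

section

variable {β : ι} (hβ : IsHighestCoroot b β)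
include hβ

theorem IsHighestCoroot.pair_rho_le (j : ι) : pair (rho b) j ≤ pair (rho b) β := by
  have h : 0 ≤ R.toLinearMap (rho b : V) (R.coroot β - R.coroot j) := by
    rcases eq_zero_or_pos_of_mem_closure (hβ j) with h | h
    · rw [h, map_zero]
    · exact h.le
  rw [map_sub, ← coroot'_eq, ← coroot'_eq, pair_spec, pair_spec, sub_nonneg] at h
  exact_mod_cast h

theorem IsHighestCoroot.eq_of_pair_rho {j : ι} (h : pair (rho b) β ≤ pair (rho b) j) : j = β := by
  rcases eq_zero_or_pos_of_mem_closure (hβ j) with h1 | h1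
  · exact (R.coroot.injective (sub_eq_zero.1 h1)).symm
  · rw [map_sub, ← coroot'_eq, ← coroot'_eq, pair_spec, pair_spec, sub_pos] at h1
    exact absurd h (not_le.2 (by exact_mod_cast h1))

theorem IsHighestCoroot.isPos : b.IsPos β := by
  by_contra h
  rw [← isPos_opp, isPos_iff_pair_rho, pair_opp] at h
  have := hβ.pair_rho_le (opp R β)
  rw [pair_opp] at this
  linarith

theorem IsHighestCoroot.pair_nonneg {j : ι} (hj : b.IsPos j) : 0 ≤ pair (rootWeight R β) j := by
  by_contra! h
  have h1 := hβ.pair_rho_le (σ R β • j)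
  rw [pair_refl] at h1
  have h2 := isPos_iff_pair_rho.1 hj
  have h3 := isPos_iff_pair_rho.1 hβ.isPos
  nlinarith

/-- Reflection in `β` raises the ρ-height of `αⱼ^∨` by `-⟨β, αⱼ^∨⟩` times the maximal height. A rise
by twice the maximum is possible only from the lowest coroot. This bound controls the affine simple
reflection. -/
theorem IsHighestCoroot.neg_one_le {j : ι} (hj : j ≠ opp R β) :
    -1 ≤ pair (rootWeight R β) j := by
  by_contra! h
  have h1 := hβ.pair_rho_le (σ R β • j)
  rw [pair_refl] at h1
  have h3 := isPos_iff_pair_rho.1 hβ.isPos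
  apply hj
  rw [← opp_opp (R := R) j, opp_injective.eq_iff]
  apply hβ.eq_of_pair_rho
  rw [pair_opp]
  nlinarith

theorem IsHighestCoroot.isPos_refl {j : ι} (hj : pair (rootWeight R β) j = -1) :
    b.IsPos (σ R β • j) := by
  have h1 := eq_zero_or_pos_of_mem_closure (hβ (opp R j))
  have h2 : R.coroot (σ R β • j) = R.coroot β - R.coroot (opp R j) := by
    rw [coroot_refl, hj, coroot_opp]; simp [add_comm]
  rw [← h2] at h1
  rcases h1 with h1 | h1
  · exact absurd h1 (R.ne_zero' _)
  · rw [isPos_iff_pair_rho]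
    rw [← coroot'_eq, pair_spec] at h1
    exact_mod_cast h1

end

end Highest

/-! ### Affine coroots, inversions and the length function -/

section Affine

variable {ι V V' : Type*} [AddCommGroup V] [Module ℝ V] [AddCommGroup V'] [Module ℝ V']
  {R : RootPairing ι ℝ V V'}

/-- The action of the extended affine Weyl group on affine coroots: the pair `(i, n)` stands for
the affine function `αᵢ^∨ + n`. -/
def aff (g : ExtAffineWeyl R) (a : ι × ℤ) : ι × ℤ :=
  (g.right • a.1, a.2 - pair g.left.toAdd (g.right • a.1))

theorem left_mul (g h : ExtAffineWeyl R) :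
    (g * h).left.toAdd = g.left.toAdd + g.right • h.left.toAdd := rfl

theorem right_mul (g h : ExtAffineWeyl R) : (g * h).right = g.right * h.right := rfl

theorem left_inv (g : ExtAffineWeyl R) :
    (g⁻¹).left.toAdd = g.right⁻¹ • (-g.left.toAdd) := rfl

theorem right_inv (g : ExtAffineWeyl R) : (g⁻¹).right = g.right⁻¹ := rfl

@[simp] theorem left_transl (x : weightLattice R) : (transl x).left.toAdd = x := rfl
@[simp] theorem right_transl (x : weightLattice R) : (transl x).right = 1 := rfl
@[simp] theorem left_fin (w : R.weylGroup) : (fin w).left.toAdd = 0 := rfl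
@[simp] theorem right_fin (w : R.weylGroup) : (fin w).right = w := rfl

theorem ext_iff {g h : ExtAffineWeyl R} :
    g = h ↔ g.left.toAdd = h.left.toAdd ∧ g.right = h.right := by
  constructor
  · rintro rfl; exact ⟨rfl, rfl⟩
  · rintro ⟨h1, h2⟩
    exact SemidirectProduct.ext h1 h2

theorem fin_mul (u w : R.weylGroup) : fin (u * w) = fin u * fin w := map_mul _ u w

@[simp] theorem fin_one : fin (1 : R.weylGroup) = 1 := rfl

theorem fin_inv (u : R.weylGroup) : fin u⁻¹ = (fin u)⁻¹ := map_inv SemidirectProduct.inr u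

theorem fin_injective : Function.Injective (fin : R.weylGroup → ExtAffineWeyl R) :=
  SemidirectProduct.inr_injective

theorem transl_add (x y : weightLattice R) : transl (x + y) = transl x * transl y := by
  rw [ext_iff]; simp

@[simp] theorem transl_zero : transl (0 : weightLattice R) = 1 := rfl

theorem transl_neg (x : weightLattice R) : transl (-x) = (transl x)⁻¹ := by
  rw [eq_inv_iff_mul_eq_one, ← transl_add]; simp

theorem fin_mul_transl (u : R.weylGroup) (x : weightLattice R) :
    fin u * transl x = transl (u • x) * fin u := by
  rw [ext_iff]
  simp only [left_mul, right_mul, left_fin, right_fin, left_transl, right_transl, smul_zero,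
    zero_add, add_zero, one_mul, mul_one, and_self]

theorem eq_transl_mul_fin (g : ExtAffineWeyl R) : g = transl g.left.toAdd * fin g.right := by
  rw [ext_iff]; simp

@[simp] theorem aff_one (a : ι × ℤ) : aff (1 : ExtAffineWeyl R) a = a := by
  ext
  · simp [aff]
  · change a.2 - pair (0 : weightLattice R) _ = a.2
    simp

theorem aff_mul (g h : ExtAffineWeyl R) (a : ι × ℤ) : aff (g * h) a = aff g (aff h a) := by
  ext
  · simp [aff, mul_smul]
  · simp only [aff, right_mul, left_mul, pair_add, pair_smul, mul_smul, inv_smul_smul]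
    ring

@[simp] theorem aff_inv_aff (g : ExtAffineWeyl R) (a : ι × ℤ) : aff g⁻¹ (aff g a) = a := by
  rw [← aff_mul, inv_mul_cancel, aff_one]

@[simp] theorem aff_aff_inv (g : ExtAffineWeyl R) (a : ι × ℤ) : aff g (aff g⁻¹ a) = a := by
  rw [← aff_mul, mul_inv_cancel, aff_one]

theorem aff_injective (g : ExtAffineWeyl R) : Function.Injective (aff g) :=
  Function.LeftInverse.injective (aff_inv_aff g)

theorem aff_inv (g : ExtAffineWeyl R) (a : ι × ℤ) :
    aff g⁻¹ a = (g.right⁻¹ • a.1, a.2 + pair g.left.toAdd a.1) := by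
  ext
  · rfl
  · simp only [aff, right_inv, left_inv, pair_smul, inv_inv, smul_inv_smul, pair_neg, sub_neg_eq_add]

variable (R) in
/-- The opposite affine coroot. -/
def aopp (a : ι × ℤ) : ι × ℤ := (opp R a.1, -a.2)

@[simp] theorem aopp_aopp (a : ι × ℤ) : aopp R (aopp R a) = a := by simp [aopp]

@[simp] theorem aff_aopp (g : ExtAffineWeyl R) (a : ι × ℤ) :
    aff g (aopp R a) = aopp R (aff g a) := by
  ext
  · simp [aff, aopp]
  · simp [aff, aopp]; ring

/-- Positive affine coroots: those with positive values on the fundamental alcove. -/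
def APos (b : R.Base) (a : ι × ℤ) : Prop := 0 < a.2 ∨ a.2 = 0 ∧ b.IsPos a.1

@[simp] theorem apos_aopp (b : R.Base) (a : ι × ℤ) : APos b (aopp R a) ↔ ¬ APos b a := by
  simp only [APos, aopp, isPos_opp]
  constructor
  · rintro (h | ⟨h1, h2⟩) (h' | ⟨h1', h2'⟩)
    · omega
    · omega
    · omega
    · exact h2 h2'
  · intro h
    push Not at h
    obtain ⟨h1, h2⟩ := h
    rcases lt_or_eq_of_le h1 with h3 | h3
    · left; omega
    · right; exact ⟨by omega, h2 h3⟩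

variable (b : R.Base)

/-- The affine coroots that are positive and made negative by `g⁻¹`. -/
def inversions (g : ExtAffineWeyl R) : Set (ι × ℤ) := {a | APos b a ∧ ¬ APos b (aff g⁻¹ a)}

open Classical in
/-- The signed number of hyperplanes of direction `i` that separate the fundamental alcove from
its image. -/
def slope (g : ExtAffineWeyl R) (i : ι) : ℤ :=
  pair g.left.toAdd i - if b.IsPos (g.right⁻¹ • i) then 0 else 1

/-- The hyperplanes in one direction are counted with a sign by `slope`: a negative slope gives
inversions over `i`, a positive one inversions over `-i`. Level `0` is positive for `i` but not for
`-i`, which explains the two ranges, starting at `0` here and at `1` in the next lemma. -/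
theorem mem_inversions_pos {g : ExtAffineWeyl R} {i : ι} (hi : b.IsPos i) {m : ℤ} :
    (i, m) ∈ inversions b g ↔ 0 ≤ m ∧ m < -slope b g i := by
  change (APos b _ ∧ ¬ APos b _) ↔ _
  simp only [APos, aff_inv, slope, hi, and_true]
  split_ifs with h <;> simp only [h, and_true, and_false, or_false] <;> omega

theorem mem_inversions_opp {g : ExtAffineWeyl R} {i : ι} (hi : b.IsPos i) {m : ℤ} :
    (opp R i, m) ∈ inversions b g ↔ 1 ≤ m ∧ m ≤ slope b g i := by
  change (APos b _ ∧ ¬ APos b _) ↔ _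
  simp only [APos, aff_inv, slope, smul_opp, isPos_opp, hi,
    pair_opp, not_true_eq_false, and_false, or_false]
  split_ifs with h <;>
  simp only [h, not_true_eq_false, not_false_eq_true, and_true, and_false, or_false] <;> omega

variable [Finite ι]

/-- The positive roots. -/
def posRoots : Finset ι := (Set.toFinite {i | b.IsPos i}).toFinset

@[simp] theorem mem_posRoots {i : ι} : i ∈ posRoots b ↔ b.IsPos i := by simp [posRoots]

theorem len_eq_sum (g : ExtAffineWeyl R) :
    len b g = ∑ i ∈ posRoots b, (slope b g i).natAbs := by
  unfold len posRoots slope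
  rw [finsum_mem_eq_finite_toFinset_sum _ (Set.toFinite {i | b.IsPos i})]

open Classical in
/-- The inversions as a finite set. -/
def inversionsFinset (g : ExtAffineWeyl R) : Finset (ι × ℤ) :=
  ((posRoots b).sigma fun i => Finset.Ico 0 (-slope b g i)).image (fun a => (a.1, a.2)) ∪
  ((posRoots b).sigma fun i => Finset.Icc 1 (slope b g i)).image (fun a => (opp R a.1, a.2))

theorem coe_inversionsFinset (g : ExtAffineWeyl R) :
    (inversionsFinset b g : Set (ι × ℤ)) = inversions b g := by
  classical
  ext ⟨i, m⟩
  simp only [inversionsFinset, Finset.coe_union, Set.mem_union, Finset.mem_coe, Finset.mem_image,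
    Finset.mem_sigma, mem_posRoots, Finset.mem_Ico, Finset.mem_Icc, Sigma.exists, Prod.mk.injEq]
  by_cases hi : b.IsPos i
  · rw [mem_inversions_pos b hi]
    constructor
    · rintro (⟨j, n, ⟨hj, h⟩, rfl, rfl⟩ | ⟨j, n, ⟨hj, h⟩, rfl, rfl⟩)
      · exact h
      · exact absurd hj ((isPos_opp b j).1 hi)
    · exact fun h => Or.inl ⟨i, m, ⟨hi, h⟩, rfl, rfl⟩
  · have hi' : b.IsPos (opp R i) := by rwa [isPos_opp]
    have := mem_inversions_opp b (g := g) (m := m) hi'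
    rw [opp_opp] at this
    rw [this]
    constructor
    · rintro (⟨j, n, ⟨hj, h⟩, rfl, rfl⟩ | ⟨j, n, ⟨hj, h⟩, rfl, rfl⟩)
      · exact absurd hj hi
      · rwa [opp_opp]
    · exact fun h => Or.inr ⟨opp R i, m, ⟨hi', h⟩, opp_opp i, rfl⟩

theorem inversions_finite (g : ExtAffineWeyl R) : (inversions b g).Finite := by
  rw [← coe_inversionsFinset]; exact Finset.finite_toSet _

/-- The hyperplane count becomes a count of inversions, and group elements permute affine coroots.
All Coxeter-theoretic properties of the length are derived from this form. -/
theorem len_eq_ncard (g : ExtAffineWeyl R) : len b g = (inversions b g).ncard := by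
  classical
  rw [← coe_inversionsFinset, Set.ncard_coe_finset, inversionsFinset, Finset.card_union_of_disjoint,
    Finset.card_image_of_injective, Finset.card_image_of_injective, Finset.card_sigma,
    Finset.card_sigma, ← Finset.sum_add_distrib, len_eq_sum]
  · refine Finset.sum_congr rfl fun i _ => ?_
    rw [Int.card_Ico, Int.card_Icc]
    omega
  · rintro ⟨i, m⟩ ⟨j, n⟩ h
    simp only [Prod.mk.injEq] at h
    obtain ⟨h1, rfl⟩ := h
    rw [opp_injective h1]
  · rintro ⟨i, m⟩ ⟨j, n⟩ h
    simp only [Prod.mk.injEq] at h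
    obtain ⟨rfl, rfl⟩ := h
    rfl
  · rw [Finset.disjoint_left]
    intro a h1 h2
    simp only [Finset.mem_image, Finset.mem_sigma, mem_posRoots] at h1 h2
    obtain ⟨x, hx, rfl⟩ := h1
    obtain ⟨y, hy, h⟩ := h2
    rw [Prod.mk.injEq] at h
    have := hx.1
    rw [← h.1, isPos_opp] at this
    exact this hy.1

/-- The map `c ↦ -g⁻¹ c` carries the inversions of `g` onto those of `g⁻¹`. -/
theorem len_inv (g : ExtAffineWeyl R) : len b g⁻¹ = len b g := by
  rw [len_eq_ncard, len_eq_ncard]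
  have : inversions b g⁻¹ = (fun c => aopp R (aff g⁻¹ c)) '' inversions b g := by
    ext d
    constructor
    · rintro ⟨h1, h2⟩
      rw [inv_inv] at h2
      refine ⟨aopp R (aff g d), ⟨by rwa [apos_aopp], ?_⟩, ?_⟩
      · rw [aff_aopp, aff_inv_aff, apos_aopp, not_not]; exact h1
      · simp
    · rintro ⟨c, ⟨h1, h2⟩, rfl⟩
      refine ⟨by simpa using h2, ?_⟩
      rw [inv_inv, aff_aopp, aff_aff_inv, apos_aopp, not_not]
      exact h1
  rw [this, Set.ncard_image_of_injective]
  intro c d h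
  have := congrArg (aopp R) h
  simp only [aopp_aopp] at this
  exact aff_injective _ this

theorem apos_aff_of_len_eq_zero {g : ExtAffineWeyl R} (hg : len b g = 0) (a : ι × ℤ) :
    APos b (aff g⁻¹ a) ↔ APos b a := by
  rw [len_eq_ncard, Set.ncard_eq_zero (inversions_finite b g)] at hg
  have key : ∀ a, APos b a → APos b (aff g⁻¹ a) := by
    intro a ha
    by_contra h
    have : a ∈ inversions b g := ⟨ha, h⟩
    rw [hg] at this
    exact this
  refine ⟨fun h => ?_, key a⟩
  by_contra h'
  rw [← apos_aopp] at h'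
  have := key _ h'
  rw [aff_aopp, apos_aopp] at this
  exact this h

theorem len_mul_of_len_eq_zero {g : ExtAffineWeyl R} (hg : len b g = 0) (h : ExtAffineWeyl R) :
    len b (g * h) = len b h := by
  suffices hs : inversions b (g * h) = aff g '' inversions b h by
    rw [len_eq_ncard, len_eq_ncard, hs, Set.ncard_image_of_injective _ (aff_injective g)]
  ext c
  constructor
  · rintro ⟨h1, h2⟩
    refine ⟨aff g⁻¹ c, ⟨(apos_aff_of_len_eq_zero b hg c).2 h1, ?_⟩, by simp⟩
    rwa [mul_inv_rev, aff_mul] at h2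
  · rintro ⟨d, ⟨h1, h2⟩, rfl⟩
    refine ⟨?_, by rwa [mul_inv_rev, aff_mul, aff_inv_aff]⟩
    rw [← apos_aff_of_len_eq_zero b hg, aff_inv_aff]; exact h1

@[simp] theorem len_one : len b (1 : ExtAffineWeyl R) = 0 := by
  rw [len_eq_ncard, Set.ncard_eq_zero (inversions_finite b _)]
  ext a
  simp [inversions]

section Reflections

variable [R.IsRootSystem] [R.IsCrystallographic]

/-- The affine reflection that negates an affine coroot. -/
def aref (a : ι × ℤ) : ExtAffineWeyl R := transl (-a.2 • rootWeight R a.1) * fin (σ R a.1)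

theorem aff_aref (a c : ι × ℤ) :
    aff (aref (R := R) a) c = (σ R a.1 • c.1, c.2 - a.2 * pair (rootWeight R a.1) c.1) := by
  ext
  · simp [aff, aref]
  · simp only [aff, aref, right_mul, left_mul, left_transl, right_transl, left_fin, smul_zero,
      add_zero, right_fin, one_mul, neg_smul, pair_neg, pair_zsmul]
    have h := pair_smul (σ R a.1) (rootWeight R a.1) c.1
    rw [smul_rootWeight, refl_smul_self, rootWeight_opp, pair_neg, refl_inv] at h
    rw [← h]
    ring

theorem aff_aref_self (a : ι × ℤ) : aff (aref (R := R) a) a = aopp R a := by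
  rw [aff_aref, aopp, pair_rootWeight_self, refl_smul_self]
  ext
  · rfl
  · simp; ring

theorem conj_aref (g : ExtAffineWeyl R) (a : ι × ℤ) :
    g * aref a * g⁻¹ = aref (aff g a) := by
  rw [ext_iff]
  constructor
  · simp only [aref, left_mul, right_mul, left_transl, right_transl, left_fin, right_fin, smul_zero,
      add_zero, one_mul, left_inv, aff]
    have h1 : (g.right * σ R a.1) • g.right⁻¹ • (-g.left.toAdd) =
        σ R (g.right • a.1) • (-g.left.toAdd) := by
      rw [← weyl_conj_refl, mul_smul, mul_smul, mul_smul]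
    have h2 : g.right • (-a.2 • rootWeight R a.1) = -a.2 • rootWeight R (g.right • a.1) := by
      rw [← smul_rootWeight]
      exact map_zsmul (DistribSMul.toAddMonoidHom (weightLattice R) g.right) _ _
    rw [h1, h2, refl_smul, pair_neg]
    module
  · simp [aref, aff, weyl_conj_refl]

@[simp] theorem aref_aopp (a : ι × ℤ) : aref (R := R) (aopp R a) = aref a := by
  simp only [aref, aopp, rootWeight_opp, refl_opp]
  congr 2
  module

theorem aref_mul_self (a : ι × ℤ) : aref (R := R) a * aref a = 1 := by
  rw [ext_iff]
  constructor
  · simp only [aref, left_mul, right_mul, left_transl, right_transl, left_fin, right_fin, smul_zero,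
      add_zero, one_mul]
    have : σ R a.1 • (-a.2 • rootWeight R a.1) = -a.2 • rootWeight R (opp R a.1) := by
      rw [← refl_smul_self, ← smul_rootWeight]
      exact map_zsmul (DistribSMul.toAddMonoidHom (weightLattice R) (σ R a.1)) _ _
    rw [this, rootWeight_opp]
    simp
  · simp [aref]

@[simp] theorem aref_inv (a : ι × ℤ) : (aref (R := R) a)⁻¹ = aref a :=
  inv_eq_of_mul_eq_one_left (aref_mul_self a)

theorem aref_zero (i : ι) : aref (R := R) (i, 0) = fin (σ R i) := by
  simp [aref]

/-- The simple affine coroots. -/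
def simpleAff (b : R.Base) : Set (ι × ℤ) :=
  {a | (∃ i ∈ b.support, a = (i, 0)) ∨ ∃ β, IsHighestCoroot b β ∧ a = (opp R β, 1)}

theorem aref_opp_one (β : ι) :
    aref (R := R) (opp R β, 1) = transl (rootWeight R β) * fin (σ R β) := by
  simp [aref, refl_opp]

theorem simpleReflections_eq : simpleReflections b = aref '' simpleAff b := by
  ext g
  constructor
  · rintro (⟨i, hi, rfl⟩ | ⟨β, hβ, rfl⟩)
    · exact ⟨_, Or.inl ⟨i, hi, rfl⟩, aref_zero i⟩
    · exact ⟨_, Or.inr ⟨β, hβ, rfl⟩, aref_opp_one β⟩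
  · rintro ⟨a, ⟨i, hi, rfl⟩ | ⟨β, hβ, rfl⟩, rfl⟩
    · exact Or.inl ⟨i, hi, aref_zero i⟩
    · exact Or.inr ⟨β, hβ, aref_opp_one β⟩

variable [R.IsReduced] {b}

theorem apos_of_mem_simpleAff {a : ι × ℤ} (ha : a ∈ simpleAff b) : APos b a := by
  rcases ha with ⟨i, hi, rfl⟩ | ⟨β, hβ, rfl⟩
  · exact Or.inr ⟨rfl, isPos_simple b hi⟩
  · exact Or.inl one_pos

/-- For the affine reflection the level of `(j, m)` rises by `⟨β, αⱼ^∨⟩`, which is at least `-1`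
unless `j = -β`, and at least `0` for positive `j`. The borderline cases, where the new level is
`0`, are settled by the sign of the reflected root. -/
theorem apos_aref {a c : ι × ℤ} (ha : a ∈ simpleAff b) (hc : APos b c) (hne : c ≠ a) :
    APos b (aff (aref (R := R) a) c) := by
  rw [aff_aref]
  obtain ⟨j, m⟩ := c
  rcases ha with ⟨i, hi, rfl⟩ | ⟨β, hβ, rfl⟩
  · rcases hc with hc | ⟨hc, hj⟩
    · left; simpa using hc
    · right
      simp only at hc hj
      subst hc
      exact ⟨by simp, isPos_refl b hi (by simpa using hne) hj⟩
  · simp only [rootWeight_opp, pair_neg, one_mul, sub_neg_eq_add, refl_opp]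
    simp only [APos] at hc ⊢
    by_cases hj : j = opp R β
    · subst hj
      rw [pair_opp, pair_rootWeight_self]
      rcases hc with hc | ⟨hc, hj⟩
      · have hm : m ≠ 1 := by simpa using hne
        by_cases hm2 : m = 2
        · right
          refine ⟨by omega, ?_⟩
          rw [smul_opp, refl_smul_self, opp_opp]
          exact hβ.isPos
        · left; omega
      · exact absurd hβ.isPos ((isPos_opp b β).1 hj)
    · rcases hc with hc | ⟨hc, hjp⟩
      · have h1 := hβ.neg_one_le hj
        by_cases h2 : pair (rootWeight R β) j = -1
        · by_cases hm : m = 1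
          · right; exact ⟨by omega, hβ.isPos_refl h2⟩
          · left; omega
        · left; omega
      · have h1 := hβ.pair_nonneg hjp
        by_cases h2 : pair (rootWeight R β) j = 0
        · right
          refine ⟨by omega, ?_⟩
          have : σ R β • j = j := R.coroot.injective (by rw [coroot_refl, h2]; simp)
          rwa [this]
        · left; omega

/-- Only `a` itself is made negative by its reflection, so the inversions of `aref a * g` are `a`
and the reflected inversions of `g`. -/
theorem len_aref_mul {a : ι × ℤ} (ha : a ∈ simpleAff b) {g : ExtAffineWeyl R}
    (hg : APos b (aff g⁻¹ a)) : len b (aref a * g) = len b g + 1 := by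
  have hs := aref_inv (R := R) a
  have hss : ∀ c, aff (aref (R := R) a) (aff (aref a) c) = c := fun c => by
    rw [← aff_mul, aref_mul_self, aff_one]
  have h : inversions b (aref a * g) = insert a (aff (aref (R := R) a) '' inversions b g) := by
    ext c
    rw [Set.mem_insert_iff]
    constructor
    · rintro ⟨h1, h2⟩
      by_cases hc : c = a
      · exact Or.inl hc
      · right
        rw [mul_inv_rev, hs, aff_mul] at h2
        exact ⟨aff (aref a) c, ⟨apos_aref ha h1 hc, h2⟩, hss c⟩
    · rintro (rfl | ⟨d, ⟨h1, h2⟩, rfl⟩)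
      · refine ⟨apos_of_mem_simpleAff ha, ?_⟩
        rw [mul_inv_rev, hs, aff_mul, aff_aref_self, aff_aopp, apos_aopp, not_not]
        exact hg
      · refine ⟨apos_aref ha h1 ?_, ?_⟩
        · rintro rfl; exact h2 hg
        · rwa [mul_inv_rev, hs, aff_mul, hss]
  have hnot : a ∉ aff (aref (R := R) a) '' inversions b g := by
    rintro ⟨d, ⟨h1, -⟩, h2⟩
    have : d = aopp R a := by rw [← hss d, h2, aff_aref_self]
    rw [this, apos_aopp] at h1
    exact h1 (apos_of_mem_simpleAff ha)
  rw [len_eq_ncard, len_eq_ncard, h,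
    Set.ncard_insert_of_notMem hnot ((inversions_finite b g).image _),
    Set.ncard_image_of_injective _ (aff_injective _)]

theorem len_aref_mul_neg {a : ι × ℤ} (ha : a ∈ simpleAff b) {g : ExtAffineWeyl R}
    (hg : ¬ APos b (aff g⁻¹ a)) : len b (aref a * g) + 1 = len b g := by
  have := len_aref_mul ha (g := aref a * g) (by
    rw [mul_inv_rev, aff_mul, aref_inv, aff_aref_self, aff_aopp, apos_aopp]; exact hg)
  rw [← mul_assoc, aref_mul_self, one_mul] at this
  exact this.symm

theorem len_mul_aref {a : ι × ℤ} (ha : a ∈ simpleAff b) {g : ExtAffineWeyl R}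
    (hg : APos b (aff g a)) : len b (g * aref a) = len b g + 1 := by
  rw [← len_inv, mul_inv_rev, aref_inv, len_aref_mul ha (by rwa [inv_inv]), len_inv]

theorem len_mul_aref_neg {a : ι × ℤ} (ha : a ∈ simpleAff b) {g : ExtAffineWeyl R}
    (hg : ¬ APos b (aff g a)) : len b (g * aref a) + 1 = len b g := by
  rw [← len_inv, mul_inv_rev, aref_inv, len_aref_mul_neg ha (by rwa [inv_inv]), len_inv]

theorem len_aref {a : ι × ℤ} (ha : a ∈ simpleAff b) : len b (aref (R := R) a) = 1 := by
  have := len_mul_aref ha (g := 1) (by rw [aff_one]; exact apos_of_mem_simpleAff ha)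
  rwa [one_mul, len_one] at this

/-- With `h = ⟨ρ, β^∨⟩ + 1`, the point `ρ/h` is interior to the fundamental alcove, so the sign of
an affine coroot is the sign of its value there. The sign after applying `g⁻¹` is read at the image
`z/h` of this point. If all simple affine coroots are positive at `z/h`, that point lies in the
fundamental alcove too, and there are no inversions. -/
theorem exists_simpleAff_neg [R.IsIrreducible] {g : ExtAffineWeyl R} (hg : len b g ≠ 0) :
    ∃ a ∈ simpleAff b, ¬ APos b (aff g⁻¹ a) := by
  obtain ⟨β, hβ⟩ := exists_isHighestCoroot b
  by_contra! hcon
  set h : ℤ := pair (rho b) β + 1 with hh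
  have hbd : ∀ j, |pair (rho b) j| < h := by
    intro j
    rw [abs_lt]
    have h1 := hβ.pair_rho_le j
    have h2 := hβ.pair_rho_le (opp R j)
    rw [pair_opp] at h2
    constructor <;> linarith
  have hφ : ∀ a : ι × ℤ, APos b a ↔ 0 < a.2 * h + pair (rho b) a.1 := by
    rintro ⟨j, m⟩
    have h1 := abs_lt.1 (hbd j)
    rw [APos, isPos_iff_pair_rho]
    simp only
    constructor
    · rintro (h2 | ⟨h2, h3⟩)
      · nlinarith
      · rw [h2]; linarith
    · intro h2
      rcases lt_trichotomy m 0 with h3 | h3 | h3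
      · nlinarith
      · right; rw [h3] at h2; exact ⟨h3, by linarith⟩
      · exact Or.inl h3
  set z : weightLattice R := h • g.left.toAdd + g.right • rho b with hz
  have hφg : ∀ a : ι × ℤ, APos b (aff g⁻¹ a) ↔ 0 < a.2 * h + pair z a.1 := by
    intro a
    rw [hφ, aff_inv, hz, pair_add, pair_zsmul, pair_smul]
    simp only
    constructor <;> intro h1 <;> linarith
  have hzd : ∀ i ∈ b.support, 1 ≤ pair z i := by
    intro i hi
    have := (hφg _).1 (hcon (i, 0) (Or.inl ⟨i, hi, rfl⟩))
    simp only [zero_mul, zero_add] at this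
    linarith
  have hzβ : pair z β < h := by
    have := (hφg _).1 (hcon (opp R β, 1) (Or.inr ⟨β, hβ, rfl⟩))
    simp only [one_mul, pair_opp] at this
    linarith
  have hzle : ∀ j, pair z j ≤ pair z β := by
    intro j
    have h0 : ∀ c ∈ AddSubmonoid.closure (R.coroot '' b.support),
        0 ≤ R.toLinearMap (z : V) c := by
      intro c hc
      induction hc using AddSubmonoid.closure_induction with
      | mem c hc =>
        obtain ⟨i, hi, rfl⟩ := hc
        rw [← coroot'_eq, pair_spec]
        have := hzd i hi
        exact_mod_cast (by linarith : 0 ≤ pair z i)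
      | zero => simp
      | add c d _ _ h1 h2 => rw [map_add]; linarith
    have h1 := h0 _ (hβ j)
    rw [map_sub, ← coroot'_eq, ← coroot'_eq, pair_spec, pair_spec, sub_nonneg] at h1
    exact_mod_cast h1
  apply hg
  rw [len_eq_ncard, Set.ncard_eq_zero (inversions_finite b g), Set.eq_empty_iff_forall_notMem]
  rintro ⟨j, m⟩ ⟨h1, h2⟩
  apply h2
  rw [hφg]
  simp only
  rcases h1 with h1 | ⟨h1, h3⟩
  · have h4 := hzle (opp R j)
    rw [pair_opp] at h4
    simp only at h1
    have h5 := (abs_nonneg _).trans_lt (hbd β)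
    have h6 : h ≤ m * h := le_mul_of_one_le_left h5.le h1
    linarith
  · simp only at h1 h3
    have := one_le_pair hzd h3
    rw [h1]; linarith

theorem len_mul_le [R.IsIrreducible] (g h : ExtAffineWeyl R) :
    len b (g * h) ≤ len b g + len b h := by
  induction hn : len b g generalizing g with
  | zero => rw [len_mul_of_len_eq_zero b hn]; omega
  | succ n ih =>
    obtain ⟨a, ha, hneg⟩ := exists_simpleAff_neg (b := b) (g := g) (by omega)
    have h1 := len_aref_mul_neg ha hneg
    have h2 := ih (aref a * g) (by omega)
    by_cases h3 : APos b (aff (g * h)⁻¹ a)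
    · have := len_aref_mul ha h3
      rw [mul_assoc] at h2
      omega
    · have := len_aref_mul_neg ha h3
      rw [mul_assoc] at h2
      omega

end Reflections

end Affine

/-! ### Lengths of translations and of finite Weyl group elements -/

section Lengths

variable {ι V V' : Type*} [AddCommGroup V] [Module ℝ V] [AddCommGroup V'] [Module ℝ V']
  {R : RootPairing ι ℝ V V'} [Finite ι]

/-- The sum of the pairings of a weight with all positive coroots. -/
def xi (b : R.Base) (x : weightLattice R) : ℤ := ∑ i ∈ posRoots b, pair x i

section

variable (b : R.Base)

theorem xi_add (x y : weightLattice R) : xi b (x + y) = xi b x + xi b y := by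
  simp [xi, Finset.sum_add_distrib]

theorem xi_neg (x : weightLattice R) : xi b (-x) = -xi b x := by simp [xi]

theorem xi_zsmul (n : ℤ) (x : weightLattice R) : xi b (n • x) = n * xi b x := by
  simp [xi, Finset.mul_sum]

@[simp] theorem xi_zero : xi b (0 : weightLattice R) = 0 := by simp [xi]

theorem xi_sum {κ : Type*} (s : Finset κ) (f : κ → weightLattice R) :
    xi b (∑ j ∈ s, f j) = ∑ j ∈ s, xi b (f j) := by
  simp only [xi, pair_sum]
  exact Finset.sum_comm

open Classical in
theorem len_fin (u : R.weylGroup) :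
    len b (fin u) = ((posRoots b).filter fun i => ¬ b.IsPos (u⁻¹ • i)).card := by
  rw [len_eq_sum, Finset.card_filter]
  refine Finset.sum_congr rfl fun i _ => ?_
  simp only [slope, left_fin, pair_zero, right_fin]
  split_ifs <;> simp_all

end

variable {b : R.Base} [R.IsRootSystem] [R.IsCrystallographic] [R.IsReduced]

theorem IsDominant.add {x y : weightLattice R} (hx : IsDominant b x) (hy : IsDominant b y) :
    IsDominant b (x + y) := fun i hi => by
  rw [pair_add]; exact add_nonneg (hx i hi) (hy i hi)

theorem len_transl {x : weightLattice R} (hx : IsDominant b x) :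
    (len b (transl x) : ℤ) = xi b x := by
  rw [len_eq_sum, xi]
  rw [Nat.cast_sum]
  refine Finset.sum_congr rfl fun i hi => ?_
  rw [mem_posRoots] at hi
  have h := pair_nonneg b hx hi
  simp only [slope, right_transl, left_transl, inv_one, one_smul, hi, if_true, sub_zero]
  omega

theorem len_transl_add {x y : weightLattice R} (hx : IsDominant b x) (hy : IsDominant b y) :
    len b (transl x * transl y) = len b (transl x) + len b (transl y) := by
  zify
  rw [← transl_add, len_transl hx, len_transl hy, len_transl (hx.add hy), xi_add]

theorem len_fin_inv (u : R.weylGroup) : len b (fin u⁻¹) = len b (fin u) := by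
  rw [fin_inv, len_inv]

theorem len_fin_mul_transl (u : R.weylGroup) {x : weightLattice R} (hx : IsDominant b x) :
    len b (fin u * transl x) = len b (fin u) + len b (transl x) := by
  classical
  rw [← len_inv, mul_inv_rev, ← transl_neg, ← fin_inv, ← len_fin_inv u]
  zify
  rw [len_transl hx, len_fin, len_eq_sum, xi, Finset.card_filter]
  simp only [Nat.cast_sum, Nat.cast_ite, Nat.cast_one, Nat.cast_zero]
  rw [← Finset.sum_add_distrib]
  refine Finset.sum_congr rfl fun i hi => ?_
  rw [mem_posRoots] at hi
  have h := pair_nonneg b hx hi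
  simp only [slope, right_mul, left_mul, right_transl, left_transl, left_fin, right_fin, one_mul,
    smul_zero, add_zero, pair_neg]
  split_ifs <;> omega

/-- In each direction inverted by `u⁻¹` the slope of the translation drops by one, and `hu` keeps it
nonnegative. The lengths thus add up when `transl x` is written as `transl x * fin u` times `fin
u⁻¹`. -/
theorem len_transl_mul_fin {x : weightLattice R} {u : R.weylGroup}
    (hx : ∀ i, b.IsPos i → 0 ≤ pair x i)
    (hu : ∀ i, b.IsPos i → ¬ b.IsPos (u⁻¹ • i) → 1 ≤ pair x i) :
    len b (transl x * fin u) + len b (fin u) = len b (transl x) := by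
  classical
  zify
  rw [len_transl fun i hi => hx i (isPos_simple b hi), len_fin, len_eq_sum, xi,
    Finset.card_filter]
  simp only [Nat.cast_sum, Nat.cast_ite, Nat.cast_one, Nat.cast_zero]
  rw [← Finset.sum_add_distrib]
  refine Finset.sum_congr rfl fun i hi => ?_
  rw [mem_posRoots] at hi
  have h := hx i hi
  have h' := hu i hi
  simp only [slope, right_mul, left_mul, right_transl, left_transl, left_fin, right_fin, one_mul,
    smul_zero, add_zero]
  by_cases h2 : b.IsPos (u⁻¹ • i)
  · simp only [h2, if_true, not_true_eq_false, if_false]; omega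
  · have := h' h2
    simp only [h2, if_true, not_false_eq_true, if_false]; omega

/-- The simple reflection permutes the positive roots other than `i`, so only the term at `i`
changes, and it changes sign. -/
theorem xi_refl_smul {i : ι} (hi : i ∈ b.support) (x : weightLattice R) :
    xi b (σ R i • x) = xi b x - 2 * pair x i := by
  classical
  have hmem : i ∈ posRoots b := (mem_posRoots b).2 (isPos_simple b hi)
  have h1 : ∑ j ∈ (posRoots b).erase i, pair (σ R i • x) j =
      ∑ j ∈ (posRoots b).erase i, pair x j := by
    have hmap : ∀ j ∈ (posRoots b).erase i, σ R i • j ∈ (posRoots b).erase i := by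
      intro j hj
      rw [Finset.mem_erase, mem_posRoots] at hj ⊢
      refine ⟨fun h => ?_, isPos_refl b hi hj.1 hj.2⟩
      have : j = opp R i := by
        have h2 := congrArg (σ R i • ·) h
        rwa [← mul_smul, refl_mul_self, one_smul, refl_smul_self] at h2
      rw [this, isPos_opp] at hj
      exact hj.2 (isPos_simple b hi)
    refine Finset.sum_bij' (fun j _ => σ R i • j) (fun j _ => σ R i • j) hmap hmap ?_ ?_ ?_
    · intro j _; rw [← mul_smul, refl_mul_self, one_smul]
    · intro j _; rw [← mul_smul, refl_mul_self, one_smul]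
    · intro j _; rw [pair_smul, refl_inv]
  rw [xi, xi, ← Finset.add_sum_erase _ _ hmem, ← Finset.add_sum_erase (posRoots b) _ hmem, h1,
    pair_smul, refl_inv, refl_smul_self, pair_opp]
  ring

theorem xi_rootWeight_simple {i : ι} (hi : i ∈ b.support) : xi b (rootWeight R i) = 2 := by
  have h := xi_refl_smul hi (rootWeight R i)
  rw [smul_rootWeight, refl_smul_self, rootWeight_opp, xi_neg, pair_rootWeight_self] at h
  linarith

theorem rootWeight_eq_sum {j : ι} {f : ι → ℤ}
    (h : R.root j = ∑ l ∈ b.support, f l • R.root l) :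
    rootWeight R j = ∑ l ∈ b.support, f l • rootWeight R l := by
  apply Subtype.ext
  push_cast
  simpa using h

theorem xi_rootWeight (j : ι) : xi b (rootWeight R j) = 2 * b.height j := by
  obtain ⟨f, -, -, h⟩ := b.exists_root_eq_sum_int j
  rw [RootPairing.Base.height_eq_sum h, rootWeight_eq_sum h, xi_sum, Finset.mul_sum]
  refine Finset.sum_congr rfl fun l hl => ?_
  rw [xi_zsmul, xi_rootWeight_simple hl, mul_comm]

theorem IsHighestCoroot.isDominant {β : ι} (hβ : IsHighestCoroot b β) :
    IsDominant b (rootWeight R β) := fun _ hi => hβ.pair_nonneg (isPos_simple b hi)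

theorem IsHighestCoroot.len_mul {β : ι} (hβ : IsHighestCoroot b β) :
    len b (transl (rootWeight R β) * fin (σ R β)) + len b (fin (σ R β)) =
      len b (transl (rootWeight R β)) := by
  refine len_transl_mul_fin (fun i hi => hβ.pair_nonneg hi) fun i hi h => ?_
  by_contra! h2
  have h3 := hβ.pair_nonneg hi
  have h4 : pair (rootWeight R β) i = 0 := by omega
  apply h
  rw [refl_inv]
  have : σ R β • i = i := R.coroot.injective (by rw [coroot_refl, h4]; simp)
  rwa [this]

theorem slope_eq_zero {g : ExtAffineWeyl R} (hg : len b g = 0) {i : ι} (hi : b.IsPos i) :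
    slope b g i = 0 := by
  rw [len_eq_sum, Finset.sum_eq_zero_iff] at hg
  exact Int.natAbs_eq_zero.1 (hg i ((mem_posRoots b).2 hi))

/-- All slopes vanish, so the translation part pairs to `1` with the positive coroots that the
inverse of the finite part makes negative and to `0` with the others. Elements of length zero are
thereby tied to dominant translations. -/
theorem len_transl_of_len_eq_zero {g : ExtAffineWeyl R} (hg : len b g = 0) :
    IsDominant b g.left.toAdd ∧
    len b g + len b (fin g.right) = len b (transl g.left.toAdd) := by
  classical
  have h1 : ∀ i, b.IsPos i → pair g.left.toAdd i = if b.IsPos (g.right⁻¹ • i) then 0 else 1 := by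
    intro i hi
    have := slope_eq_zero hg hi
    rwa [slope, sub_eq_zero] at this
  have h2 : ∀ i, b.IsPos i → 0 ≤ pair g.left.toAdd i := fun i hi => by
    rw [h1 i hi]; split_ifs <;> norm_num
  refine ⟨fun i hi => h2 i (isPos_simple b hi), ?_⟩
  conv_lhs => rw [eq_transl_mul_fin g]
  refine len_transl_mul_fin h2 fun i hi h => ?_
  rw [h1 i hi, if_neg h]

theorem mem_simpleAff {i : ι} (hi : i ∈ b.support) : ((i, 0) : ι × ℤ) ∈ simpleAff b :=
  Or.inl ⟨i, hi, rfl⟩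

theorem apos_zero {i : ι} : APos b (i, 0) ↔ b.IsPos i := by
  simp [APos]

theorem aff_fin (u : R.weylGroup) (i : ι) (n : ℤ) : aff (fin u) (i, n) = (u • i, n) := by
  ext <;> simp [aff]

theorem len_refl_mul {i : ι} (hi : i ∈ b.support) {u : R.weylGroup} (h : b.IsPos (u⁻¹ • i)) :
    len b (fin (σ R i * u)) = len b (fin u) + 1 := by
  rw [fin_mul, ← aref_zero]
  exact len_aref_mul (mem_simpleAff hi) (by rwa [← fin_inv, aff_fin, apos_zero])

theorem len_refl_mul_neg {i : ι} (hi : i ∈ b.support) {u : R.weylGroup}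
    (h : ¬ b.IsPos (u⁻¹ • i)) : len b (fin (σ R i * u)) + 1 = len b (fin u) := by
  rw [fin_mul, ← aref_zero]
  exact len_aref_mul_neg (mem_simpleAff hi) (by rwa [← fin_inv, aff_fin, apos_zero])

theorem len_mul_refl {i : ι} (hi : i ∈ b.support) {u : R.weylGroup} (h : b.IsPos (u • i)) :
    len b (fin (u * σ R i)) = len b (fin u) + 1 := by
  rw [fin_mul, ← aref_zero]
  exact len_mul_aref (mem_simpleAff hi) (by rwa [aff_fin, apos_zero])

theorem len_mul_refl_neg {i : ι} (hi : i ∈ b.support) {u : R.weylGroup}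
    (h : ¬ b.IsPos (u • i)) : len b (fin (u * σ R i)) + 1 = len b (fin u) := by
  rw [fin_mul, ← aref_zero]
  exact len_mul_aref_neg (mem_simpleAff hi) (by rwa [aff_fin, apos_zero])

theorem len_refl {i : ι} (hi : i ∈ b.support) : len b (fin (σ R i)) = 1 := by
  rw [← aref_zero]; exact len_aref (mem_simpleAff hi)

theorem eq_one_of_len {u : R.weylGroup} (h : len b (fin u) = 0) : u = 1 := by
  apply eq_one_of_isPos b
  intro i hi
  by_contra hneg
  have := len_mul_refl_neg hi hneg
  omega

theorem not_isPos_smul_of_simple {u : R.weylGroup} (h : ∀ i ∈ b.support, ¬ b.IsPos (u • i)) {j : ι}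
    (hj : b.IsPos j) : ¬ b.IsPos (u • j) := by
  rw [← isPos_opp]
  refine hj.induction_on_add (p := fun j => b.IsPos (opp R (u • j)))
    (fun i hi => (isPos_opp b _).2 (h i hi)) ?_
  intro i j k hk hi hj
  refine hi.add ((isPos_opp b _).2 (h j hj)) ?_
  rw [root_opp, root_opp, root_opp, ← weyl_smul_root, ← weyl_smul_root, ← weyl_smul_root, hk,
    smul_add, neg_add]

theorem longest_inv_smul {j : ι} (hj : b.IsPos j) : ¬ b.IsPos ((longest b)⁻¹ • j) := by
  refine not_isPos_smul_of_simple (fun i hi h => ?_) hj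
  have h1 := len_refl_mul hi h
  have h2 := len_le_longest b (σ R i * longest b)
  omega

theorem len_longest : len b (fin (longest b)) = (posRoots b).card := by
  classical
  rw [len_fin, Finset.filter_true_of_mem]
  intro i hi
  exact longest_inv_smul ((mem_posRoots b).1 hi)

theorem eq_longest {u : R.weylGroup} (h : len b (fin u) = len b (fin (longest b))) :
    u = longest b := by
  classical
  rw [len_longest, len_fin] at h
  have hu : ∀ j, b.IsPos j → ¬ b.IsPos (u⁻¹ • j) := by
    intro j hj
    have := Finset.filter_card_eq h j ((mem_posRoots b).2 hj)
    exact this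
  rw [← inv_mul_eq_one]
  apply eq_one_of_isPos b
  intro i hi
  by_contra hneg
  have h1 : b.IsPos (longest b • i) := by
    by_contra h2
    rw [← isPos_opp] at h2
    have h3 := hu _ h2
    rw [smul_opp, isPos_opp, not_not, ← mul_smul] at h3
    exact hneg h3
  have h2 := longest_inv_smul h1
  rw [inv_smul_smul] at h2
  exact h2 (isPos_simple b hi)

theorem longest_inv : (longest b)⁻¹ = longest b := eq_longest (len_fin_inv _)

theorem longest_smul {j : ι} : b.IsPos (longest b • j) ↔ ¬ b.IsPos j := by
  have h : ∀ {j}, b.IsPos j → ¬ b.IsPos (longest b • j) := fun {j} hj => by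
    have := longest_inv_smul hj
    rwa [longest_inv] at this
  refine ⟨fun h1 h2 => h h2 h1, fun h1 => ?_⟩
  rw [← isPos_opp] at h1
  have := h h1
  rwa [smul_opp, isPos_opp, not_not] at this

theorem len_lt_longest {u : R.weylGroup} (h : u ≠ longest b) :
    len b (fin u) < len b (fin (longest b)) :=
  lt_of_le_of_ne (len_le_longest b u) fun h' => h (eq_longest h')

/-- `l(w₀ u) = l(w₀) - l(u)`. -/
theorem len_longest_mul (u : R.weylGroup) :
    len b (fin (longest b * u)) + len b (fin u) = len b (fin (longest b)) := by
  classical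
  rw [← len_fin_inv (longest b * u), ← len_fin_inv u, len_longest, len_fin, len_fin,
    ← Finset.card_filter_add_card_filter_not (s := posRoots b) (fun i => ¬ b.IsPos (u • i))]
  simp only [inv_inv, mul_smul, longest_smul, not_not]
  rw [add_comm]

theorem len_mul_longest (u : R.weylGroup) :
    len b (fin (u * longest b)) + len b (fin u) = len b (fin (longest b)) := by
  rw [← len_fin_inv (u * longest b), mul_inv_rev, longest_inv, ← len_fin_inv u]
  exact len_longest_mul u⁻¹

variable (b) in
/-- The sign character of the Weyl group. -/
def eps (u : R.weylGroup) : ℤ := (-1) ^ len b (fin u)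

theorem eps_refl_mul_simple {i : ι} (hi : i ∈ b.support) (u : R.weylGroup) :
    eps b (σ R i * u) = -eps b u := by
  unfold eps
  by_cases h : b.IsPos (u⁻¹ • i)
  · rw [len_refl_mul hi h, pow_succ]; ring
  · rw [← len_refl_mul_neg hi h, pow_succ]; ring

@[simp] theorem eps_one : eps b 1 = 1 := by simp [eps]

theorem eps_mul (u w : R.weylGroup) : eps b (u * w) = eps b u * eps b w := by
  induction u using weyl_induction b with
  | one => simp
  | mul i hi u ih => rw [mul_assoc, eps_refl_mul_simple hi, eps_refl_mul_simple hi, ih]; ring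

theorem eps_mul_self (u : R.weylGroup) : eps b u * eps b u = 1 := by
  unfold eps; rw [← mul_pow]; simp

theorem eps_inv (u : R.weylGroup) : eps b u⁻¹ = eps b u := by
  unfold eps; rw [len_fin_inv]

theorem eps_refl (j : ι) : eps b (σ R j) = -1 := by
  obtain ⟨w, i, hi, rfl⟩ := exists_weyl_smul_simple b j
  have := eps_refl_mul_simple hi (1 : R.weylGroup)
  rw [mul_one, eps_one] at this
  rw [← weyl_conj_refl, eps_mul, eps_mul, this, eps_inv, mul_neg_one, neg_mul, eps_mul_self]

/-- Write `-w₀ αᵢ` as a nonnegative combination of simple roots and apply `-w₀`: then `αᵢ` is the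
same combination of positive roots `-w₀ αₗ`, each of which has `ξ ≥ 2`. Since `ξ(αᵢ) = 2`, the
coefficients sum to at most one. -/
theorem height_longest_smul {i : ι} (hi : i ∈ b.support) : b.height (longest b • i) = -1 := by
  have hneg : b.IsPos (opp R (longest b • i)) := by
    rw [isPos_opp, longest_smul, not_not]; exact isPos_simple b hi
  obtain ⟨f, hf, hsum⟩ := exists_root_sum_nonneg b hneg
  have h1 := RootPairing.Base.height_eq_sum hsum
  have hopp : b.height (opp R (longest b • i)) = -b.height (longest b • i) :=
    b.height_reflectionPerm_self _
  have h2 : xi b (rootWeight R i) =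
      ∑ l ∈ b.support, f l * xi b (rootWeight R (opp R (longest b • l))) := by
    have h3 := rootWeight_eq_sum hsum
    have h4 : rootWeight R i = longest b • -rootWeight R (opp R (longest b • i)) := by
      rw [rootWeight_opp, neg_neg, smul_rootWeight, ← mul_smul]
      nth_rewrite 1 [← longest_inv]
      rw [inv_mul_cancel, one_smul]
    rw [h4, h3, smul_neg, xi_neg, Finset.smul_sum, xi_sum, ← Finset.sum_neg_distrib]
    refine Finset.sum_congr rfl fun l _ => ?_
    have h5 : longest b • (f l • rootWeight R l) = f l • (longest b • rootWeight R l) :=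
      map_zsmul (DistribSMul.toAddMonoidHom (weightLattice R) (longest b)) _ _
    rw [h5, xi_zsmul, smul_rootWeight, rootWeight_opp, xi_neg, mul_neg]
  have h6 : ∀ l ∈ b.support, f l * 2 ≤ f l * xi b (rootWeight R (opp R (longest b • l))) := by
    intro l hl
    refine mul_le_mul_of_nonneg_left ?_ (hf l)
    have : b.IsPos (opp R (longest b • l)) := by
      rw [isPos_opp, longest_smul, not_not]; exact isPos_simple b hl
    rw [xi_rootWeight]
    rw [RootPairing.Base.isPos_iff] at this
    omega
  have h7 := Finset.sum_le_sum h6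
  rw [← h2, xi_rootWeight_simple hi, ← Finset.sum_mul, ← h1] at h7
  rw [RootPairing.Base.isPos_iff] at hneg
  omega

end Lengths

/-! ### The regular representation of the Hecke algebra -/

section HeckeBasis

variable {ι V V' : Type*} [AddCommGroup V] [Module ℝ V] [AddCommGroup V'] [Module ℝ V']
  {R : RootPairing ι ℝ V V'} [Finite ι] [R.IsRootSystem] [R.IsCrystallographic] [R.IsReduced]
  (b : R.Base) {A : Type*} [CommRing A] (q : A)

@[simp] theorem T_one : T b A q 1 = 1 := by
  have := RingQuot.mkAlgHom_rel A (HeckeRel.one (b := b) (A := A) (q := q))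
  rw [map_one] at this
  exact this

variable {b} in
theorem T_mul {g h : ExtAffineWeyl R} (H : len b (g * h) = len b g + len b h) :
    T b A q g * T b A q h = T b A q (g * h) := by
  have := RingQuot.mkAlgHom_rel A (HeckeRel.mul (b := b) (A := A) (q := q) g h H)
  rw [map_mul] at this
  exact this

variable {b} in
theorem T_aref_mul_self {a : ι × ℤ} (ha : a ∈ simpleAff b) :
    T b A q (aref a) * T b A q (aref a) = (q - 1) • T b A q (aref a) + q • 1 := by
  have hs : aref (R := R) a ∈ simpleReflections b := by
    rw [simpleReflections_eq]; exact ⟨a, ha, rfl⟩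
  have := RingQuot.mkAlgHom_rel A (HeckeRel.quad (b := b) (A := A) (q := q) _ hs)
  rw [map_mul, map_sub, map_add, map_one, map_zero, AlgHom.commutes] at this
  change (T b A q (aref a) - algebraMap A _ q) * (T b A q (aref a) + 1) = 0 at this
  rw [Algebra.smul_def, Algebra.smul_def, map_sub, map_one]
  rw [sub_mul, mul_add, mul_add, mul_one, mul_one] at this
  rw [← sub_eq_zero, ← this, sub_mul, one_mul, mul_one]
  abel

variable {b} in
theorem T_aref_mul {a : ι × ℤ} (ha : a ∈ simpleAff b) {g : ExtAffineWeyl R}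
    (hg : APos b (aff g⁻¹ a)) : T b A q (aref a) * T b A q g = T b A q (aref a * g) :=
  T_mul q (by rw [len_aref_mul ha hg, len_aref ha, add_comm])

variable {b} in
theorem T_mul_aref {a : ι × ℤ} (ha : a ∈ simpleAff b) {g : ExtAffineWeyl R}
    (hg : APos b (aff g a)) : T b A q g * T b A q (aref a) = T b A q (g * aref a) :=
  T_mul q (by rw [len_mul_aref ha hg, len_aref ha])

theorem apos_aff_aref_inv (a : ι × ℤ) (g : ExtAffineWeyl R) :
    APos b (aff (aref a * g)⁻¹ a) ↔ ¬ APos b (aff g⁻¹ a) := by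
  rw [mul_inv_rev, aff_mul, aref_inv, aff_aref_self, aff_aopp, apos_aopp]

theorem apos_aff_aref (a : ι × ℤ) (g : ExtAffineWeyl R) :
    APos b (aff (g * aref a) a) ↔ ¬ APos b (aff g a) := by
  rw [aff_mul, aff_aref_self, aff_aopp, apos_aopp]

theorem aref_mul_aref_mul (a : ι × ℤ) (g : ExtAffineWeyl R) : aref a * (aref a * g) = g := by
  rw [← mul_assoc, aref_mul_self, one_mul]

variable {b} in
theorem T_aref_mul_neg {a : ι × ℤ} (ha : a ∈ simpleAff b) {g : ExtAffineWeyl R}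
    (hg : ¬ APos b (aff g⁻¹ a)) :
    T b A q (aref a) * T b A q g = (q - 1) • T b A q g + q • T b A q (aref a * g) := by
  have h1 := T_aref_mul q ha ((apos_aff_aref_inv b a g).2 hg)
  rw [aref_mul_aref_mul] at h1
  rw [← h1, ← mul_assoc, T_aref_mul_self q ha, add_mul, smul_mul_assoc, smul_mul_assoc, one_mul]

open Classical in
/-- Left multiplication by a simple reflection in the regular representation. -/
def leftOp (a : ι × ℤ) : Module.End A (ExtAffineWeyl R →₀ A) :=
  Finsupp.linearCombination A fun g =>
    if APos b (aff g⁻¹ a) then Finsupp.single (aref a * g) 1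
    else (q - 1) • Finsupp.single g 1 + q • Finsupp.single (aref a * g) 1

open Classical in
/-- Right multiplication by a simple reflection in the regular representation. -/
def rightOp (a : ι × ℤ) : Module.End A (ExtAffineWeyl R →₀ A) :=
  Finsupp.linearCombination A fun g =>
    if APos b (aff g a) then Finsupp.single (g * aref a) 1
    else (q - 1) • Finsupp.single g 1 + q • Finsupp.single (g * aref a) 1

/-- Left translation in the regular representation. -/
def leftTr (A : Type*) [CommRing A] (w : ExtAffineWeyl R) : Module.End A (ExtAffineWeyl R →₀ A) :=
  Finsupp.linearCombination A fun g => Finsupp.single (w * g) 1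

/-- Right translation in the regular representation. -/
def rightTr (A : Type*) [CommRing A] (w : ExtAffineWeyl R) : Module.End A (ExtAffineWeyl R →₀ A) :=
  Finsupp.linearCombination A fun g => Finsupp.single (g * w) 1

local notation "e₀" => fun g => (Finsupp.single g 1 : ExtAffineWeyl R →₀ A)

theorem leftTr_single (w g : ExtAffineWeyl R) :
    leftTr A w (Finsupp.single g 1) = Finsupp.single (w * g) 1 := by simp [leftTr]

theorem rightTr_single (w g : ExtAffineWeyl R) :
    rightTr A w (Finsupp.single g 1) = Finsupp.single (g * w) 1 := by simp [rightTr]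

variable {b} in
theorem leftOp_pos {a : ι × ℤ} {g : ExtAffineWeyl R} (h : APos b (aff g⁻¹ a)) :
    leftOp b q a (Finsupp.single g 1) = Finsupp.single (aref a * g) 1 := by
  simp [leftOp, h]

variable {b} in
theorem leftOp_neg {a : ι × ℤ} {g : ExtAffineWeyl R} (h : ¬ APos b (aff g⁻¹ a)) :
    leftOp b q a (Finsupp.single g 1) =
      (q - 1) • Finsupp.single g 1 + q • Finsupp.single (aref a * g) 1 := by
  rw [leftOp, Finsupp.linearCombination_single, one_smul, if_neg h]

variable {b} in
theorem rightOp_pos {a : ι × ℤ} {g : ExtAffineWeyl R} (h : APos b (aff g a)) :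
    rightOp b q a (Finsupp.single g 1) = Finsupp.single (g * aref a) 1 := by
  simp [rightOp, h]

variable {b} in
theorem rightOp_neg {a : ι × ℤ} {g : ExtAffineWeyl R} (h : ¬ APos b (aff g a)) :
    rightOp b q a (Finsupp.single g 1) =
      (q - 1) • Finsupp.single g 1 + q • Finsupp.single (g * aref a) 1 := by
  rw [rightOp, Finsupp.linearCombination_single, one_smul, if_neg h]

variable {b}

theorem apos_aref_iff {a c : ι × ℤ} (ha : a ∈ simpleAff b) (h1 : c ≠ a) (h2 : c ≠ aopp R a) :
    APos b (aff (aref (R := R) a) c) ↔ APos b c := by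
  refine ⟨fun h => ?_, fun h => apos_aref ha h h1⟩
  by_contra hc
  rw [← apos_aopp] at hc
  have := apos_aref ha hc (fun h3 => h2 (by rw [← h3, aopp_aopp]))
  rw [aff_aopp, apos_aopp] at this
  exact this h

/-- Unless `s g = g s'` with `g⁻¹ a = ±c`, each side's change of length is unaffected by
multiplication on the other side, and the operators visibly commute. In the exceptional case the two
operators agree at `g` and at `s g`, so the order does not matter. -/
theorem leftOp_rightOp_comm {a c : ι × ℤ} (ha : a ∈ simpleAff b) (hc : c ∈ simpleAff b) :
    leftOp b q a * rightOp b q c = rightOp b q c * leftOp b q a := by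
  ext1 g
  refine LinearMap.ext_ring ?_
  simp only [LinearMap.comp_apply, Finsupp.lsingle_apply, Module.End.mul_apply]
  have hA := apos_of_mem_simpleAff ha
  have hC := apos_of_mem_simpleAff hc
  by_cases h : aff g⁻¹ a = c ∨ aff g⁻¹ a = aopp R c
  · have hs : aref a * g = g * aref c := by
      have h1 := conj_aref (R := R) g c
      have h2 : aref (R := R) (aff g c) = aref a := by
        rcases h with h | h
        · rw [← h, aff_aff_inv]
        · rw [← aopp_aopp (R := R) c, ← h, aff_aopp, aff_aff_inv, aref_aopp]
      rw [← h2, ← h1]; group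
    have hiff : APos b (aff g⁻¹ a) ↔ APos b (aff g c) := by
      rcases h with h | h
      · rw [h, ← h, aff_aff_inv, h]; exact ⟨fun _ => hA, fun _ => hC⟩
      · have : aff g c = aopp R a := by
          rw [← aopp_aopp (R := R) c, ← h, aff_aopp, aff_aff_inv]
        rw [h, this, apos_aopp, apos_aopp]
        exact ⟨fun h => absurd hC h, fun h => absurd hA h⟩
    have hiff' : APos b (aff (aref a * g)⁻¹ a) ↔ APos b (aff (g * aref c) c) := by
      rw [apos_aff_aref_inv, apos_aff_aref, hiff]
    have e1 : leftOp b q a (Finsupp.single g 1) = rightOp b q c (Finsupp.single g 1) := by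
      by_cases h3 : APos b (aff g⁻¹ a)
      · rw [leftOp_pos q h3, rightOp_pos q (hiff.1 h3), hs]
      · rw [leftOp_neg q h3, rightOp_neg q (fun h => h3 (hiff.2 h)), hs]
    have hback : aref a * (aref a * g) = (g * aref c) * aref c := by
      rw [aref_mul_aref_mul, mul_assoc, aref_mul_self, mul_one]
    have e2 : leftOp b q a (Finsupp.single (g * aref c) 1) =
        rightOp b q c (Finsupp.single (g * aref c) 1) := by
      rw [← hs] at hiff' ⊢
      by_cases h3 : APos b (aff (aref a * g)⁻¹ a)
      · rw [leftOp_pos q h3, rightOp_pos q (hiff'.1 h3), hback, hs]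
      · rw [leftOp_neg q h3, rightOp_neg q (fun h => h3 (hiff'.2 h)), hback, hs]
    rw [e1]
    by_cases h3 : APos b (aff g c)
    · rw [rightOp_pos q h3, e2]
    · rw [rightOp_neg q h3]
      simp only [map_add, map_smul, e1, e2]
  · push Not at h
    have h4 : APos b (aff (g * aref c)⁻¹ a) ↔ APos b (aff g⁻¹ a) := by
      rw [mul_inv_rev, aff_mul, aref_inv, apos_aref_iff hc h.1 h.2]
    have h5 : APos b (aff (aref a * g) c) ↔ APos b (aff g c) := by
      rw [aff_mul, apos_aref_iff ha]
      · intro h6; exact h.1 (by rw [← h6, aff_inv_aff])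
      · intro h6
        exact h.2 (by rw [← aopp_aopp (R := R) a, ← h6, aff_aopp, aff_inv_aff])
    by_cases h1 : APos b (aff g⁻¹ a) <;> by_cases h2 : APos b (aff g c)
    · rw [rightOp_pos q h2, leftOp_pos q (h4.2 h1), leftOp_pos q h1, rightOp_pos q (h5.2 h2),
        mul_assoc]
    · rw [rightOp_neg q h2, map_add, map_smul, map_smul, leftOp_pos q (h4.2 h1), leftOp_pos q h1,
        rightOp_neg q (fun h => h2 (h5.1 h)), mul_assoc]
    · rw [rightOp_pos q h2, leftOp_neg q (fun h => h1 (h4.1 h)), leftOp_neg q h1, map_add,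
        map_smul, map_smul, rightOp_pos q h2, rightOp_pos q (h5.2 h2), mul_assoc]
    · rw [rightOp_neg q h2, map_add, map_smul, map_smul, leftOp_neg q (fun h => h1 (h4.1 h)),
        leftOp_neg q h1, map_add, map_smul, map_smul, rightOp_neg q h2,
        rightOp_neg q (fun h => h2 (h5.1 h)), mul_assoc]
      module

theorem leftOp_quad (a : ι × ℤ) :
    (leftOp b q a - algebraMap A (Module.End A (ExtAffineWeyl R →₀ A)) q) *
      (leftOp b q a + 1) = 0 := by
  ext1 g
  refine LinearMap.ext_ring ?_
  simp only [LinearMap.comp_apply, Finsupp.lsingle_apply, Module.End.mul_apply,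
    LinearMap.sub_apply, LinearMap.add_apply, Module.algebraMap_end_apply, Module.End.one_apply,
    LinearMap.zero_apply, map_add]
  have h := apos_aff_aref_inv b a g
  by_cases h1 : APos b (aff g⁻¹ a)
  · rw [leftOp_pos q h1, leftOp_neg q (fun h2 => h.1 h2 h1), aref_mul_aref_mul]
    module
  · rw [leftOp_neg q h1, map_add, map_smul, map_smul, leftOp_pos q (h.2 h1), leftOp_neg q h1,
      aref_mul_aref_mul]
    module

theorem leftOp_rightTr_comm (a : ι × ℤ) {w : ExtAffineWeyl R} (hw : len b w = 0) :
    leftOp b q a * rightTr A w = rightTr A w * leftOp b q a := by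
  ext1 g
  refine LinearMap.ext_ring ?_
  simp only [LinearMap.comp_apply, Finsupp.lsingle_apply, Module.End.mul_apply, rightTr_single]
  have h : APos b (aff (g * w)⁻¹ a) ↔ APos b (aff g⁻¹ a) := by
    rw [mul_inv_rev, aff_mul, apos_aff_of_len_eq_zero b hw]
  by_cases h1 : APos b (aff g⁻¹ a)
  · rw [leftOp_pos q h1, leftOp_pos q (h.2 h1), rightTr_single, mul_assoc]
  · rw [leftOp_neg q h1, leftOp_neg q (fun h2 => h1 (h.1 h2)), map_add, map_smul, map_smul,
      rightTr_single, rightTr_single, mul_assoc]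

theorem leftTr_rightOp_comm (a : ι × ℤ) {w : ExtAffineWeyl R} (hw : len b w = 0) :
    leftTr A w * rightOp b q a = rightOp b q a * leftTr A w := by
  ext1 g
  refine LinearMap.ext_ring ?_
  simp only [LinearMap.comp_apply, Finsupp.lsingle_apply, Module.End.mul_apply, leftTr_single]
  have h : APos b (aff (w * g) a) ↔ APos b (aff g a) := by
    rw [← apos_aff_of_len_eq_zero b hw, ← aff_mul, inv_mul_cancel_left]
  by_cases h1 : APos b (aff g a)
  · rw [rightOp_pos q h1, rightOp_pos q (h.2 h1), leftTr_single, mul_assoc]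
  · rw [rightOp_neg q h1, rightOp_neg q (fun h2 => h1 (h.1 h2)), map_add, map_smul, map_smul,
      leftTr_single, leftTr_single, mul_assoc]

theorem leftTr_rightTr_comm (w w' : ExtAffineWeyl R) :
    leftTr A w * rightTr A w' = rightTr A w' * leftTr A w := by
  ext1 g
  refine LinearMap.ext_ring ?_
  simp only [LinearMap.comp_apply, Finsupp.lsingle_apply, Module.End.mul_apply, leftTr_single,
    rightTr_single, mul_assoc]

variable (b)

/-- The generators of the algebra of left multiplications. -/
def leftGens : Set (Module.End A (ExtAffineWeyl R →₀ A)) :=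
  {φ | (∃ a ∈ simpleAff b, φ = leftOp b q a) ∨ ∃ w, len b w = 0 ∧ φ = leftTr A w}

/-- The generators of the algebra of right multiplications. -/
def rightGens : Set (Module.End A (ExtAffineWeyl R →₀ A)) :=
  {φ | (∃ a ∈ simpleAff b, φ = rightOp b q a) ∨ ∃ w, len b w = 0 ∧ φ = rightTr A w}

theorem adjoin_le_centralizer :
    Algebra.adjoin A (leftGens b q) ≤ Subalgebra.centralizer A (rightGens b q) := by
  refine Algebra.adjoin_le ?_
  rintro φ hφ
  rw [SetLike.mem_coe, Subalgebra.mem_centralizer_iff]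
  rintro ψ hψ
  rcases hφ with ⟨a, ha, rfl⟩ | ⟨w, hw, rfl⟩ <;> rcases hψ with ⟨c, hc, rfl⟩ | ⟨u, hu, rfl⟩
  · exact (leftOp_rightOp_comm q ha hc).symm
  · exact (leftOp_rightTr_comm q a hu).symm
  · exact (leftTr_rightOp_comm q c hw).symm
  · exact (leftTr_rightTr_comm w u).symm

variable [R.IsIrreducible]

variable {b q} in
-- Operators generated by left multiplications commute with the right ones, and those carry the
-- basis vector at `1` to every other basis vector. The defining relations of `H` therefore need to
-- be checked only on the vector at `1`.
theorem eq_of_apply_one {φ ψ : Module.End A (ExtAffineWeyl R →₀ A)}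
    (hφ : φ ∈ Algebra.adjoin A (leftGens b q)) (hψ : ψ ∈ Algebra.adjoin A (leftGens b q))
    (h : φ (Finsupp.single 1 1) = ψ (Finsupp.single 1 1)) : φ = ψ := by
  have hφ' := (Subalgebra.mem_centralizer_iff A).1 (adjoin_le_centralizer b q hφ)
  have hψ' := (Subalgebra.mem_centralizer_iff A).1 (adjoin_le_centralizer b q hψ)
  ext1 g
  refine LinearMap.ext_ring ?_
  simp only [LinearMap.comp_apply, Finsupp.lsingle_apply]
  induction hn : len b g generalizing g with
  | zero =>
    have h1 := LinearMap.congr_fun (hφ' _ (Or.inr ⟨g, hn, rfl⟩)) (Finsupp.single 1 1)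
    have h2 := LinearMap.congr_fun (hψ' _ (Or.inr ⟨g, hn, rfl⟩)) (Finsupp.single 1 1)
    simp only [Module.End.mul_apply, rightTr_single, one_mul] at h1 h2
    rw [← h1, ← h2, h]
  | succ n ih =>
    obtain ⟨a, ha, hneg⟩ := exists_simpleAff_neg (b := b) (g := g⁻¹) (by rw [len_inv]; omega)
    rw [inv_inv] at hneg
    have hl := len_mul_aref_neg ha hneg
    have h1 := LinearMap.congr_fun (hφ' _ (Or.inl ⟨a, ha, rfl⟩)) (Finsupp.single (g * aref a) 1)
    have h2 := LinearMap.congr_fun (hψ' _ (Or.inl ⟨a, ha, rfl⟩)) (Finsupp.single (g * aref a) 1)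
    have hp := (apos_aff_aref b a g).2 hneg
    simp only [Module.End.mul_apply, rightOp_pos q hp, mul_assoc, aref_mul_self, mul_one] at h1 h2
    rw [← h1, ← h2, ih (g * aref a) (by omega)]

theorem exists_left (g : ExtAffineWeyl R) :
    ∃ φ ∈ Algebra.adjoin A (leftGens b q), φ (Finsupp.single 1 1) = Finsupp.single g 1 := by
  induction hn : len b g generalizing g with
  | zero =>
    exact ⟨leftTr A g, Algebra.subset_adjoin (Or.inr ⟨g, hn, rfl⟩), by rw [leftTr_single, mul_one]⟩
  | succ n ih =>
    obtain ⟨a, ha, hneg⟩ := exists_simpleAff_neg (b := b) (g := g) (by omega)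
    have hl := len_aref_mul_neg ha hneg
    obtain ⟨φ, hφ, h⟩ := ih (aref a * g) (by omega)
    refine ⟨leftOp b q a * φ, mul_mem (Algebra.subset_adjoin (Or.inl ⟨a, ha, rfl⟩)) hφ, ?_⟩
    rw [Module.End.mul_apply, h, leftOp_pos q ((apos_aff_aref_inv b a g).2 hneg),
      aref_mul_aref_mul]

/-- The operator of left multiplication by `T_g` in the regular representation. -/
def regOp (g : ExtAffineWeyl R) : Module.End A (ExtAffineWeyl R →₀ A) :=
  (exists_left b q g).choose

theorem regOp_mem (g : ExtAffineWeyl R) : regOp b q g ∈ Algebra.adjoin A (leftGens b q) :=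
  (exists_left b q g).choose_spec.1

theorem regOp_one_apply (g : ExtAffineWeyl R) :
    regOp b q g (Finsupp.single 1 1) = Finsupp.single g 1 :=
  (exists_left b q g).choose_spec.2

variable {b} in
theorem regOp_of_len_eq_zero {g : ExtAffineWeyl R} (hg : len b g = 0) :
    regOp b q g = leftTr A g :=
  eq_of_apply_one (regOp_mem b q g) (Algebra.subset_adjoin (Or.inr ⟨g, hg, rfl⟩))
    (by rw [regOp_one_apply, leftTr_single, mul_one])

variable {b} in
theorem regOp_aref_mul {a : ι × ℤ} (ha : a ∈ simpleAff b) {g : ExtAffineWeyl R}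
    (hg : APos b (aff g⁻¹ a)) : regOp b q (aref a * g) = leftOp b q a * regOp b q g :=
  eq_of_apply_one (regOp_mem b q _)
    (mul_mem (Algebra.subset_adjoin (Or.inl ⟨a, ha, rfl⟩)) (regOp_mem b q g))
    (by rw [regOp_one_apply, Module.End.mul_apply, regOp_one_apply, leftOp_pos q hg])

variable {b} in
theorem regOp_aref {a : ι × ℤ} (ha : a ∈ simpleAff b) : regOp b q (aref a) = leftOp b q a :=
  eq_of_apply_one (regOp_mem b q _) (Algebra.subset_adjoin (Or.inl ⟨a, ha, rfl⟩)) (by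
    rw [regOp_one_apply, leftOp_pos q, mul_one]
    rw [inv_one, aff_one]; exact apos_of_mem_simpleAff ha)

theorem regOp_apply (g h : ExtAffineWeyl R) (H : len b (g * h) = len b g + len b h) :
    regOp b q g (Finsupp.single h 1) = Finsupp.single (g * h) 1 := by
  induction hn : len b g generalizing g with
  | zero => rw [regOp_of_len_eq_zero q hn, leftTr_single]
  | succ n ih =>
    obtain ⟨a, ha, hneg⟩ := exists_simpleAff_neg (b := b) (g := g) (by omega)
    have hl := len_aref_mul_neg ha hneg
    have hp := (apos_aff_aref_inv b a g).2 hneg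
    have h1 := regOp_aref_mul (A := A) q ha hp
    rw [aref_mul_aref_mul] at h1
    have h2 := len_mul_le (b := b) (aref a * g) h
    rw [mul_assoc] at h2
    have hneg' : ¬ APos b (aff (g * h)⁻¹ a) := by
      intro hp'
      have := len_aref_mul ha hp'
      omega
    have h3 := len_aref_mul_neg ha hneg'
    rw [h1, Module.End.mul_apply, ih (aref a * g) (by rw [mul_assoc]; omega) (by omega),
      mul_assoc, leftOp_pos q ((apos_aff_aref_inv b a (g * h)).2 hneg'), aref_mul_aref_mul]

/-- The regular representation of the Hecke algebra. -/
def regRep : Hecke b A q →ₐ[A] Module.End A (ExtAffineWeyl R →₀ A) :=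
  RingQuot.liftAlgHom A ⟨FreeAlgebra.lift A (regOp b q), by
    intro x y h
    induction h with
    | one =>
      rw [FreeAlgebra.lift_ι_apply, map_one]
      refine eq_of_apply_one (regOp_mem b q _) (one_mem _) ?_
      rw [regOp_one_apply]; rfl
    | mul g h H =>
      rw [map_mul, FreeAlgebra.lift_ι_apply, FreeAlgebra.lift_ι_apply, FreeAlgebra.lift_ι_apply]
      refine eq_of_apply_one (mul_mem (regOp_mem b q _) (regOp_mem b q _)) (regOp_mem b q _) ?_
      rw [Module.End.mul_apply, regOp_one_apply, regOp_one_apply, regOp_apply b q g h H]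
    | quad s hs =>
      rw [simpleReflections_eq] at hs
      obtain ⟨a, ha, rfl⟩ := hs
      rw [map_mul, map_sub, map_add, map_one, map_zero, AlgHom.commutes,
        FreeAlgebra.lift_ι_apply, regOp_aref q ha]
      exact leftOp_quad q a⟩

theorem regRep_T (g : ExtAffineWeyl R) : regRep b q (T b A q g) = regOp b q g := by
  rw [regRep, T, RingQuot.liftAlgHom_mkAlgHom_apply, FreeAlgebra.lift_ι_apply]

/-- The coordinates of an element of the Hecke algebra in the basis `T_w`. -/
def coord : Hecke b A q →ₗ[A] (ExtAffineWeyl R →₀ A) :=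
  (LinearMap.applyₗ (R := A) (Finsupp.single 1 1)).comp (regRep b q).toLinearMap

@[simp] theorem coord_T (g : ExtAffineWeyl R) : coord b q (T b A q g) = Finsupp.single g 1 := by
  change regRep b q (T b A q g) (Finsupp.single 1 1) = _
  rw [regRep_T, regOp_one_apply]

/-- The algebra `H` is generated by the `T_s` for simple reflections `s` and the `T_g` for `g` of
length zero. -/
theorem mem_of_T_mem {B : Subalgebra A (Hecke b A q)}
    (h1 : ∀ a ∈ simpleAff b, T b A q (aref a) ∈ B) (h2 : ∀ g, len b g = 0 → T b A q g ∈ B)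
    (h : Hecke b A q) : h ∈ B := by
  have hT : ∀ g, T b A q g ∈ B := by
    intro g
    induction hn : len b g generalizing g with
    | zero => exact h2 g hn
    | succ n ih =>
      obtain ⟨a, ha, hneg⟩ := exists_simpleAff_neg (b := b) (g := g) (by omega)
      have hl := len_aref_mul_neg ha hneg
      have := T_aref_mul q (A := A) ha ((apos_aff_aref_inv b a g).2 hneg)
      rw [aref_mul_aref_mul] at this
      rw [← this]
      exact mul_mem (h1 a ha) (ih _ (by omega))
  obtain ⟨x, rfl⟩ := RingQuot.mkAlgHom_surjective A (HeckeRel b A q) h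
  induction x using FreeAlgebra.induction with
  | grade0 r => rw [AlgHom.commutes]; exact Subalgebra.algebraMap_mem _ _
  | grade1 g => exact hT g
  | mul x y hx hy => rw [map_mul]; exact mul_mem hx hy
  | add x y hx hy => rw [map_add]; exact add_mem hx hy

variable {q}

theorem isUnit_T (hq : IsUnit q) (g : ExtAffineWeyl R) : IsUnit (T b A q g) := by
  induction hn : len b g generalizing g with
  | zero =>
    have h1 : T b A q g * T b A q g⁻¹ = 1 := by
      rw [T_mul, mul_inv_cancel, T_one]
      rw [mul_inv_cancel, len_inv, hn, len_one]
    have h2 : T b A q g⁻¹ * T b A q g = 1 := by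
      rw [T_mul, inv_mul_cancel, T_one]
      rw [inv_mul_cancel, len_inv, hn, len_one]
    exact ⟨⟨_, _, h1, h2⟩, rfl⟩
  | succ n ih =>
    obtain ⟨a, ha, hneg⟩ := exists_simpleAff_neg (b := b) (g := g) (by omega)
    have hl := len_aref_mul_neg ha hneg
    have := T_aref_mul q (A := A) ha ((apos_aff_aref_inv b a g).2 hneg)
    rw [aref_mul_aref_mul] at this
    rw [← this]
    refine IsUnit.mul ?_ (ih _ (by omega))
    have h2 := T_aref_mul_self (A := A) q ha
    obtain ⟨r, hr⟩ := hq.exists_left_inv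
    have h3 : T b A q (aref a) * (T b A q (aref a) - algebraMap A _ (q - 1)) = algebraMap A _ q := by
      rw [mul_sub, h2, Algebra.smul_def, Algebra.smul_def, mul_one,
        Algebra.commutes (q - 1) (T b A q (aref a))]
      abel
    have h4 : (T b A q (aref a) - algebraMap A _ (q - 1)) * T b A q (aref a) = algebraMap A _ q := by
      rw [sub_mul, h2, Algebra.smul_def, Algebra.smul_def, mul_one]
      abel
    refine ⟨⟨T b A q (aref a), r • (T b A q (aref a) - algebraMap A _ (q - 1)), ?_, ?_⟩, rfl⟩
    · rw [mul_smul_comm, h3, Algebra.smul_def, ← map_mul, hr, map_one]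
    · rw [smul_mul_assoc, h4, Algebra.smul_def, ← map_mul, hr, map_one]

end HeckeBasis

/-! ### Symmetrizers of the finite Hecke algebra -/

section FiniteHecke

variable {ι V V' : Type*} [AddCommGroup V] [Module ℝ V] [AddCommGroup V'] [Module ℝ V']
  {R : RootPairing ι ℝ V V'} [Finite ι] [R.IsRootSystem] [R.IsCrystallographic] [R.IsReduced]
  {b : R.Base} {A : Type*} [CommRing A] (q : A)

/-- Induction on the length in the finite Weyl group. -/
theorem len_induction {p : R.weylGroup → Prop} (one : p 1)
    (mul : ∀ i ∈ b.support, ∀ u : R.weylGroup, b.IsPos (u⁻¹ • i) → p u → p (σ R i * u))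
    (w : R.weylGroup) : p w := by
  induction hn : len b (fin w) generalizing w with
  | zero => rw [eq_one_of_len hn]; exact one
  | succ n ih =>
    have : ∃ i ∈ b.support, ¬ b.IsPos (w⁻¹ • i) := by
      by_contra! h
      have := eq_one_of_isPos b h
      rw [inv_eq_one] at this
      rw [this, fin_one, len_one] at hn
      omega
    obtain ⟨i, hi, hneg⟩ := this
    have hl := len_refl_mul_neg hi hneg
    have := mul i hi (σ R i * w) (by
      rw [mul_inv_rev, mul_smul, refl_inv, refl_smul_self, smul_opp, isPos_opp]
      exact hneg) (ih _ (by omega))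
    rwa [← mul_assoc, refl_mul_self, one_mul] at this

theorem T_refl_mul {i : ι} (hi : i ∈ b.support) {u : R.weylGroup} (h : b.IsPos (u⁻¹ • i)) :
    T b A q (fin (σ R i)) * T b A q (fin u) = T b A q (fin (σ R i * u)) := by
  rw [T_mul, fin_mul]
  rw [← fin_mul, len_refl_mul hi h, len_refl hi, add_comm]

theorem T_mul_refl {i : ι} (hi : i ∈ b.support) {u : R.weylGroup} (h : b.IsPos (u • i)) :
    T b A q (fin u) * T b A q (fin (σ R i)) = T b A q (fin (u * σ R i)) := by
  rw [T_mul, fin_mul]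
  rw [← fin_mul, len_mul_refl hi h, len_refl hi]

theorem T_refl_mul_self {i : ι} (hi : i ∈ b.support) :
    T b A q (fin (σ R i)) * T b A q (fin (σ R i)) = (q - 1) • T b A q (fin (σ R i)) + q • 1 := by
  rw [← aref_zero]
  exact T_aref_mul_self q (mem_simpleAff hi)

theorem isPos_refl_mul_inv_smul (i : ι) (u : R.weylGroup) :
    b.IsPos ((σ R i * u)⁻¹ • i) ↔ ¬ b.IsPos (u⁻¹ • i) := by
  rw [mul_inv_rev, mul_smul, refl_inv, refl_smul_self, smul_opp, isPos_opp]

theorem isPos_mul_refl_smul (i : ι) (u : R.weylGroup) :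
    b.IsPos ((u * σ R i) • i) ↔ ¬ b.IsPos (u • i) := by
  rw [mul_smul, refl_smul_self, smul_opp, isPos_opp]

theorem T_refl_mul_neg {i : ι} (hi : i ∈ b.support) {u : R.weylGroup}
    (h : b.IsPos (u⁻¹ • i)) :
    T b A q (fin (σ R i)) * T b A q (fin (σ R i * u)) =
      (q - 1) • T b A q (fin (σ R i * u)) + q • T b A q (fin u) := by
  rw [← T_refl_mul q hi h, ← mul_assoc, T_refl_mul_self q hi, add_mul, smul_mul_assoc,
    smul_mul_assoc, one_mul]

theorem T_mul_refl_neg {i : ι} (hi : i ∈ b.support) {u : R.weylGroup}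
    (h : b.IsPos (u • i)) :
    T b A q (fin (u * σ R i)) * T b A q (fin (σ R i)) =
      (q - 1) • T b A q (fin (u * σ R i)) + q • T b A q (fin u) := by
  rw [← T_mul_refl q hi h, mul_assoc, T_refl_mul_self q hi, mul_add, mul_smul_comm,
    mul_smul_comm, mul_one]

variable (b) in
/-- The element `∑ e ^ l(w) T_w` of the finite Hecke algebra; for `e = 1` and `e = -q⁻¹` it is an
eigenvector of all `T_s`. -/
def symm (e : A) : Hecke b A q := ∑ w : R.weylGroup, e ^ len b (fin w) • T b A q (fin w)

variable {q}

/-- Pair `u` with the longer element `s u`. Since `a` and `c` are the roots of the quadratic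
relation, `T_u + e T_{su}` is an eigenvector of `T_s` with eigenvalue `a` exactly when `e c = -1`,
and the sum consists of multiples of such pairs. -/
theorem T_refl_mul_symm {a c e : A} (h1 : a + c = q - 1) (h2 : a * c = -q) (h3 : e * c = -1)
    {i : ι} (hi : i ∈ b.support) :
    T b A q (fin (σ R i)) * symm b q e = a • symm b q e := by
  have ha : e * q = a := by linear_combination e * h2 - a * h3
  rw [symm, Finset.mul_sum, Finset.smul_sum, ← sub_eq_zero, ← Finset.sum_sub_distrib]
  have key : ∀ u : R.weylGroup, b.IsPos (u⁻¹ • i) →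
      (T b A q (fin (σ R i)) * e ^ len b (fin u) • T b A q (fin u) -
        a • e ^ len b (fin u) • T b A q (fin u)) +
      (T b A q (fin (σ R i)) * e ^ len b (fin (σ R i * u)) • T b A q (fin (σ R i * u)) -
        a • e ^ len b (fin (σ R i * u)) • T b A q (fin (σ R i * u))) = 0 := by
    intro u hu
    rw [mul_smul_comm, mul_smul_comm, T_refl_mul q hi hu, T_refl_mul_neg q hi hu,
      len_refl_mul hi hu, pow_succ]
    rw [show q - 1 = a + c from h1.symm]
    generalize T b A q (fin (σ R i * u)) = x
    generalize T b A q (fin u) = y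
    have : ∀ r : A, r • x + (r * e) • c • x = 0 := fun r => by
      rw [smul_smul, mul_assoc, h3, ← add_smul]; simp
    have h4 : ∀ r : A, (r * e) • q • y = r • a • y := fun r => by
      rw [smul_smul, mul_assoc, ha, smul_smul]
    have h5 := this (e ^ len b (fin u))
    rw [smul_add, h4, add_smul, smul_add]
    refine Eq.trans ?_ h5
    module
  refine Finset.sum_involution (fun u _ => σ R i * u) ?_ ?_ (fun _ _ => Finset.mem_univ _) ?_
  · intro u _
    by_cases hu : b.IsPos (u⁻¹ • i)
    · exact key u hu
    · have := key (σ R i * u) ((isPos_refl_mul_inv_smul i u).2 hu)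
      rw [← mul_assoc, refl_mul_self, one_mul] at this
      rw [add_comm]; exact this
  · intro u _ _ h
    have := isPos_refl_mul_inv_smul (b := b) i u
    rw [h] at this
    tauto
  · intro u _
    rw [← mul_assoc, refl_mul_self, one_mul]

theorem symm_mul_T_refl {a c e : A} (h1 : a + c = q - 1) (h2 : a * c = -q) (h3 : e * c = -1)
    {i : ι} (hi : i ∈ b.support) :
    symm b q e * T b A q (fin (σ R i)) = a • symm b q e := by
  have ha : e * q = a := by linear_combination e * h2 - a * h3
  rw [symm, Finset.sum_mul, Finset.smul_sum, ← sub_eq_zero, ← Finset.sum_sub_distrib]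
  have key : ∀ u : R.weylGroup, b.IsPos (u • i) →
      (e ^ len b (fin u) • T b A q (fin u) * T b A q (fin (σ R i)) -
        a • e ^ len b (fin u) • T b A q (fin u)) +
      (e ^ len b (fin (u * σ R i)) • T b A q (fin (u * σ R i)) * T b A q (fin (σ R i)) -
        a • e ^ len b (fin (u * σ R i)) • T b A q (fin (u * σ R i))) = 0 := by
    intro u hu
    rw [smul_mul_assoc, smul_mul_assoc, T_mul_refl q hi hu, T_mul_refl_neg q hi hu,
      len_mul_refl hi hu, pow_succ]
    rw [show q - 1 = a + c from h1.symm]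
    generalize T b A q (fin (u * σ R i)) = x
    generalize T b A q (fin u) = y
    have : ∀ r : A, r • x + (r * e) • c • x = 0 := fun r => by
      rw [smul_smul, mul_assoc, h3, ← add_smul]; simp
    have h4 : ∀ r : A, (r * e) • q • y = r • a • y := fun r => by
      rw [smul_smul, mul_assoc, ha, smul_smul]
    have h5 := this (e ^ len b (fin u))
    rw [smul_add, h4, add_smul, smul_add]
    refine Eq.trans ?_ h5
    module
  refine Finset.sum_involution (fun u _ => u * σ R i) ?_ ?_ (fun _ _ => Finset.mem_univ _) ?_
  · intro u _
    by_cases hu : b.IsPos (u • i)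
    · exact key u hu
    · have := key (u * σ R i) ((isPos_mul_refl_smul i u).2 hu)
      rw [mul_assoc u, refl_mul_self, mul_one] at this
      rw [add_comm]; exact this
  · intro u _ _ h
    have := isPos_mul_refl_smul (b := b) i u
    rw [h] at this
    tauto
  · intro u _
    rw [mul_assoc, refl_mul_self, mul_one]

theorem T_fin_mul_symm {a c e : A} (h1 : a + c = q - 1) (h2 : a * c = -q) (h3 : e * c = -1)
    (u : R.weylGroup) : T b A q (fin u) * symm b q e = a ^ len b (fin u) • symm b q e := by
  induction u using len_induction (b := b) with
  | one => simp
  | mul i hi u hu ih =>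
    rw [← T_refl_mul q hi hu, mul_assoc, ih, mul_smul_comm, T_refl_mul_symm h1 h2 h3 hi,
      len_refl_mul hi hu, pow_succ, mul_smul]

theorem symm_mul_T_fin {a c e : A} (h1 : a + c = q - 1) (h2 : a * c = -q) (h3 : e * c = -1)
    (u : R.weylGroup) : symm b q e * T b A q (fin u) = a ^ len b (fin u) • symm b q e := by
  induction u using len_induction (b := b) with
  | one => simp
  | mul i hi u hu ih =>
    rw [← T_refl_mul q hi hu, ← mul_assoc, symm_mul_T_refl h1 h2 h3 hi, smul_mul_assoc, ih,
      len_refl_mul hi hu, pow_succ', mul_smul]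

/-- The scalar is the Poincaré polynomial of `W₀` at `e a`, which is `q` or `q⁻¹` for the two
symmetrizers. Its vanishing separates the two cases of the theorem. -/
theorem symm_mul_symm {a c e : A} (h1 : a + c = q - 1) (h2 : a * c = -q) (h3 : e * c = -1) :
    symm b q e * symm b q e = (∑ w : R.weylGroup, (e * a) ^ len b (fin w)) • symm b q e := by
  conv_lhs => enter [1]; rw [symm]
  rw [Finset.sum_mul, Finset.sum_smul]
  refine Finset.sum_congr rfl fun u _ => ?_
  rw [smul_mul_assoc, T_fin_mul_symm h1 h2 h3, smul_smul, mul_pow]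

end FiniteHecke

/-! ### Kazhdan–Lusztig polynomials of the longest element -/

section KazhdanLusztig

variable {ι V V' : Type*} [AddCommGroup V] [Module ℝ V] [AddCommGroup V'] [Module ℝ V']
  {R : RootPairing ι ℝ V V'} [Finite ι] [R.IsRootSystem] [R.IsCrystallographic] [R.IsReduced]
  {b : R.Base}

section Triangular

variable {A : Type*} [CommRing A] {q : A}

variable (b q) in
/-- The span of the `T_w` with `l(w) < n`. -/
def lenLT (n : ℕ) : Submodule A (Hecke b A q) :=
  Submodule.span A (T b A q '' {w | len b w < n})

theorem T_mem_lenLT {w : ExtAffineWeyl R} {n : ℕ} (h : len b w < n) : T b A q w ∈ lenLT b q n :=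
  Submodule.subset_span ⟨w, h, rfl⟩

theorem lenLT_mono {m n : ℕ} (h : m ≤ n) : lenLT b q m ≤ lenLT b q n :=
  Submodule.span_mono (Set.image_mono fun _ hw => lt_of_lt_of_le hw h)

theorem T_aref_mul_mem_lenLT {a : ι × ℤ} (ha : a ∈ simpleAff b) {n : ℕ} {h : Hecke b A q}
    (hh : h ∈ lenLT b q n) : T b A q (aref a) * h ∈ lenLT b q (n + 1) := by
  induction hh using Submodule.span_induction with
  | mem x hx =>
    obtain ⟨w, hw, rfl⟩ := hx
    change len b w < n at hw
    by_cases hp : APos b (aff w⁻¹ a)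
    · rw [T_aref_mul q ha hp]
      exact T_mem_lenLT (by rw [len_aref_mul ha hp]; omega)
    · rw [T_aref_mul_neg q ha hp]
      have := len_aref_mul_neg ha hp
      exact add_mem (Submodule.smul_mem _ _ (T_mem_lenLT (by omega)))
        (Submodule.smul_mem _ _ (T_mem_lenLT (by omega)))
  | zero => rw [mul_zero]; exact zero_mem _
  | add x y _ _ hx hy => rw [mul_add]; exact add_mem hx hy
  | smul r x _ hx => rw [mul_smul_comm]; exact Submodule.smul_mem _ _ hx

variable [R.IsIrreducible]

theorem coord_eq_zero_of_mem_lenLT {n : ℕ} {h : Hecke b A q} (hh : h ∈ lenLT b q n)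
    {w : ExtAffineWeyl R} (hw : n ≤ len b w) : coord b q h w = 0 := by
  induction hh using Submodule.span_induction with
  | mem x hx =>
    obtain ⟨u, hu, rfl⟩ := hx
    change len b u < n at hu
    rw [coord_T, Finsupp.single_eq_of_ne]
    rintro rfl
    omega
  | zero => simp
  | add x y _ _ hx hy => simp [hx, hy]
  | smul r x _ hx => simp [hx]

theorem inverse_T_aref {r : A} (hr : r * q = 1) {a : ι × ℤ} (ha : a ∈ simpleAff b) :
    Ring.inverse (T b A q (aref a)) = r • T b A q (aref a) - (r * (q - 1)) • 1 := by
  have hu := isUnit_T b (IsUnit.of_mul_eq_one r (by rw [mul_comm]; exact hr)) (aref (R := R) a)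
  refine hu.mul_left_cancel ?_
  rw [Ring.mul_inverse_cancel _ hu, mul_sub, mul_smul_comm, mul_smul_comm, T_aref_mul_self q ha,
    mul_one, smul_add, smul_smul, smul_smul, hr, one_smul]
  abel

/-- With `r = q⁻¹`, the inverse of `T_s` is `r T_s` plus a scalar. Splitting off one simple
reflection at a time shows that the bar involution is triangular with respect to the length. -/
theorem inverse_T_sub_mem {r : A} (hr : r * q = 1) (z : ExtAffineWeyl R) :
    Ring.inverse (T b A q z⁻¹) - r ^ len b z • T b A q z ∈ lenLT b q (len b z) := by
  have hq : IsUnit q := IsUnit.of_mul_eq_one r (by rw [mul_comm]; exact hr)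
  induction hn : len b z generalizing z with
  | zero =>
    have : Ring.inverse (T b A q z⁻¹) = T b A q z := by
      refine (isUnit_T b hq z⁻¹).mul_left_cancel ?_
      rw [Ring.mul_inverse_cancel _ (isUnit_T b hq _), T_mul, inv_mul_cancel, T_one]
      rw [inv_mul_cancel, len_inv, hn, len_one]
    rw [this, pow_zero, one_smul, sub_self]
    exact zero_mem _
  | succ n ih =>
    obtain ⟨a, ha, hneg⟩ := exists_simpleAff_neg (b := b) (g := z) (by omega)
    have hl := len_aref_mul_neg ha hneg
    have hp := (apos_aff_aref_inv b a z).2 hneg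
    have hT := T_aref_mul q (A := A) ha hp
    rw [aref_mul_aref_mul] at hT
    have hTi : T b A q (aref a * z)⁻¹ * T b A q (aref a) = T b A q z⁻¹ := by
      rw [T_mul_aref q ha hp, mul_inv_rev, aref_inv, mul_assoc, aref_mul_self, mul_one]
    have ih := ih (aref a * z) (by omega)
    have hi : Ring.inverse (T b A q z⁻¹) =
        Ring.inverse (T b A q (aref a)) * Ring.inverse (T b A q (aref a * z)⁻¹) := by
      have hu1 := isUnit_T (A := A) b hq (aref (R := R) a)
      have hu2 := isUnit_T (A := A) b hq (aref a * z)⁻¹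
      refine (isUnit_T b hq z⁻¹).mul_left_cancel ?_
      rw [Ring.mul_inverse_cancel _ (isUnit_T b hq _), ← hTi, mul_assoc, ← mul_assoc (T b A q (aref a)),
        Ring.mul_inverse_cancel _ hu1, one_mul, Ring.mul_inverse_cancel _ hu2]
    set Y := Ring.inverse (T b A q (aref a * z)⁻¹) - r ^ n • T b A q (aref a * z) with hY
    have hY' : Ring.inverse (T b A q (aref a * z)⁻¹) = r ^ n • T b A q (aref a * z) + Y := by
      rw [hY]; abel
    have e : Ring.inverse (T b A q z⁻¹) - r ^ (n + 1) • T b A q z =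
        r • (T b A q (aref a) * Y) - (r * (q - 1)) • Y -
          (r * (q - 1) * r ^ n) • T b A q (aref a * z) := by
      rw [hi, hY', inverse_T_aref hr ha, sub_mul, mul_add, mul_add, smul_mul_assoc, smul_mul_assoc,
        smul_mul_assoc, smul_mul_assoc, mul_smul_comm, hT, one_mul, one_mul]
      module
    rw [e]
    refine sub_mem (sub_mem (Submodule.smul_mem _ _ (T_aref_mul_mem_lenLT ha ih))
      (Submodule.smul_mem _ _ (lenLT_mono (by omega) ih)))
      (Submodule.smul_mem _ _ (T_mem_lenLT (by omega)))

end Triangular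

/-- The exponents on the left are at most `2 deg p < m`, those on the right at least `2m - 2 deg p >
m`. In polynomial form, `p` equals `X ^ (m - deg p)` times its reverse, and the power alone exceeds
the degree of `p`. -/
theorem eq_zero_of_aeval_eq {p : ℤ[X]} {m : ℕ} (hm : 2 * p.natDegree < m)
    (h : Polynomial.aeval (LaurentPolynomial.T 2 : ℤ[T;T⁻¹]) p =
      LaurentPolynomial.T (2 * m : ℤ) * Polynomial.aeval (LaurentPolynomial.T (-2) : ℤ[T;T⁻¹]) p) :
    p = 0 := by
  have hinj : Function.Injective (Polynomial.aeval (R := ℤ) (LaurentPolynomial.T 2 : ℤ[T;T⁻¹])) := by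
    have : (Polynomial.aeval (R := ℤ) (LaurentPolynomial.T 2 : ℤ[T;T⁻¹])) =
        (Polynomial.toLaurentAlg (R := ℤ)).comp (Polynomial.expand ℤ 2) := by
      ext
      simp
    rw [this]
    exact Polynomial.toLaurent_injective.comp (Polynomial.expand_injective (by norm_num))
  let : Invertible (LaurentPolynomial.T (-2) : ℤ[T;T⁻¹]) :=
    ⟨LaurentPolynomial.T 2, by rw [← LaurentPolynomial.T_add]; simp,
      by rw [← LaurentPolynomial.T_add]; simp⟩
  have h1 := Polynomial.eval₂_reverse_mul_pow (algebraMap ℤ ℤ[T;T⁻¹])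
    (LaurentPolynomial.T (-2) : ℤ[T;T⁻¹]) p
  rw [← Polynomial.aeval_def, ← Polynomial.aeval_def] at h1
  change Polynomial.aeval (LaurentPolynomial.T 2 : ℤ[T;T⁻¹]) p.reverse *
    (LaurentPolynomial.T (-2) : ℤ[T;T⁻¹]) ^ p.natDegree =
    Polynomial.aeval (LaurentPolynomial.T (-2) : ℤ[T;T⁻¹]) p at h1
  rw [← h1, LaurentPolynomial.T_pow, mul_left_comm, ← LaurentPolynomial.T_add] at h
  have h2 : (LaurentPolynomial.T (2 * m + p.natDegree * -2 : ℤ) : ℤ[T;T⁻¹]) =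
      Polynomial.aeval (LaurentPolynomial.T 2 : ℤ[T;T⁻¹])
        ((Polynomial.X : ℤ[X]) ^ (m - p.natDegree)) := by
    rw [map_pow, Polynomial.aeval_X, LaurentPolynomial.T_pow]
    congr 1
    have : p.natDegree ≤ m := by omega
    push_cast [this]
    ring
  rw [h2, ← map_mul] at h
  have h3 := hinj h
  by_contra hp
  have h4 : (Polynomial.X : ℤ[X]) ^ (m - p.natDegree) ∣ p := ⟨_, by rw [mul_comm]; exact h3⟩
  have := Polynomial.natDegree_le_of_dvd h4 hp
  rw [Polynomial.natDegree_X_pow] at this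
  omega

variable [R.IsIrreducible]

theorem T_two_inv : (LaurentPolynomial.T (-2) : ℤ[T;T⁻¹]) * LaurentPolynomial.T 2 = 1 := by
  rw [← LaurentPolynomial.T_add]; simp

theorem hecke_sub_smul {A : Type*} [CommRing A] {q : A} (r s : A) (h : Hecke b A q) :
    (r - s) • h = r • h - s • h := sub_smul r s h

/-- Take `y` of maximal length in the support of the difference and compare coefficients of `T_y`.
By triangularity only the term of `y` contributes, and the resulting symmetry of `d y` contradicts
the degree bound. -/
theorem IsKLFamily.unique {w : ExtAffineWeyl R} {P Q : ExtAffineWeyl R →₀ ℤ[X]}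
    (hP : IsKLFamily b w P) (hQ : IsKLFamily b w Q) : P = Q := by
  by_contra hne
  set d := P - Q with hd
  have hd0 : d.support.Nonempty := by
    rw [Finsupp.support_nonempty_iff, hd]
    exact sub_ne_zero.2 hne
  obtain ⟨y, hy, hmax⟩ := d.support.exists_max_image (len b) hd0
  have hdy : d y ≠ 0 := Finsupp.mem_support_iff.1 hy
  have hyw : y ≠ w := by
    rintro rfl
    exact hdy (by rw [hd, Finsupp.sub_apply, hP.self, hQ.self, sub_self])
  have hdeg : 2 * (d y).natDegree + len b y + 1 ≤ len b w := by
    by_cases h1 : P y = 0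
    · have h2 : Q y ≠ 0 := fun h2 => hdy (by rw [hd, Finsupp.sub_apply, h1, h2, sub_zero])
      have : d y = -Q y := by rw [hd, Finsupp.sub_apply, h1, zero_sub]
      rw [this, Polynomial.natDegree_neg]
      exact hQ.degree y h2 hyw
    · have h1' := hP.degree y h1 hyw
      by_cases h2 : Q y = 0
      · rw [hd, Finsupp.sub_apply, h2, sub_zero]; exact h1'
      · have h2' := hQ.degree y h2 hyw
        have := Polynomial.natDegree_sub_le (P y) (Q y)
        rw [hd, Finsupp.sub_apply]
        omega
  have hbar : (d.sum fun y p => (LaurentPolynomial.T (-(len b w : ℤ)) *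
        Polynomial.aeval (LaurentPolynomial.T 2 : ℤ[T;T⁻¹]) p) •
          T b ℤ[T;T⁻¹] (LaurentPolynomial.T 2) y) =
      d.sum fun y p => (LaurentPolynomial.T (len b w : ℤ) *
        Polynomial.aeval (LaurentPolynomial.T (-2) : ℤ[T;T⁻¹]) p) •
          Ring.inverse (T b ℤ[T;T⁻¹] (LaurentPolynomial.T 2) y⁻¹) := by
    rw [hd, Finsupp.sum_sub_index, Finsupp.sum_sub_index, hP.bar, hQ.bar]
    · intro _ _ _; rw [map_sub, mul_sub]; exact hecke_sub_smul _ _ _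
    · intro _ _ _; rw [map_sub, mul_sub]; exact hecke_sub_smul _ _ _
  have hc := DFunLike.congr_fun (congrArg (coord b _) hbar) y
  rw [Finsupp.sum, Finsupp.sum, map_sum, map_sum, Finsupp.finsetSum_apply,
    Finsupp.finsetSum_apply, Finset.sum_eq_single_of_mem y hy, Finset.sum_eq_single_of_mem y hy]
    at hc
  · rw [map_smul, map_smul, coord_T, Finsupp.smul_apply, Finsupp.smul_apply,
      Finsupp.single_eq_same, smul_eq_mul, smul_eq_mul, mul_one] at hc
    have h1 := coord_eq_zero_of_mem_lenLT (inverse_T_sub_mem (b := b) T_two_inv y) le_rfl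
    rw [map_sub, map_smul, coord_T, Finsupp.sub_apply, Finsupp.smul_apply,
      Finsupp.single_eq_same, smul_eq_mul, mul_one, sub_eq_zero] at h1
    rw [h1, LaurentPolynomial.T_pow] at hc
    refine hdy (eq_zero_of_aeval_eq (m := len b w - len b y) (by omega) ?_)
    have h2 := congrArg (fun z => LaurentPolynomial.T (len b w : ℤ) * z) hc
    rw [← mul_assoc, ← LaurentPolynomial.T_add, add_neg_cancel, LaurentPolynomial.T_zero, one_mul]
      at h2
    have h3 : (LaurentPolynomial.T (2 * (len b w - len b y : ℕ) : ℤ) : ℤ[T;T⁻¹]) =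
        LaurentPolynomial.T (len b w : ℤ) * (LaurentPolynomial.T (len b w : ℤ) *
          LaurentPolynomial.T ((len b y : ℤ) * -2)) := by
      rw [← LaurentPolynomial.T_add, ← LaurentPolynomial.T_add]
      congr 1
      have : len b y ≤ len b w := by omega
      push_cast [this]
      ring
    rw [h2, h3]
    ring
  · intro z hz hzy
    rw [map_smul, Finsupp.smul_apply]
    have h1 := coord_eq_zero_of_mem_lenLT (inverse_T_sub_mem (b := b) T_two_inv z) (hmax z hz)
    rw [map_sub, map_smul, coord_T, Finsupp.sub_apply, Finsupp.smul_apply,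
      Finsupp.single_eq_of_ne hzy.symm, smul_zero, sub_zero] at h1
    rw [h1, smul_zero]
  · intro z hz hzy
    rw [map_smul, coord_T, Finsupp.smul_apply, Finsupp.single_eq_of_ne hzy.symm, smul_zero]

variable (R) in
/-- The family of Kazhdan–Lusztig polynomials of the longest element of `W₀`. -/
def longestKL : ExtAffineWeyl R →₀ ℤ[X] :=
  (Finsupp.equivFunOnFinite.symm fun _ : R.weylGroup => (1 : ℤ[X])).embDomain
    ⟨fin, fin_injective⟩

theorem longestKL_fin (u : R.weylGroup) : longestKL R (fin u) = 1 :=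
  Finsupp.embDomain_apply_self ⟨fin, fin_injective⟩ _ u

theorem exists_of_longestKL_ne_zero {y : ExtAffineWeyl R} (h : longestKL R y ≠ 0) :
    ∃ u, fin u = y := by
  by_contra! h1
  exact h (Finsupp.embDomain_of_notMem_range _ _ _ (by rintro ⟨u, hu⟩; exact h1 u hu))

theorem longestKL_sum {M : Type*} [AddCommMonoid M] (f : ExtAffineWeyl R → ℤ[X] → M)
    (hf : ∀ y, f y 0 = 0) : (longestKL R).sum f = ∑ u : R.weylGroup, f (fin u) 1 := by
  rw [longestKL, Finsupp.sum_embDomain, Finsupp.sum_fintype _ _ fun _ => hf _]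
  rfl

theorem bruhatLE_longest (u : R.weylGroup) : BruhatLE b (fin u) (fin (longest b)) := by
  induction hn : len b (fin (longest b)) - len b (fin u) generalizing u with
  | zero =>
    have := len_le_longest b u
    rw [eq_longest (u := u) (b := b) (by omega)]
    exact Relation.ReflTransGen.refl
  | succ n ih =>
    have : ∃ i ∈ b.support, b.IsPos (u • i) := by
      by_contra! h
      have h1 : ∀ i ∈ b.support, b.IsPos ((longest b * u) • i) := fun i hi => by
        rw [mul_smul, longest_smul]; exact h i hi
      have h2 := eq_one_of_isPos b h1
      rw [mul_eq_one_iff_eq_inv, ← inv_eq_iff_eq_inv, longest_inv] at h2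
      rw [← h2] at hn
      omega
    obtain ⟨i, hi, hpos⟩ := this
    have hl := len_mul_refl hi hpos
    refine Relation.ReflTransGen.head (b := fin (u * σ R i)) ⟨⟨fin (σ R i), Or.inl ⟨i, hi, rfl⟩,
      1, ?_⟩, by omega⟩ (ih _ (by omega))
    rw [one_mul, inv_one, mul_one, fin_mul]

/-- Lengths add in `w₀ = u⁻¹ · (u w₀)`, so the bar involution sends `T_u` to `T_{u w₀} T_{w₀}⁻¹`.
The barred sum is `X T_{w₀}⁻¹`, and `X` is an eigenvector of right multiplication by `T_{w₀}` with
eigenvalue `v^{2 l(w₀)}`, where `v = T 1`. -/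
theorem isKLFamily_longest : IsKLFamily b (fin (longest b)) (longestKL R) where
  self := longestKL_fin _
  support y hy := by
    obtain ⟨u, rfl⟩ := exists_of_longestKL_ne_zero hy
    exact bruhatLE_longest u
  degree y hy hne := by
    obtain ⟨u, rfl⟩ := exists_of_longestKL_ne_zero hy
    rw [longestKL_fin, Polynomial.natDegree_one]
    have := len_lt_longest (b := b) (u := u) (fun h => hne (by rw [h]))
    omega
  bar := by
    rw [longestKL_sum _ (by simp), longestKL_sum _ (by simp)]
    simp only [map_one, mul_one]
    rw [← Finset.smul_sum, ← Finset.smul_sum]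
    set X := symm b (LaurentPolynomial.T 2 : ℤ[T;T⁻¹]) 1 with hX
    have hX' : ∑ u : R.weylGroup, T b ℤ[T;T⁻¹] (LaurentPolynomial.T 2) (fin u) = X := by
      rw [hX, symm]; simp
    have hq : IsUnit (LaurentPolynomial.T 2 : ℤ[T;T⁻¹]) := LaurentPolynomial.isUnit_T 2
    set Y := T b ℤ[T;T⁻¹] (LaurentPolynomial.T 2) (fin (longest b)) with hY
    have hYu : IsUnit Y := isUnit_T b hq _
    have h1 : ∀ u : R.weylGroup, Ring.inverse (T b ℤ[T;T⁻¹] (LaurentPolynomial.T 2) (fin u)⁻¹) =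
        T b ℤ[T;T⁻¹] (LaurentPolynomial.T 2) (fin (u * longest b)) * Ring.inverse Y := by
      intro u
      have hu : IsUnit (T b ℤ[T;T⁻¹] (LaurentPolynomial.T 2) (fin u)⁻¹) := isUnit_T b hq _
      refine hu.mul_left_cancel ?_
      rw [Ring.mul_inverse_cancel _ hu, ← mul_assoc, T_mul, ← fin_inv, ← fin_mul,
        inv_mul_cancel_left, Ring.mul_inverse_cancel _ hYu]
      have h2 := len_mul_longest (b := b) u
      have h3 := len_fin_inv (b := b) u
      rw [← fin_inv, ← fin_mul, inv_mul_cancel_left]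
      omega
    have h2 : ∑ u : R.weylGroup, Ring.inverse (T b ℤ[T;T⁻¹] (LaurentPolynomial.T 2) (fin u)⁻¹) =
        X * Ring.inverse Y := by
      rw [← hX', Finset.sum_mul, ← Equiv.sum_comp (Equiv.mulRight (longest b))
        fun u => T b ℤ[T;T⁻¹] (LaurentPolynomial.T 2) (fin u) * Ring.inverse Y]
      exact Finset.sum_congr rfl fun u _ => h1 u
    rw [h2, hX']
    refine hYu.mul_right_cancel ?_
    rw [smul_mul_assoc, smul_mul_assoc, mul_assoc, Ring.inverse_mul_cancel _ hYu, mul_one, hX, hY,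
      symm_mul_T_fin (a := LaurentPolynomial.T 2) (c := -1) (e := 1) (by ring) (by ring) (by ring),
      smul_smul, LaurentPolynomial.T_pow, ← LaurentPolynomial.T_add]
    congr 2
    ring

theorem klPoly_longest : klPoly b (fin (longest b)) = longestKL R :=
  (Classical.epsilon_spec (p := IsKLFamily b (fin (longest b))) ⟨_, isKLFamily_longest⟩).unique
    isKLFamily_longest

theorem C_longest {k : Type*} [Field k] (q v : k) :
    C b q v (fin (longest b)) = v⁻¹ ^ len b (fin (longest b)) • symm b q 1 := by
  rw [C, klPoly_longest, longestKL_sum _ (by simp), symm]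
  simp

theorem C'_longest {k : Type*} [Field k] (q v : k) :
    C' b q v (fin (longest b)) =
      (v ^ len b (fin (longest b)) * (-1) ^ len b (fin (longest b))) • symm b q (-q⁻¹) := by
  rw [C', klPoly_longest, longestKL_sum _ (by simp), symm, mul_smul, Finset.smul_sum (r := (-1) ^ _)]
  congr 1
  refine Finset.sum_congr rfl fun u _ => ?_
  rw [map_one, mul_one, smul_smul]
  congr 1
  have := len_le_longest b u
  obtain ⟨n, hn⟩ := Nat.exists_eq_add_of_le this
  rw [hn, Nat.add_sub_cancel_left, neg_pow, pow_add]
  have : ((-1 : k) ^ len b (fin u)) * (-1) ^ len b (fin u) = 1 := by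
    rw [← mul_pow]; simp
  linear_combination -(-1 : k) ^ n * q⁻¹ ^ len b (fin u) * this

end KazhdanLusztig

/-! ### The group algebra of the weight lattice and divided differences -/

section WeightAlgebra

variable {ι V V' : Type*} [AddCommGroup V] [Module ℝ V] [AddCommGroup V'] [Module ℝ V']

/-- The group algebra `k[P]` of the weight lattice. -/
abbrev WeightAlg (k : Type*) [Field k] (R : RootPairing ι ℝ V V') : Type _ :=
  AddMonoidAlgebra k (weightLattice R)

variable {R : RootPairing ι ℝ V V'} {k : Type*} [Field k]

/-- A subgroup of a rational vector space has unique sums, which makes `k[P]` a domain. Every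
cancellation in `k[P]` below rests on this. -/
instance : TwoUniqueSums (weightLattice R) := by
  let : Module ℚ V := Module.compHom V (algebraMap ℚ ℝ)
  exact TwoUniqueSums.of_injective_addHom (weightLattice R).subtype.toAddHom
    Subtype.val_injective inferInstance

variable (k) in
/-- The basis element of `k[P]` given by a weight. -/
def ex (x : weightLattice R) : WeightAlg k R := AddMonoidAlgebra.single x 1

@[simp] theorem ex_zero : ex k (0 : weightLattice R) = 1 := rfl

theorem ex_add (x y : weightLattice R) : ex k (x + y) = ex k x * ex k y := by
  rw [ex, ex, ex, AddMonoidAlgebra.single_mul_single, one_mul]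

theorem ex_injective : Function.Injective (ex k : weightLattice R → WeightAlg k R) :=
  AddMonoidAlgebra.single_left_injective one_ne_zero

theorem ex_ne_zero (x : weightLattice R) : ex k x ≠ 0 :=
  AddMonoidAlgebra.single_ne_zero.2 one_ne_zero

theorem ex_neg_mul (x : weightLattice R) : ex k (-x) * ex k x = 1 := by
  rw [← ex_add, neg_add_cancel, ex_zero]

theorem ex_mul_neg (x : weightLattice R) : ex k x * ex k (-x) = 1 := by
  rw [← ex_add, add_neg_cancel, ex_zero]

theorem ex_nsmul (n : ℕ) (x : weightLattice R) : ex k (n • x) = ex k x ^ n := by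
  induction n with
  | zero => simp
  | succ n ih => rw [succ_nsmul, ex_add, ih, pow_succ]

theorem ex_sum {κ : Type*} (s : Finset κ) (f : κ → weightLattice R) :
    ex k (∑ j ∈ s, f j) = ∏ j ∈ s, ex k (f j) := by
  classical
  induction s using Finset.induction_on with
  | empty => simp
  | insert j s hj ih => rw [Finset.sum_insert hj, Finset.prod_insert hj, ex_add, ih]

theorem weightAlg_induction {p : WeightAlg k R → Prop} (hex : ∀ x, p (ex k x))
    (hadd : ∀ f g, p f → p g → p (f + g)) (hsmul : ∀ (r : k) f, p f → p (r • f))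
    (f : WeightAlg k R) : p f := by
  induction f using AddMonoidAlgebra.induction_linear with
  | zero => simpa using hsmul 0 _ (hex 0)
  | add f g hf hg => exact hadd f g hf hg
  | single x r =>
    have := hsmul r _ (hex x)
    rwa [ex, AddMonoidAlgebra.smul_single, smul_eq_mul, mul_one] at this

/-- The action of the Weyl group on `k[P]`. -/
def wact (w : R.weylGroup) : WeightAlg k R →ₐ[k] WeightAlg k R :=
  AddMonoidAlgebra.mapDomainAlgHom k k (DistribSMul.toAddMonoidHom (weightLattice R) w)

@[simp] theorem wact_ex (w : R.weylGroup) (x : weightLattice R) :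
    wact w (ex k x) = ex k (w • x) :=
  AddMonoidAlgebra.mapDomain_single

@[simp] theorem wact_one (f : WeightAlg k R) : wact 1 f = f := by
  induction f using weightAlg_induction with
  | hex x => simp
  | hadd f g hf hg => rw [map_add, hf, hg]
  | hsmul r f hf => rw [map_smul, hf]

theorem wact_mul (u w : R.weylGroup) (f : WeightAlg k R) :
    wact (u * w) f = wact u (wact w f) := by
  induction f using weightAlg_induction with
  | hex x => simp [mul_smul]
  | hadd f g hf hg => rw [map_add, hf, hg, map_add, map_add]
  | hsmul r f hf => rw [map_smul, hf, map_smul, map_smul]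

@[simp] theorem wact_inv_wact (w : R.weylGroup) (f : WeightAlg k R) :
    wact w⁻¹ (wact w f) = f := by
  rw [← wact_mul, inv_mul_cancel, wact_one]

@[simp] theorem wact_wact_inv (w : R.weylGroup) (f : WeightAlg k R) :
    wact w (wact w⁻¹ f) = f := by
  rw [← wact_mul, mul_inv_cancel, wact_one]

theorem wact_refl_refl (i : ι) (f : WeightAlg k R) : wact (σ R i) (wact (σ R i) f) = f := by
  rw [← wact_mul, refl_mul_self, wact_one]

theorem wact_injective (w : R.weylGroup) :
    Function.Injective (wact w : WeightAlg k R → WeightAlg k R) :=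
  Function.LeftInverse.injective (wact_inv_wact w)

/-- Evaluation of elements of `k[P]` at a point of the torus. -/
def ev (t : Multiplicative (weightLattice R) →* kˣ) : WeightAlg k R →ₐ[k] k :=
  AddMonoidAlgebra.lift k k (weightLattice R) ((Units.coeHom k).comp t)

theorem ev_ex (t : Multiplicative (weightLattice R) →* kˣ) (x : weightLattice R) :
    ev t (ex k x) = t (Multiplicative.ofAdd x) := by
  rw [ev, ex, AddMonoidAlgebra.lift_single, one_smul]
  rfl

variable [R.IsCrystallographic]

variable (k) in
/-- The element `1 - e^{-α}` of `k[P]`, for a root `α`. -/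
def den (i : ι) : WeightAlg k R := 1 - ex k (-rootWeight R i)

theorem rootWeight_ne_zero (i : ι) : rootWeight R i ≠ 0 := by
  intro h
  have := pair_rootWeight_self (R := R) i
  rw [h, pair_zero] at this
  omega

theorem den_ne_zero (i : ι) : den k i ≠ (0 : WeightAlg k R) := by
  rw [den, sub_ne_zero, ← ex_zero]
  intro h
  have := ex_injective h
  exact rootWeight_ne_zero i (by rw [← neg_eq_zero, ← this])

theorem den_dvd_ex_sub (i : ι) (x : weightLattice R) (n : ℕ) :
    den k i ∣ ex k x - ex k (x - n • rootWeight R i) := by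
  rw [sub_eq_add_neg x, ex_add, ← smul_neg, ex_nsmul]
  have : ex k x - ex k x * ex k (-rootWeight R i) ^ n =
      ex k x * (1 ^ n - ex k (-rootWeight R i) ^ n) := by ring
  rw [this]
  exact Dvd.dvd.mul_left (sub_dvd_pow_sub_pow 1 _ n) _

theorem den_dvd_sub (i : ι) (f : WeightAlg k R) : den k i ∣ f - wact (σ R i) f := by
  induction f using weightAlg_induction with
  | hex x =>
    rw [wact_ex, refl_smul]
    obtain ⟨n, hn | hn⟩ := (pair x i).eq_nat_or_neg
    · rw [hn, natCast_zsmul]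
      exact den_dvd_ex_sub i x n
    · have := den_dvd_ex_sub (k := k) i (x - pair x i • rootWeight R i) n
      rw [← dvd_neg, neg_sub, hn, neg_smul, natCast_zsmul, sub_neg_eq_add, add_sub_cancel_right]
        at this
      rw [hn, neg_smul, natCast_zsmul, sub_neg_eq_add]
      exact this
  | hadd f g hf hg =>
    rw [map_add, add_sub_add_comm]
    exact dvd_add hf hg
  | hsmul r f hf =>
    rw [map_smul, ← smul_sub, Algebra.smul_def]
    exact Dvd.dvd.mul_left hf _

/-- The divided difference `(f - s f) / (1 - e^{-α})`. -/
def dem (i : ι) (f : WeightAlg k R) : WeightAlg k R := (den_dvd_sub i f).choose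

theorem den_mul_dem (i : ι) (f : WeightAlg k R) : den k i * dem i f = f - wact (σ R i) f :=
  (den_dvd_sub i f).choose_spec.symm

theorem den_mul_left_cancel {i : ι} {f g : WeightAlg k R} (h : den k i * f = den k i * g) :
    f = g := mul_left_cancel₀ (den_ne_zero i) h

theorem dem_add (i : ι) (f g : WeightAlg k R) : dem i (f + g) = dem i f + dem i g := by
  apply den_mul_left_cancel (i := i)
  rw [mul_add, den_mul_dem, den_mul_dem, den_mul_dem, map_add]
  ring

theorem dem_smul (i : ι) (r : k) (f : WeightAlg k R) : dem i (r • f) = r • dem i f := by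
  apply den_mul_left_cancel (i := i)
  rw [mul_smul_comm, den_mul_dem, den_mul_dem, map_smul, smul_sub]

theorem dem_mul (i : ι) (f g : WeightAlg k R) :
    dem i (f * g) = wact (σ R i) f * dem i g + dem i f * g := by
  apply den_mul_left_cancel (i := i)
  rw [mul_add, den_mul_dem, mul_left_comm, den_mul_dem, ← mul_assoc, den_mul_dem, map_mul]
  ring

theorem dem_of_invariant {i : ι} {f : WeightAlg k R} (h : wact (σ R i) f = f) : dem i f = 0 := by
  apply den_mul_left_cancel (i := i)
  rw [den_mul_dem, h, sub_self, mul_zero]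

theorem dem_of_pair_eq_one {i : ι} {x : weightLattice R} (h : pair x i = 1) :
    dem i (ex k x) = ex k x := by
  apply den_mul_left_cancel (i := i)
  rw [den_mul_dem, wact_ex, refl_smul, h, one_smul, sub_eq_add_neg x, ex_add, den]
  ring

end WeightAlgebra

/-! ### The elements θ and the Bernstein relation -/

section Bernstein

variable {ι V V' : Type*} [AddCommGroup V] [Module ℝ V] [AddCommGroup V'] [Module ℝ V']
  {R : RootPairing ι ℝ V V'} [Finite ι] [R.IsRootSystem] [R.IsCrystallographic] [R.IsReduced]
  {b : R.Base} {k : Type*} [Field k] {q v : k}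

theorem exists_large_weight (b : R.Base) (n : ι → ℤ) :
    ∃ z : weightLattice R, IsDominant b z ∧ ∀ i ∈ b.support, n i ≤ pair z i := by
  obtain ⟨z, hz⟩ := exists_weight b fun i => |n i|
  exact ⟨z, fun i hi => by rw [hz i hi]; exact abs_nonneg _,
    fun i hi => by rw [hz i hi]; exact le_abs_self _⟩

theorem isDominant_zero : IsDominant b (0 : weightLattice R) := fun i _ => by simp

variable (b q v) in
/-- The normalized basis element `q^{-l(x)/2} T_x` of a dominant weight. -/
def normT (x : weightLattice R) : Hecke b k q :=
  v⁻¹ ^ len b (transl x) • T b k q (transl x)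

theorem normT_add {x y : weightLattice R} (hx : IsDominant b x) (hy : IsDominant b y) :
    normT b q v x * normT b q v y = normT b q v (x + y) := by
  rw [normT, normT, normT, transl_add, smul_mul_smul_comm, T_mul q (len_transl_add hx hy),
    len_transl_add hx hy, pow_add]

theorem normT_zero : normT b q v (0 : weightLattice R) = 1 := by
  rw [normT, transl_zero, len_one, pow_zero, one_smul, T_one]

variable [R.IsIrreducible]

section
variable (hq : q ≠ 0) (hv : v ^ 2 = q)
include hq hv

theorem root_ne_zero : v ≠ 0 := by
  rintro rfl
  exact hq (by rw [← hv]; simp)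

theorem isUnit_normT (x : weightLattice R) : IsUnit (normT b q v x) := by
  rw [normT, Algebra.smul_def]
  refine IsUnit.mul (IsUnit.map _ (IsUnit.mk0 _ ?_)) (isUnit_T b (IsUnit.mk0 _ hq) _)
  exact pow_ne_zero _ (inv_ne_zero (root_ne_zero hq hv))

/-- The factor `normT z` is a unit, so this equation for any single `z` determines `θ_x`; it removes
the dependence on the dominant weights chosen in the definition. -/
theorem theta_mul_normT {x z : weightLattice R} (hz : IsDominant b z)
    (hxz : IsDominant b (x + z)) : theta b q v x * normT b q v z = normT b q v (x + z) := by
  have hv0 := root_ne_zero hq hv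
  obtain ⟨hy, hz', hx⟩ := (exists_dominant_sub b x).choose_spec
  set y := (exists_dominant_sub b x).choose.1 with hydef
  set z' := (exists_dominant_sub b x).choose.2 with hzdef
  have h1 : theta b q v x * normT b q v z' = normT b q v y := by
    rw [theta]
    simp only [← hydef, ← hzdef]
    rw [normT, smul_mul_smul_comm, mul_assoc (T b k q _),
      Ring.inverse_mul_cancel _ (isUnit_T b (IsUnit.mk0 _ hq) _), mul_one, normT, mul_assoc,
      ← mul_pow, mul_inv_cancel₀ hv0, one_pow, mul_one]
  refine (isUnit_normT (b := b) hq hv z').mul_right_cancel ?_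
  rw [mul_assoc, normT_add hz hz', add_comm, ← normT_add hz' hz, ← mul_assoc, h1, normT_add hy hz,
    normT_add hxz hz']
  congr 1
  rw [hx]
  abel

theorem theta_of_isDominant {x : weightLattice R} (hx : IsDominant b x) :
    theta b q v x = normT b q v x := by
  have := theta_mul_normT hq hv (b := b) (x := x) isDominant_zero (by rwa [add_zero])
  rwa [normT_zero, mul_one, add_zero] at this

theorem theta_zero : theta b q v (0 : weightLattice R) = 1 := by
  rw [theta_of_isDominant hq hv isDominant_zero, normT_zero]

theorem theta_add (x y : weightLattice R) :
    theta b q v (x + y) = theta b q v x * theta b q v y := by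
  obtain ⟨z, hz, hz'⟩ := exists_large_weight b fun i => max (-pair y i) (-pair (x + y) i)
  have h1 : IsDominant b (y + z) := fun i hi => by
    have := hz' i hi
    rw [max_le_iff] at this
    rw [pair_add]; linarith
  have h2 : IsDominant b (x + y + z) := fun i hi => by
    have := hz' i hi
    rw [max_le_iff] at this
    rw [pair_add]; linarith
  refine (isUnit_normT (b := b) hq hv z).mul_right_cancel ?_
  rw [theta_mul_normT hq hv hz h2, mul_assoc, theta_mul_normT hq hv hz h1,
    theta_mul_normT hq hv h1 (by rwa [← add_assoc]), add_assoc]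

/-- The algebra homomorphism `k[P] → H` with `e^x ↦ θ_x`. -/
def Theta (b : R.Base) : WeightAlg k R →ₐ[k] Hecke b k q :=
  AddMonoidAlgebra.lift k (Hecke b k q) (weightLattice R)
    { toFun := fun x => theta b q v x.toAdd
      map_one' := theta_zero hq hv
      map_mul' := fun x y => theta_add hq hv x.toAdd y.toAdd }

theorem Theta_ex (x : weightLattice R) : Theta hq hv b (ex k x) = theta b q v x := by
  rw [Theta, ex, AddMonoidAlgebra.lift_single, one_smul]
  rfl

theorem Theta_ofCoeff (f : weightLattice R →₀ k) :
    Theta hq hv b (.ofCoeff f) = f.sum fun x a => a • theta b q v x := by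
  rw [Theta, AddMonoidAlgebra.lift_apply]
  rfl

theorem len_transl_mul_refl {i : ι} (hi : i ∈ b.support) {x : weightLattice R}
    (hx : IsDominant b x) (h1 : 1 ≤ pair x i) :
    len b (transl x * fin (σ R i)) + 1 = len b (transl x) := by
  have := len_transl_mul_fin (b := b) (x := x) (u := σ R i) (fun j hj => pair_nonneg b hx hj)
    (fun j hj hneg => by
      have : j = i := by
        by_contra hne
        rw [refl_inv] at hneg
        exact hneg (isPos_refl b hi hne hj)
      rwa [this])
  rwa [len_refl hi] at this

theorem T_mul_T_transl {i : ι} {x : weightLattice R}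
    (hx : IsDominant b x) (h0 : pair x i = 0) :
    T b k q (fin (σ R i)) * T b k q (transl x) = T b k q (transl x) * T b k q (fin (σ R i)) := by
  have h1 : fin (σ R i) * transl x = transl x * fin (σ R i) := by
    rw [fin_mul_transl, refl_smul, h0, zero_smul, sub_zero]
  have h2 := len_fin_mul_transl (b := b) (σ R i) hx
  rw [T_mul q h2, T_mul q (by rw [← h1, h2, add_comm]), h1]

/-- As `l(x s) = l(x) - 1`, the left factor `T_x T_s⁻¹` is `T_{x s}`. In the group, `x · s · x = (x
+ s x) · s`, where `x + s x` is dominant and orthogonal to the coroot of `s`. Since `ξ(s x) = ξ(x) -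
2`, the lengths add on both sides. -/
theorem T_transl_mul_inverse {i : ι} (hi : i ∈ b.support) {x : weightLattice R}
    (hx : IsDominant b x) (h1 : pair x i = 1) :
    T b k q (transl x) * Ring.inverse (T b k q (fin (σ R i))) * T b k q (transl x) =
      T b k q (transl (x + σ R i • x)) * T b k q (fin (σ R i)) := by
  have hu := isUnit_T (A := k) b (IsUnit.mk0 _ hq) (fin (σ R i))
  have hl := len_transl_mul_refl hq hv hi hx h1.ge
  have h2 : T b k q (transl x * fin (σ R i)) * T b k q (fin (σ R i)) = T b k q (transl x) := by
    rw [T_mul, mul_assoc, ← fin_mul, refl_mul_self, fin_one, mul_one]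
    rw [mul_assoc, ← fin_mul, refl_mul_self, fin_one, mul_one, len_refl hi, hl]
  have hy : IsDominant b (x + σ R i • x) := fun j hj => by
    have hxj := hx j hj
    rw [refl_smul, h1, one_smul, pair_add, pair_sub]
    by_cases hij : j = i
    · subst hij; rw [pair_rootWeight_self, h1]; norm_num
    · have : pair (rootWeight R i) j ≤ 0 := by
        rw [pair_rootWeight]
        exact b.pairingIn_le_zero_of_ne (Ne.symm hij) hi hj
      linarith
  have hy0 : pair (x + σ R i • x) i = 0 := by
    rw [pair_add, pair_smul, refl_inv, refl_smul_self, pair_opp]; ring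
  have hg : transl x * fin (σ R i) * transl x = transl (x + σ R i • x) * fin (σ R i) := by
    rw [mul_assoc, fin_mul_transl, ← mul_assoc, transl_add]
  have hg' : fin (σ R i) * transl (x + σ R i • x) = transl (x + σ R i • x) * fin (σ R i) := by
    rw [fin_mul_transl, refl_smul, hy0, zero_smul, sub_zero]
  have hly := len_transl (b := b) hy
  have hlx := len_transl (b := b) hx
  rw [xi_add, xi_refl_smul hi, h1] at hly
  have h3 := len_fin_mul_transl (b := b) (σ R i) hy
  rw [len_refl hi] at h3
  rw [← h2, mul_assoc _ _ (Ring.inverse _), Ring.mul_inverse_cancel _ hu, mul_one, h2, T_mul, hg,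
    T_mul]
  · rw [← hg', h3, len_refl hi, add_comm]
  · rw [hg, ← hg', h3]
    omega

theorem inverse_T_refl {i : ι} (hi : i ∈ b.support) :
    q • Ring.inverse (T b k q (fin (σ R i))) = T b k q (fin (σ R i)) - (q - 1) • 1 := by
  have hu := isUnit_T (A := k) b (IsUnit.mk0 _ hq) (fin (σ R i))
  refine hu.mul_left_cancel ?_
  rw [mul_smul_comm, Ring.mul_inverse_cancel _ hu, mul_sub, T_refl_mul_self q hi, mul_smul_comm,
    mul_one]
  abel

/-- Here the divided difference of `e^x` is `e^x` itself, and since `T_s - (q - 1) = q T_s⁻¹` the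
relation reads `q T_s⁻¹ θ_x = θ_{s x} T_s`. Multiplied by `θ_x` from the left, it is the product
formula above up to powers of `v`. -/
theorem T_mul_Theta_of_pair_eq_one {i : ι} (hi : i ∈ b.support) {x : weightLattice R}
    (hx : IsDominant b x) (h1 : pair x i = 1) :
    T b k q (fin (σ R i)) * Theta hq hv b (ex k x) =
      Theta hq hv b (ex k (σ R i • x)) * T b k q (fin (σ R i)) +
        (q - 1) • Theta hq hv b (ex k x) := by
  have hv0 := root_ne_zero hq hv
  have hu : IsUnit (Theta hq hv b (ex k x)) := by
    rw [Theta_ex, theta_of_isDominant hq hv hx]; exact isUnit_normT hq hv x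
  rw [← sub_eq_iff_eq_add]
  have e1 : T b k q (fin (σ R i)) * Theta hq hv b (ex k x) - (q - 1) • Theta hq hv b (ex k x) =
      q • Ring.inverse (T b k q (fin (σ R i))) * Theta hq hv b (ex k x) := by
    rw [inverse_T_refl hq hv hi, sub_mul, smul_mul_assoc, one_mul]
  rw [e1]
  refine hu.mul_left_cancel ?_
  rw [← mul_assoc (Theta hq hv b _), ← mul_assoc (Theta hq hv b _), ← map_mul (Theta hq hv b),
    ← ex_add]
  have hy : IsDominant b (x + σ R i • x) := fun j hj => by
    have hxj := hx j hj
    rw [refl_smul, h1, one_smul, pair_add, pair_sub]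
    by_cases hij : j = i
    · subst hij; rw [pair_rootWeight_self, h1]; norm_num
    · have : pair (rootWeight R i) j ≤ 0 := by
        rw [pair_rootWeight]
        exact b.pairingIn_le_zero_of_ne (Ne.symm hij) hi hj
      linarith
  have hly := len_transl (b := b) hy
  have hlx := len_transl (b := b) hx
  rw [xi_add, xi_refl_smul hi, h1] at hly
  have hl : len b (transl x) + len b (transl x) = len b (transl (x + σ R i • x)) + 2 := by omega
  rw [Theta_ex, Theta_ex, theta_of_isDominant hq hv hx, theta_of_isDominant hq hv hy, normT, normT,
    mul_smul_comm, smul_mul_assoc, smul_mul_assoc, smul_mul_assoc, mul_smul_comm,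
    smul_mul_assoc, T_transl_mul_inverse hq hv hi hx h1, smul_smul, smul_smul]
  congr 1
  rw [← pow_add, hl, pow_add, mul_assoc, ← hv, ← mul_pow, inv_mul_cancel₀ hv0, one_pow,
    mul_one]

/-- The elements of `k[P]` that satisfy the Bernstein relation with `T_s`. -/
def bernsteinAlg (b : R.Base) (i : ι) : Subalgebra k (WeightAlg k R) where
  carrier := {f | T b k q (fin (σ R i)) * Theta hq hv b f =
      Theta hq hv b (wact (σ R i) f) * T b k q (fin (σ R i)) +
        (q - 1) • Theta hq hv b (dem i f)}
  mul_mem' := by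
    intro f g hf hg
    change _ = _ at hf
    change _ = _ at hg
    change _ = _
    rw [map_mul, ← mul_assoc, hf, add_mul, mul_assoc, hg, mul_add, dem_mul, map_mul, map_mul,
      map_add, map_mul, map_mul, smul_add, mul_smul_comm, smul_mul_assoc]
    simp only [mul_assoc]
    abel
  add_mem' := by
    intro f g hf hg
    change _ = _ at hf
    change _ = _ at hg
    change _ = _
    rw [map_add, mul_add, hf, hg, dem_add, map_add, map_add, map_add, smul_add, add_mul]
    abel
  algebraMap_mem' := by
    intro r
    change _ = _
    rw [AlgHom.commutes, AlgHom.commutes, AlgHom.commutes, dem_of_invariant (AlgHom.commutes _ _),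
      map_zero, smul_zero, add_zero, Algebra.commutes]

/-- Multiply the relation for `f` by `Θ(s g)` on the left and by `Θ(g)` on the right. Closure under
inverses is what leads from dominant weights to all weights. -/
theorem inv_mem_bernsteinAlg {i : ι} {f g : WeightAlg k R} (hfg : f * g = 1)
    (hf : f ∈ bernsteinAlg hq hv b i) : g ∈ bernsteinAlg hq hv b i := by
  change _ = _ at hf
  change _ = _
  have h1 : wact (σ R i) g * wact (σ R i) f = 1 := by rw [← map_mul, mul_comm, hfg, map_one]
  have h2 : dem i g = -(wact (σ R i) g * dem i f * g) := by
    have h3 := dem_mul i f g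
    rw [hfg, dem_of_invariant (map_one _)] at h3
    linear_combination (-wact (σ R i) g) * h3 - dem i g * h1
  have h4 := congrArg (fun h => Theta hq hv b (wact (σ R i) g) * h * Theta hq hv b g) hf
  simp only [mul_add, add_mul] at h4
  rw [← mul_assoc, mul_assoc, mul_assoc, ← map_mul (Theta hq hv b) f, hfg, map_one, mul_one,
    ← mul_assoc (Theta hq hv b (wact (σ R i) g)), ← map_mul (Theta hq hv b), h1, map_one, one_mul,
    mul_smul_comm, smul_mul_assoc, ← map_mul (Theta hq hv b), ← map_mul (Theta hq hv b)] at h4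
  rw [h4, h2, map_neg, smul_neg]
  abel

/-- A weight is a multiple of a dominant weight with pairing `1` plus a weight orthogonal to the
coroot. The latter is a difference of two dominant orthogonal weights, whose translations commute
with `s`. -/
theorem ex_mem_bernsteinAlg {i : ι} (hi : i ∈ b.support) (x : weightLattice R) :
    ex k x ∈ bernsteinAlg hq hv b i := by
  have hdom : ∀ y : weightLattice R, IsDominant b y → pair y i = 0 →
      ex k y ∈ bernsteinAlg hq hv b i := by
    intro y hy h0
    have hs : wact (σ R i) (ex k y) = ex k y := by
      rw [wact_ex, refl_smul, h0, zero_smul, sub_zero]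
    change _ = _
    rw [dem_of_invariant hs, hs, map_zero, smul_zero, add_zero, Theta_ex,
      theta_of_isDominant hq hv hy, normT, mul_smul_comm, smul_mul_assoc,
      T_mul_T_transl hq hv hy h0]
  have hzero : ∀ y : weightLattice R, pair y i = 0 → ex k y ∈ bernsteinAlg hq hv b i := by
    intro y h0
    obtain ⟨z, hz⟩ := exists_weight b fun j => |pair y j|
    have hz0 : pair z i = 0 := by rw [hz i hi, h0, abs_zero]
    have hzd : IsDominant b z := fun j hj => by rw [hz j hj]; exact abs_nonneg _
    have hyz : IsDominant b (y + z) := fun j hj => by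
      rw [pair_add, hz j hj]
      have := neg_abs_le (pair y j)
      linarith
    have h1 := hdom (y + z) hyz (by rw [pair_add, h0, hz0, add_zero])
    have h2 := inv_mem_bernsteinAlg hq hv (ex_mul_neg z) (hdom z hzd hz0)
    have := mul_mem h1 h2
    rwa [← ex_add, add_neg_cancel_right] at this
  classical
  obtain ⟨w, hw⟩ := exists_weight b fun j => if j = i then 1 else 0
  have hwi : pair w i = 1 := by rw [hw i hi, if_pos rfl]
  have hwd : IsDominant b w := fun j hj => by
    rw [hw j hj]; split_ifs <;> norm_num
  have hwm : ex k w ∈ bernsteinAlg hq hv b i := by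
    change _ = _
    rw [dem_of_pair_eq_one hwi, wact_ex]
    exact T_mul_Theta_of_pair_eq_one hq hv hi hwd hwi
  have hwm' := inv_mem_bernsteinAlg hq hv (ex_mul_neg w) hwm
  have hn : ∀ n : ℤ, ex k (n • w) ∈ bernsteinAlg hq hv b i := by
    intro n
    obtain ⟨m, rfl | rfl⟩ := n.eq_nat_or_neg
    · rw [natCast_zsmul, ex_nsmul]; exact pow_mem hwm m
    · rw [neg_smul, natCast_zsmul, ← smul_neg, ex_nsmul]; exact pow_mem hwm' m
  have := mul_mem (hn (pair x i)) (hzero (x - pair x i • w) (by simp [hwi]))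
  rwa [← ex_add, add_sub_cancel] at this

/-- The Bernstein relation. -/
theorem T_mul_Theta {i : ι} (hi : i ∈ b.support) (f : WeightAlg k R) :
    T b k q (fin (σ R i)) * Theta hq hv b f =
      Theta hq hv b (wact (σ R i) f) * T b k q (fin (σ R i)) +
        (q - 1) • Theta hq hv b (dem i f) := by
  change f ∈ bernsteinAlg hq hv b i
  induction f using weightAlg_induction with
  | hex x => exact ex_mem_bernsteinAlg hq hv hi x
  | hadd f g hf hg => exact add_mem hf hg
  | hsmul r f hf => exact Subalgebra.smul_mem _ hf r

theorem T_transl_mem {B : Subalgebra k (Hecke b k q)} (h2 : ∀ f, Theta hq hv b f ∈ B)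
    {x : weightLattice R} (hx : IsDominant b x) : T b k q (transl x) ∈ B := by
  have hv0 := root_ne_zero hq hv
  have := B.smul_mem (h2 (ex k x)) (v ^ len b (transl x))
  rwa [Theta_ex, theta_of_isDominant hq hv hx, normT, smul_smul, ← mul_pow, mul_inv_cancel₀ hv0,
    one_pow, one_smul] at this

/-- The Hecke algebra is generated by the finite Hecke algebra and the image of `k[P]`. -/
theorem mem_of_generators {B : Subalgebra k (Hecke b k q)}
    (h1 : ∀ i ∈ b.support, T b k q (fin (σ R i)) ∈ B) (h2 : ∀ f, Theta hq hv b f ∈ B)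
    (h : Hecke b k q) : h ∈ B := by
  have hfin : ∀ u : R.weylGroup, T b k q (fin u) ∈ B ∧ Ring.inverse (T b k q (fin u)) ∈ B := by
    intro u
    induction u using len_induction (b := b) with
    | one => simp
    | mul i hi u hu ih =>
      have hu1 := isUnit_T (A := k) b (IsUnit.mk0 _ hq) (fin (σ R i))
      have hu2 := isUnit_T (A := k) b (IsUnit.mk0 _ hq) (fin u)
      rw [← T_refl_mul q hi hu]
      refine ⟨mul_mem (h1 i hi) ih.1, ?_⟩
      have e : Ring.inverse (T b k q (fin (σ R i)) * T b k q (fin u)) =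
          Ring.inverse (T b k q (fin u)) * Ring.inverse (T b k q (fin (σ R i))) := by
        refine (hu1.mul hu2).mul_left_cancel ?_
        rw [Ring.mul_inverse_cancel _ (hu1.mul hu2), mul_assoc, ← mul_assoc (T b k q (fin u)),
          Ring.mul_inverse_cancel _ hu2, one_mul, Ring.mul_inverse_cancel _ hu1]
      rw [e]
      refine mul_mem ih.2 ?_
      have := B.smul_mem (Subalgebra.sub_mem _ (h1 i hi) (B.smul_mem (one_mem B) (q - 1))) q⁻¹
      rwa [← inverse_T_refl hq hv hi, smul_smul, inv_mul_cancel₀ hq, one_smul] at this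
  refine mem_of_T_mem b q ?_ ?_ h
  · intro a ha
    have hs : aref (R := R) a ∈ simpleReflections b := by
      rw [simpleReflections_eq]; exact ⟨a, ha, rfl⟩
    rcases hs with ⟨i, hi, hs⟩ | ⟨β, hβ, hs⟩
    · rw [hs]; exact h1 i hi
    · rw [hs]
      -- Since `β` is dominant and the lengths add, the affine generator is `T_β` times the inverse
      -- of a finite `T_w`. Elements of length zero are treated in the same way below.
      have hl := hβ.len_mul
      have e : T b k q (transl (rootWeight R β) * fin (σ R β)) * T b k q (fin (σ R β)) =
          T b k q (transl (rootWeight R β)) := by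
        rw [T_mul, mul_assoc, ← fin_mul, refl_mul_self, fin_one, mul_one]
        rw [mul_assoc, ← fin_mul, refl_mul_self, fin_one, mul_one, hl]
      have hu := isUnit_T (A := k) b (IsUnit.mk0 _ hq) (fin (σ R β))
      have e2 : T b k q (transl (rootWeight R β) * fin (σ R β)) =
          T b k q (transl (rootWeight R β)) * Ring.inverse (T b k q (fin (σ R β))) := by
        rw [← e, mul_assoc, Ring.mul_inverse_cancel _ hu, mul_one]
      rw [e2]
      exact mul_mem (T_transl_mem hq hv h2 hβ.isDominant) (hfin _).2
  · intro g hg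
    obtain ⟨hd, hl⟩ := len_transl_of_len_eq_zero hg
    have hgx : g * fin g.right⁻¹ = transl g.left.toAdd := by
      conv_lhs => rw [eq_transl_mul_fin g]
      rw [right_mul, right_transl, right_fin, one_mul, mul_assoc, ← fin_mul, mul_inv_cancel,
        fin_one, mul_one]
    have e : T b k q g * T b k q (fin g.right⁻¹) = T b k q (transl g.left.toAdd) := by
      rw [T_mul, hgx]
      rw [hgx, len_fin_inv, hl]
    have hu := isUnit_T (A := k) b (IsUnit.mk0 _ hq) (fin g.right⁻¹)
    have e2 : T b k q g =
        T b k q (transl g.left.toAdd) * Ring.inverse (T b k q (fin g.right⁻¹)) := by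
      rw [← e, mul_assoc, Ring.mul_inverse_cancel _ hu, mul_one]
    rw [e2]
    exact mul_mem (T_transl_mem hq hv h2 hd) (hfin _).2

open Classical in
theorem symm_mul_T_transl_coord (e : k) {x z : weightLattice R} (hx : IsDominant b x) :
    coord b q (symm b q e * T b k q (transl x)) (transl z) = if x = z then 1 else 0 := by
  classical
  rw [symm, Finset.sum_mul, map_sum, Finsupp.finsetSum_apply, Finset.sum_eq_single 1]
  · rw [fin_one, T_one, len_one, pow_zero, one_smul, one_mul, coord_T, Finsupp.single_apply]
    congr 1
    rw [eq_iff_iff]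
    refine ⟨fun h => ?_, fun h => by rw [h]⟩
    have := congrArg (fun g => g.left.toAdd) h
    simpa using this
  · intro w _ hw
    rw [smul_mul_assoc, T_mul q (len_fin_mul_transl w hx), map_smul, coord_T, Finsupp.smul_apply,
      Finsupp.single_eq_of_ne, smul_zero]
    intro h
    have := congrArg (fun g => g.right) h
    simp only [right_mul, right_fin, right_transl, mul_one] at this
    exact hw this.symm
  · intro h; exact absurd (Finset.mem_univ _) h

/-- Multiplication by `θ_z` with `z` sufficiently dominant makes every weight of `f` dominant. Then
`T_u T_x = T_{u x}` for all `u ∈ W₀`, and the coordinate at a pure translation sees only the summand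
`u = 1` of the symmetrizer, hence a single coefficient of `f`. -/
theorem symm_mul_Theta_injective (e : k) {f : WeightAlg k R}
    (h : symm b q e * Theta hq hv b f = 0) : f = 0 := by
  classical
  have hv0 := root_ne_zero hq hv
  obtain ⟨z, hz, hz'⟩ := exists_large_weight b fun i => ∑ x ∈ f.coeff.support, |pair x i|
  have hd : ∀ x ∈ f.coeff.support, IsDominant b (x + z) := by
    intro x hx i hi
    have h1 : |pair x i| ≤ ∑ x ∈ f.coeff.support, |pair x i| :=
      Finset.single_le_sum (f := fun x => |pair x i|) (fun _ _ => abs_nonneg _) hx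
    have h2 := neg_abs_le (pair x i)
    have h3 := hz' i hi
    rw [pair_add]
    linarith
  have h1 : symm b q e * Theta hq hv b f * theta b q v z = 0 := by rw [h, zero_mul]
  have hf : f = .ofCoeff f.coeff := rfl
  rw [hf, Theta_ofCoeff, Finsupp.sum, mul_assoc, Finset.sum_mul, Finset.mul_sum] at h1
  ext y
  by_contra hy
  have hy' : y ∈ f.coeff.support := Finsupp.mem_support_iff.2 hy
  have h2 := DFunLike.congr_fun (congrArg (coord b q) h1) (transl (y + z))
  rw [map_sum, Finsupp.finsetSum_apply, map_zero, Finsupp.zero_apply,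
    Finset.sum_eq_single_of_mem y hy'] at h2
  · rw [smul_mul_assoc, ← theta_add hq hv, theta_of_isDominant hq hv (hd y hy'), normT,
      mul_smul_comm, mul_smul_comm, map_smul, map_smul, Finsupp.smul_apply, Finsupp.smul_apply,
      symm_mul_T_transl_coord hq hv e (hd y hy'), if_pos rfl, smul_eq_mul, smul_eq_mul, mul_one]
      at h2
    rcases mul_eq_zero.1 h2 with h3 | h3
    · exact hy h3
    · exact pow_ne_zero _ (inv_ne_zero hv0) h3
  · intro x hx hxy
    rw [smul_mul_assoc, ← theta_add hq hv, theta_of_isDominant hq hv (hd x hx), normT,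
      mul_smul_comm, mul_smul_comm, map_smul, map_smul, Finsupp.smul_apply, Finsupp.smul_apply,
      symm_mul_T_transl_coord hq hv e (hd x hx), if_neg, smul_zero, smul_zero]
    intro h3
    exact hxy (add_right_cancel h3)

end

end Bernstein

/-! ### Elements of infinite order in group algebras -/

section Coprime

variable {k G : Type*} [Field k] [AddCommGroup G]

/-- In a group algebra, `1 - e^x` is not a zero divisor if `x` has infinite order. -/
theorem eq_zero_of_single_mul_eq {x : G} (hx : ∀ n : ℕ, n ≠ 0 → n • x ≠ 0)
    {h : AddMonoidAlgebra k G} (hh : AddMonoidAlgebra.single x 1 * h = h) : h = 0 := by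
  by_contra hne
  have hpow : ∀ n : ℕ, AddMonoidAlgebra.single (n • x) 1 * h = h := by
    intro n
    induction n with
    | zero => rw [zero_smul, ← AddMonoidAlgebra.one_def, one_mul]
    | succ n ih =>
      have : (AddMonoidAlgebra.single ((n + 1) • x) 1 : AddMonoidAlgebra k G) =
          AddMonoidAlgebra.single (n • x) 1 * AddMonoidAlgebra.single x 1 := by
        rw [AddMonoidAlgebra.single_mul_single, one_mul, succ_nsmul]
      rw [this, mul_assoc, hh, ih]
  have h0 : h.coeff ≠ 0 := fun h0 => hne (AddMonoidAlgebra.coeff_eq_zero.1 h0)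
  obtain ⟨y, hy⟩ := Finsupp.support_nonempty_iff.2 h0
  -- The support of `h` would be stable under translation by `x`, hence infinite.
  have hmem : ∀ n : ℕ, n • x + y ∈ h.coeff.support := by
    intro n
    rw [Finsupp.mem_support_iff]
    have h1 := congrArg (fun g => g.coeff (n • x + y)) (hpow n)
    rw [AddMonoidAlgebra.coeff_single_mul_apply, one_mul, neg_add_cancel_left] at h1
    rw [← h1]
    exact Finsupp.mem_support_iff.1 hy
  have hinj : Function.Injective fun n : ℕ => n • x + y := by
    intro m n hmn
    have hmn' : m • x = n • x := add_right_cancel hmn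
    by_contra hne'
    rcases lt_or_gt_of_ne hne' with hlt | hlt
    · refine hx (n - m) (by omega) ?_
      rw [sub_nsmul _ hlt.le, hmn', add_neg_cancel]
    · refine hx (m - n) (by omega) ?_
      rw [sub_nsmul _ hlt.le, hmn', add_neg_cancel]
  exact Set.infinite_of_injective_forall_mem hinj hmem h.coeff.support.finite_toSet

end Coprime

/-! ### Alternating sums and the Weyl denominator -/

section Alternants

variable {ι V V' : Type*} [AddCommGroup V] [Module ℝ V] [AddCommGroup V'] [Module ℝ V']
  {R : RootPairing ι ℝ V V'} [R.IsCrystallographic] {k : Type*} [Field k]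

theorem wact_den (w : R.weylGroup) (i : ι) : wact w (den k i) = den k (w • i) := by
  rw [den, map_sub, map_one, wact_ex, smul_neg, smul_rootWeight, den]

theorem den_opp (i : ι) : den k (opp R i) = -ex k (rootWeight R i) * den k i := by
  rw [den, den, rootWeight_opp, neg_neg, mul_sub, neg_mul, neg_mul, ex_mul_neg]
  ring

/-- Divisibility by `1 - e^{-α}` is detected in the group algebra of `P / ℤα`. -/
theorem den_dvd_of_mapDomain_eq_zero (i : ι) {h : WeightAlg k R}
    (hh : AddMonoidAlgebra.mapDomain
      (QuotientAddGroup.mk : weightLattice R → weightLattice R ⧸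
        AddSubgroup.zmultiples (rootWeight R i)) h = 0) : den k i ∣ h := by
  set π : weightLattice R → weightLattice R ⧸ AddSubgroup.zmultiples (rootWeight R i) :=
    QuotientAddGroup.mk
  have key : ∀ f : WeightAlg k R,
      den k i ∣ f - AddMonoidAlgebra.mapDomain Quotient.out (AddMonoidAlgebra.mapDomain π f) := by
    intro f
    induction f using AddMonoidAlgebra.induction_linear with
    | zero => simp
    | add f g hf hg =>
      rw [AddMonoidAlgebra.mapDomain_add, AddMonoidAlgebra.mapDomain_add, add_sub_add_comm]
      exact dvd_add hf hg
    | single x r =>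
      rw [AddMonoidAlgebra.mapDomain_single, AddMonoidAlgebra.mapDomain_single]
      have h1 : ∀ y : weightLattice R, (AddMonoidAlgebra.single y r : WeightAlg k R) =
          r • ex k y := fun y => by
        rw [ex, AddMonoidAlgebra.smul_single, smul_eq_mul, mul_one]
      rw [h1, h1, ← smul_sub, Algebra.smul_def]
      refine Dvd.dvd.mul_left ?_ _
      have h2 : π (Quotient.out (π x)) = π x := Quotient.out_eq _
      obtain ⟨n, hn⟩ := AddSubgroup.mem_zmultiples_iff.1 (QuotientAddGroup.eq.1 h2)
      have h3 : x = Quotient.out (π x) + n • rootWeight R i := by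
        rw [hn]; abel
      set y := Quotient.out (π x)
      obtain ⟨m, rfl | rfl⟩ := n.eq_nat_or_neg
      · have := den_dvd_ex_sub (k := k) i x m
        rw [natCast_zsmul] at h3
        rw [h3, add_sub_cancel_right] at this
        rwa [h3]
      · have := den_dvd_ex_sub (k := k) i y m
        rw [neg_smul, natCast_zsmul, ← sub_eq_add_neg] at h3
        rw [← h3] at this
        rw [← dvd_neg, neg_sub]
        exact this
  have := key h
  rwa [hh, AddMonoidAlgebra.mapDomain_zero, sub_zero] at this

/-- In the group algebra of `P / ℤα` the image of `1 - e^{-α}` is zero. The image of `1 - e^{-β}` is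
not a zero divisor for `β ≠ ±α`, because in a reduced system `β` has infinite order modulo `ℤα`. -/
theorem den_dvd_of_dvd_den_mul [R.IsRootSystem] [R.IsReduced] {i j : ι} (hij : j ≠ i) (hij' : j ≠ opp R i)
    {h : WeightAlg k R} (hd : den k i ∣ den k j * h) : den k i ∣ h := by
  apply den_dvd_of_mapDomain_eq_zero
  set π := QuotientAddGroup.mk' (AddSubgroup.zmultiples (rootWeight R i)) with hπ
  have hmul : ∀ f g : WeightAlg k R, AddMonoidAlgebra.mapDomain π (f * g) =
      AddMonoidAlgebra.mapDomain π f * AddMonoidAlgebra.mapDomain π g := fun f g =>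
    AddMonoidAlgebra.mapDomain_mul π f g
  have hden : ∀ l : ι, AddMonoidAlgebra.mapDomain π (den k l) =
      1 - AddMonoidAlgebra.single (π (-rootWeight R l)) 1 := by
    intro l
    have : (den k l : WeightAlg k R) =
        AddMonoidAlgebra.single 0 1 + AddMonoidAlgebra.single (-rootWeight R l) (-1) := by
      rw [den, sub_eq_add_neg, ex, AddMonoidAlgebra.one_def, ← AddMonoidAlgebra.single_neg]
    rw [this, AddMonoidAlgebra.mapDomain_add, AddMonoidAlgebra.mapDomain_single,
      AddMonoidAlgebra.mapDomain_single, map_zero, AddMonoidAlgebra.single_neg,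
      ← AddMonoidAlgebra.one_def, sub_eq_add_neg]
  have h0 : π (-rootWeight R i) = 0 := by
    rw [map_neg, neg_eq_zero]
    exact (QuotientAddGroup.eq_zero_iff _).2 (AddSubgroup.mem_zmultiples _)
  obtain ⟨g, hg⟩ := hd
  have h1 := congrArg (AddMonoidAlgebra.mapDomain π) hg
  rw [hmul, hmul, hden, hden, h0, ← AddMonoidAlgebra.one_def, sub_self, zero_mul, sub_mul, one_mul,
    sub_eq_zero] at h1
  change AddMonoidAlgebra.mapDomain π h = 0
  refine eq_zero_of_single_mul_eq (x := π (-rootWeight R j)) ?_ h1.symm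
  intro n hn hzero
  rw [← map_nsmul] at hzero
  obtain ⟨m, hm⟩ := AddSubgroup.mem_zmultiples_iff.1 ((QuotientAddGroup.eq_zero_iff _).1 hzero)
  have h2 := congrArg (Subtype.val) hm
  have h3 : (m : ℝ) • R.root i = -((n : ℝ) • R.root j) := by
    have : ((m • rootWeight R i : weightLattice R) : V) = m • R.root i := rfl
    rw [this] at h2
    have h4 : ((n • -rootWeight R j : weightLattice R) : V) = n • (-R.root j) := rfl
    rw [h4] at h2
    rw [← smul_neg, Int.cast_smul_eq_zsmul, Nat.cast_smul_eq_nsmul]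
    exact h2
  have hn' : (n : ℝ) ≠ 0 := by exact_mod_cast hn
  have hnl : ¬ LinearIndependent ℝ ![R.root i, R.root j] := by
    intro hli
    rw [LinearIndependent.pair_iff] at hli
    have := hli m n (by rw [h3]; simp)
    exact hn' this.2
  rcases RootPairing.IsReduced.eq_or_eq_neg i j hnl with h5 | h5
  · exact hij (R.root.injective h5.symm)
  · refine hij' (opp_eq_iff.2 ?_).symm
    rw [h5, neg_neg]

section Finite

variable [Finite ι] [R.IsRootSystem] [R.IsReduced] {b : R.Base}

theorem eq_or_eq_of_isPos {i j : ι} (hi : b.IsPos i) (hj : b.IsPos j) : j ≠ opp R i := by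
  rintro rfl
  exact (isPos_opp b i).1 hj hi

/-- The cancellation of `1 - e^{-β}` from divisibility by powers of `1 - e^{-α}` plays the role of
coprimality, so unique factorization in `k[P]` is not needed. -/
theorem prod_den_pow_dvd {S : Finset ι} (hS : ∀ i ∈ S, b.IsPos i) (m : ℕ) {g : WeightAlg k R}
    (h : ∀ i ∈ S, den k i ^ m ∣ g) : ∏ i ∈ S, den k i ^ m ∣ g := by
  classical
  have hcancel : ∀ i j : ι, b.IsPos i → b.IsPos j → j ≠ i → ∀ (n : ℕ) (f : WeightAlg k R),
      den k i ^ n ∣ den k j * f → den k i ^ n ∣ f := by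
    intro i j hi hj hij n
    induction n with
    | zero => intro f _; simp
    | succ n ih =>
      intro f hf
      obtain ⟨f', rfl⟩ := den_dvd_of_dvd_den_mul hij (eq_or_eq_of_isPos hi hj)
        ((dvd_pow_self _ n.succ_ne_zero).trans hf)
      rw [pow_succ'] at hf ⊢
      rw [mul_left_comm] at hf
      exact mul_dvd_mul_left _ (ih f' ((mul_dvd_mul_iff_left (den_ne_zero i)).1 hf))
  induction S using Finset.induction_on with
  | empty => simp
  | insert i S hiS ih =>
    have hpos := hS i (Finset.mem_insert_self i S)
    obtain ⟨f, hf⟩ := ih (fun j hj => hS j (Finset.mem_insert_of_mem hj))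
      (fun j hj => h j (Finset.mem_insert_of_mem hj))
    rw [Finset.prod_insert hiS, hf, mul_comm]
    refine mul_dvd_mul_left _ ?_
    have h1 := h i (Finset.mem_insert_self i S)
    rw [hf] at h1
    clear hf ih h
    induction S using Finset.induction_on with
    | empty => simpa using h1
    | insert j S hjS ih =>
      have hne : j ≠ i := fun hji => hiS (by rw [hji]; exact Finset.mem_insert_self _ _)
      rw [Finset.prod_insert hjS, mul_assoc] at h1
      refine ih (fun hi => hiS (Finset.mem_insert_of_mem hi)) ?_ ?_
      · intro l hl
        rcases Finset.mem_insert.1 hl with rfl | hl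
        · exact hpos
        · exact hS l (Finset.mem_insert_of_mem (Finset.mem_insert_of_mem hl))
      · have hj : b.IsPos j :=
          hS j (Finset.mem_insert_of_mem (Finset.mem_insert_self _ _))
        have : ∀ (n : ℕ) (f : WeightAlg k R),
            den k i ^ m ∣ den k j ^ n * f → den k i ^ m ∣ f := by
          intro n
          induction n with
          | zero => intro f hf; simpa using hf
          | succ n ih =>
            intro f hf
            rw [pow_succ', mul_assoc] at hf
            exact ih f (hcancel i j hpos hj hne m _ hf)
        exact this m _ h1

variable (k) in
/-- The element `a + c e^{-α}`. -/
def lin (a c : k) (i : ι) : WeightAlg k R := algebraMap k _ a + c • ex k (-rootWeight R i)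

theorem lin_one_neg (i : ι) : lin k 1 (-1) i = (den k i : WeightAlg k R) := by
  rw [lin, den, map_one, neg_smul, one_smul, sub_eq_add_neg]

theorem wact_lin (w : R.weylGroup) (a c : k) (i : ι) :
    wact w (lin k a c i) = lin k a c (w • i) := by
  rw [lin, map_add, AlgHom.commutes, map_smul, wact_ex, smul_neg, smul_rootWeight, lin]

theorem lin_opp (a c : k) (i : ι) : lin k a c (opp R i) = ex k (rootWeight R i) * lin k c a i := by
  rw [lin, lin, rootWeight_opp, neg_neg, mul_add, mul_smul_comm, ex_mul_neg, mul_comm,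
    ← Algebra.smul_def, add_comm, ← Algebra.algebraMap_eq_smul_one]

theorem lin_ne_zero {a c : k} (hc : c ≠ 0) (i : ι) : lin k a c i ≠ (0 : WeightAlg k R) := by
  intro h
  have h1 := congrArg (fun f => f.coeff (-rootWeight R i)) h
  have h2 : (algebraMap k (WeightAlg k R) a) = AddMonoidAlgebra.single 0 a := rfl
  have h3 : (0 : weightLattice R) ≠ -rootWeight R i := by
    rw [ne_comm, neg_ne_zero]; exact rootWeight_ne_zero i
  simp [lin, h2, ex, h3] at h1
  exact hc h1

variable (b) in
/-- The product `e^ρ ∏ (a + c e^{-α})` over the positive roots; for `a = 1` and `c = -1` this is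
the Weyl denominator. -/
def qprod (a c : k) : WeightAlg k R := ex k (rho b) * ∏ i ∈ posRoots b, lin k a c i

theorem qprod_ne_zero {a c : k} (hc : c ≠ 0) : qprod b a c ≠ (0 : WeightAlg k R) :=
  mul_ne_zero (ex_ne_zero _) (Finset.prod_ne_zero_iff.2 fun _ _ => lin_ne_zero hc _)

theorem prod_posRoots_refl {i : ι} (hi : i ∈ b.support) {M : Type*} [CommMonoid M] (F : ι → M) :
    (∏ j ∈ posRoots b, F (σ R i • j)) * F i = (∏ j ∈ posRoots b, F j) * F (opp R i) := by
  classical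
  have hmem : i ∈ posRoots b := (mem_posRoots b).2 (isPos_simple b hi)
  rw [← Finset.mul_prod_erase _ _ hmem, ← Finset.mul_prod_erase (posRoots b) F hmem,
    refl_smul_self]
  have : ∏ j ∈ (posRoots b).erase i, F (σ R i • j) = ∏ j ∈ (posRoots b).erase i, F j := by
    refine Finset.prod_bij' (fun j _ => σ R i • j) (fun j _ => σ R i • j) ?_ ?_ ?_ ?_ ?_
    · intro j hj
      rw [Finset.mem_erase, mem_posRoots] at hj ⊢
      refine ⟨fun h => ?_, isPos_refl b hi hj.1 hj.2⟩
      have h2 := congrArg (fun l => σ R i • l) h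
      simp only [← mul_smul, refl_mul_self, one_smul] at h2
      rw [refl_smul_self] at h2
      rw [h2, isPos_opp] at hj
      exact hj.2 (isPos_simple b hi)
    · intro j hj
      rw [Finset.mem_erase, mem_posRoots] at hj ⊢
      refine ⟨fun h => ?_, isPos_refl b hi hj.1 hj.2⟩
      have h2 := congrArg (fun l => σ R i • l) h
      simp only [← mul_smul, refl_mul_self, one_smul] at h2
      rw [refl_smul_self] at h2
      rw [h2, isPos_opp] at hj
      exact hj.2 (isPos_simple b hi)
    · intro j _; rw [← mul_smul, refl_mul_self, one_smul]
    · intro j _; rw [← mul_smul, refl_mul_self, one_smul]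
    · intro j _; rfl
  rw [this]
  exact (mul_right_comm _ _ _).trans ((mul_comm _ _).trans (by rw [← mul_assoc, mul_right_comm]; rw [mul_comm (F i)]))

/-- The reflection permutes the factors of the positive roots other than `i`. The factor at `i`
moves to the opposite root, which swaps `a` and `c` and produces an `e^α` that compensates `s ρ = ρ
- α`. -/
theorem lin_mul_wact_qprod {i : ι} (hi : i ∈ b.support) (a c : k) :
    lin k a c i * wact (σ R i) (qprod b a c) = lin k c a i * qprod b a c := by
  have h := prod_posRoots_refl hi (fun j => (lin k a c j : WeightAlg k R))
  rw [lin_opp] at h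
  rw [qprod, map_mul, map_prod, wact_ex, refl_smul_rho hi]
  simp only [wact_lin]
  have e : ex k (rho b - rootWeight R i) * ex k (rootWeight R i) = ex k (rho b) := by
    rw [← ex_add, sub_add_cancel]
  rw [← e]
  linear_combination ex k (rho b - rootWeight R i) * h

variable (k b) in
/-- The Weyl denominator `e^ρ ∏ (1 - e^{-α})`. -/
def weylDen : WeightAlg k R := qprod b 1 (-1)

theorem weylDen_eq : weylDen k b = ex k (rho b) * ∏ i ∈ posRoots b, den k i := by
  rw [weylDen, qprod]
  simp only [lin_one_neg]

theorem weylDen_ne_zero : weylDen k b ≠ (0 : WeightAlg k R) := qprod_ne_zero (by simp)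

theorem wact_refl_weylDen {i : ι} (hi : i ∈ b.support) :
    wact (σ R i) (weylDen k b) = -weylDen k b := by
  have h := lin_mul_wact_qprod hi (1 : k) (-1)
  have h2 : lin k (-1) 1 i = -(lin k 1 (-1) i : WeightAlg k R) := by
    rw [lin, lin, map_neg, neg_smul, neg_add, neg_neg]
  rw [h2] at h
  refine mul_left_cancel₀ (lin_ne_zero (a := (1 : k)) (c := -1) (by simp) i) ?_
  rw [weylDen, h]
  ring

theorem wact_weylDen (w : R.weylGroup) :
    wact w (weylDen k b) = (eps b w : k) • weylDen k b := by
  induction w using weyl_induction b with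
  | one => simp
  | mul i hi w ih =>
    rw [wact_mul, ih, map_smul, wact_refl_weylDen hi, eps_refl_mul_simple hi, Int.cast_neg,
      neg_smul, smul_neg]

theorem eps_sq (w : R.weylGroup) : (eps b w : k) * eps b w = 1 := by
  exact_mod_cast congrArg (Int.cast : ℤ → k) (eps_mul_self (b := b) w)

variable (b) in
/-- The alternating sum of the Weyl group translates. -/
def alt (f : WeightAlg k R) : WeightAlg k R := ∑ w : R.weylGroup, (eps b w : k) • wact w f

theorem alt_add (f g : WeightAlg k R) : alt b (f + g) = alt b f + alt b g := by
  simp only [alt, map_add, smul_add, Finset.sum_add_distrib]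

theorem wact_alt (u : R.weylGroup) (f : WeightAlg k R) :
    wact u (alt b f) = (eps b u : k) • alt b f := by
  rw [alt, map_sum, Finset.smul_sum, ← Equiv.sum_comp (Equiv.mulLeft u)
    fun w => (eps b u : k) • (eps b w : k) • wact w f]
  refine Finset.sum_congr rfl fun w _ => ?_
  rw [Equiv.coe_mulLeft, map_smul, ← wact_mul, eps_mul, Int.cast_mul, smul_smul, ← mul_assoc, eps_sq,
    one_mul]

theorem alt_mul_of_invariant {g : WeightAlg k R} (hg : ∀ w, wact w g = g) (f : WeightAlg k R) :
    alt b (g * f) = g * alt b f := by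
  simp only [alt, Finset.mul_sum, map_mul, hg, mul_smul_comm]

theorem den_dvd_sub_refl (j : ι) (u : R.weylGroup) (f : WeightAlg k R) :
    den k j ∣ wact u f - wact (σ R j * u) f := by
  rw [wact_mul]; exact den_dvd_sub j _

/-- Group `w` with `σ R j * w`. The signs are opposite, so each pair contributes, up to sign, a
difference of an element and its reflection. This grouping works in characteristic two as well. -/
theorem den_dvd_alt (j : ι) (f : WeightAlg k R) : den k j ∣ alt b f := by
  classical
  rw [alt, ← Finset.sum_filter_add_sum_filter_not Finset.univ
    (fun w : R.weylGroup => b.IsPos (w⁻¹ • j))]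
  have h : ∑ w : R.weylGroup with ¬ b.IsPos (w⁻¹ • j), (eps b w : k) • wact w f =
      ∑ w : R.weylGroup with b.IsPos (w⁻¹ • j), (eps b (σ R j * w) : k) • wact (σ R j * w) f := by
    refine Finset.sum_bij' (fun w _ => σ R j * w) (fun w _ => σ R j * w) ?_ ?_ ?_ ?_ ?_
    · intro w hw
      rw [Finset.mem_filter] at hw ⊢
      exact ⟨Finset.mem_univ _, (isPos_refl_mul_inv_smul j w).2 hw.2⟩
    · intro w hw
      rw [Finset.mem_filter] at hw ⊢
      exact ⟨Finset.mem_univ _, fun h => (isPos_refl_mul_inv_smul j w).1 h hw.2⟩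
    · intro w _; rw [← mul_assoc, refl_mul_self, one_mul]
    · intro w _; rw [← mul_assoc, refl_mul_self, one_mul]
    · intro w _; rw [← mul_assoc, refl_mul_self, one_mul]
  rw [h, ← Finset.sum_add_distrib]
  refine Finset.dvd_sum fun w _ => ?_
  rw [eps_mul, eps_refl, neg_one_mul, Int.cast_neg, neg_smul, ← sub_eq_add_neg, ← smul_sub,
    Algebra.smul_def]
  exact Dvd.dvd.mul_left (den_dvd_sub_refl j w f) _

theorem weylDen_pow_dvd {g : WeightAlg k R} {m : ℕ} (h : ∀ j, b.IsPos j → den k j ^ m ∣ g) :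
    weylDen k b ^ m ∣ g := by
  have h1 := prod_den_pow_dvd (b := b) (S := posRoots b) (fun i hi => (mem_posRoots b).1 hi) m
    (fun i hi => h i ((mem_posRoots b).1 hi))
  rw [Finset.prod_pow] at h1
  rw [weylDen_eq, mul_pow]
  have hu : IsUnit (ex k (rho b) ^ m) := by
    refine IsUnit.pow m ⟨⟨ex k (rho b), ex k (-rho b), ex_mul_neg _, ex_neg_mul _⟩, rfl⟩
  exact (IsUnit.mul_left_dvd hu).2 h1

theorem weylDen_dvd_alt (f : WeightAlg k R) : weylDen k b ∣ alt b f := by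
  have := weylDen_pow_dvd (b := b) (g := alt b f) (m := 1) fun j _ => by
    rw [pow_one]; exact den_dvd_alt j f
  rwa [pow_one] at this

variable (b) in
/-- The quotient of the alternating sum by the Weyl denominator. -/
def nrm (f : WeightAlg k R) : WeightAlg k R := (weylDen_dvd_alt (b := b) f).choose

theorem weylDen_mul_nrm (f : WeightAlg k R) : weylDen k b * nrm b f = alt b f :=
  (weylDen_dvd_alt f).choose_spec.symm

theorem eq_of_weylDen_mul {f g : WeightAlg k R} (h : weylDen k b * f = weylDen k b * g) : f = g :=
  mul_left_cancel₀ weylDen_ne_zero h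

theorem nrm_add (f g : WeightAlg k R) : nrm b (f + g) = nrm b f + nrm b g := by
  apply eq_of_weylDen_mul (b := b)
  rw [mul_add, weylDen_mul_nrm, weylDen_mul_nrm, weylDen_mul_nrm, alt_add]

theorem nrm_mul_of_invariant {g : WeightAlg k R} (hg : ∀ w, wact w g = g) (f : WeightAlg k R) :
    nrm b (g * f) = g * nrm b f := by
  apply eq_of_weylDen_mul (b := b)
  rw [mul_left_comm, weylDen_mul_nrm, weylDen_mul_nrm, alt_mul_of_invariant hg]

theorem wact_nrm (w : R.weylGroup) (f : WeightAlg k R) : wact w (nrm b f) = nrm b f := by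
  have h := congrArg (wact w) (weylDen_mul_nrm (b := b) f)
  rw [map_mul, wact_weylDen, wact_alt, smul_mul_assoc, ← weylDen_mul_nrm f] at h
  have h2 := congrArg (fun g => (eps b w : k) • g) h
  simp only [smul_smul, eps_sq, one_smul] at h2
  exact eq_of_weylDen_mul h2

end Finite

end Alternants

/-! ### Demazure–Lusztig operators and the Weyl character formula -/

section Demazure

variable {ι V V' : Type*} [AddCommGroup V] [Module ℝ V] [AddCommGroup V'] [Module ℝ V']
  {R : RootPairing ι ℝ V V'} [Finite ι] [R.IsRootSystem] [R.IsCrystallographic] [R.IsReduced]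
  {b : R.Base} {k : Type*} [Field k]

/-- The Demazure–Lusztig operator `a s + (a + c) ∂`. -/
def rop (a c : k) (i : ι) : WeightAlg k R →ₗ[k] WeightAlg k R where
  toFun f := a • wact (σ R i) f + (a + c) • dem i f
  map_add' f g := by rw [map_add, dem_add]; module
  map_smul' r f := by rw [map_smul, dem_smul, RingHom.id_apply]; module

theorem rop_apply (a c : k) (i : ι) (f : WeightAlg k R) :
    rop a c i f = a • wact (σ R i) f + (a + c) • dem i f := rfl

theorem den_mul_rop (a c : k) (i : ι) (f : WeightAlg k R) :
    den k i * rop a c i f = (a + c) • f - lin k c a i * wact (σ R i) f := by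
  rw [rop_apply, mul_add, mul_smul_comm, mul_smul_comm, den_mul_dem, lin, den]
  simp only [Algebra.smul_def, map_add]
  ring

theorem rop_mul_of_invariant (a c : k) {i : ι} {g : WeightAlg k R} (hg : wact (σ R i) g = g)
    (f : WeightAlg k R) : rop a c i (g * f) = g * rop a c i f := by
  rw [rop_apply, rop_apply, dem_mul, dem_of_invariant hg, map_mul, hg, zero_mul, add_zero, mul_add,
    mul_smul_comm, mul_smul_comm]

/-- Conjugation by `qprod b c a` exchanges the two eigenvalues in the operator. It is the bridge
between the two symmetrizers. -/
theorem rop_qprod_mul (a c : k) {i : ι} (hi : i ∈ b.support) (f : WeightAlg k R) :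
    rop a c i (qprod b c a * f) = qprod b c a * rop c a i f := by
  apply den_mul_left_cancel (i := i)
  rw [mul_left_comm, den_mul_rop, den_mul_rop, map_mul, ← mul_assoc, lin_mul_wact_qprod hi,
    add_comm c a, mul_sub, mul_smul_comm]
  ring

/-- At such a point `a + c` equals `a (1 - e^{-α})`, so the divided difference contributes `a (f - s
f)` and the terms in `s f` cancel. -/
theorem ev_rop {a c : k} {i : ι} {t : Multiplicative (weightLattice R) →* kˣ}
    (ht : a * ev t (ex k (-rootWeight R i)) = -c) (f : WeightAlg k R) :
    ev t (rop a c i f) = a * ev t f := by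
  have h := congrArg (ev t) (den_mul_dem i f)
  rw [map_mul, map_sub, den, map_sub, map_one] at h
  rw [rop_apply, map_add, map_smul, map_smul, smul_eq_mul, smul_eq_mul]
  linear_combination a * h + ev t (dem i f) * ht

variable (b) in
/-- Reduced words of elements of the finite Weyl group. -/
inductive IsReducedWord : List ι → R.weylGroup → Prop
  | nil : IsReducedWord [] 1
  | cons {L : List ι} {w : R.weylGroup} {i : ι} (hi : i ∈ b.support) (h : b.IsPos (w⁻¹ • i))
      (hL : IsReducedWord L w) : IsReducedWord (i :: L) (σ R i * w)

theorem exists_isReducedWord (w : R.weylGroup) : ∃ L, IsReducedWord b L w := by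
  induction w using len_induction (b := b) with
  | one => exact ⟨[], .nil⟩
  | mul i hi u hu ih =>
    obtain ⟨L, hL⟩ := ih
    exact ⟨i :: L, .cons hi hu hL⟩

/-- The product of the Demazure–Lusztig operators along a word. -/
def ropList (a c : k) : List ι → WeightAlg k R →ₗ[k] WeightAlg k R
  | [] => LinearMap.id
  | i :: L => (rop a c i).comp (ropList a c L)

theorem ropList_cons (a c : k) (i : ι) (L : List ι) (f : WeightAlg k R) :
    ropList a c (i :: L) f = rop a c i (ropList a c L f) := rfl

variable (b) in
/-- The Demazure–Lusztig operator of an element of the finite Weyl group. -/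
def phi (a c : k) (w : R.weylGroup) : WeightAlg k R →ₗ[k] WeightAlg k R :=
  ropList a c (exists_isReducedWord (b := b) w).choose

/-- The operator is built from one chosen reduced word, so an induction has to carry the word along
with the group element. Independence of the word is never needed. -/
theorem phi_induction {p : (w : R.weylGroup) → (L : List ι) → Prop} (one : p 1 [])
    (mul : ∀ i ∈ b.support, ∀ w L, b.IsPos (w⁻¹ • i) → p w L → p (σ R i * w) (i :: L))
    (w : R.weylGroup) : p w (exists_isReducedWord (b := b) w).choose := by
  have h := (exists_isReducedWord (b := b) w).choose_spec
  generalize (exists_isReducedWord (b := b) w).choose = L at h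
  induction h with
  | nil => exact one
  | cons hi h hL ih => exact mul _ hi _ _ h ih

theorem phi_mul_of_invariant (a c : k) {g : WeightAlg k R} (hg : ∀ w, wact w g = g)
    (f : WeightAlg k R) (w : R.weylGroup) : phi b a c w (g * f) = g * phi b a c w f := by
  unfold phi
  refine phi_induction (b := b) (p := fun w L => ropList a c L (g * f) = g * ropList a c L f)
    rfl ?_ w
  intro i hi w L _ ih
  rw [ropList_cons, ropList_cons, ih, rop_mul_of_invariant _ _ (hg _)]

theorem phi_qprod_mul (a c : k) (f : WeightAlg k R) (w : R.weylGroup) :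
    phi b a c w (qprod b c a * f) = qprod b c a * phi b c a w f := by
  unfold phi
  refine phi_induction (b := b)
    (p := fun w L => ropList a c L (qprod b c a * f) = qprod b c a * ropList c a L f) rfl ?_ w
  intro i hi w L _ ih
  rw [ropList_cons, ropList_cons, ih, rop_qprod_mul _ _ hi]

theorem ev_phi {a c : k} {t : Multiplicative (weightLattice R) →* kˣ}
    (ht : ∀ i ∈ b.support, a * ev t (ex k (-rootWeight R i)) = -c) (f : WeightAlg k R)
    (w : R.weylGroup) : ev t (phi b a c w f) = a ^ len b (fin w) * ev t f := by
  unfold phi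
  refine phi_induction (b := b)
    (p := fun w L => ev t (ropList a c L f) = a ^ len b (fin w) * ev t f) ?_ ?_ w
  · rw [fin_one, len_one, pow_zero, one_mul]; rfl
  intro i hi w L hw ih
  rw [ropList_cons, ev_rop (ht i hi), ih, len_refl_mul hi hw, pow_succ']
  ring

/-- The sum `∑ e^{l(w)} φ_w` of Demazure–Lusztig operators. -/
def psiSum (b : R.Base) (a c e : k) (f : WeightAlg k R) : WeightAlg k R :=
  ∑ w : R.weylGroup, e ^ len b (fin w) • phi b a c w f

theorem den_dvd_weylDen_sq (b : R.Base) (i : ι) : den k i ∣ weylDen k b ^ 2 := by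
  classical
  have hpos : ∀ j : ι, b.IsPos j → den k j ∣ weylDen k b := by
    intro j hj
    rw [weylDen_eq]
    exact Dvd.dvd.mul_left (Finset.dvd_prod_of_mem _ ((mem_posRoots b).2 hj)) _
  rw [pow_two]
  by_cases hi : b.IsPos i
  · exact Dvd.dvd.mul_left (hpos i hi) _
  · have h1 := hpos (opp R i) ((isPos_opp b i).2 hi)
    have h2 : den k i = -ex k (rootWeight R (opp R i)) * den k (opp R i) := by
      rw [← den_opp, opp_opp]
    have h3 : den k (opp R i) = -ex k (-rootWeight R (opp R i)) * den k i := by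
      rw [h2]
      linear_combination -den k (opp R i) * ex_neg_mul (k := k) (rootWeight R (opp R i))
    exact Dvd.dvd.mul_left ((Dvd.intro_left _ h3.symm).trans h1) _

variable (b k) in
/-- The quotient of the squared Weyl denominator by `1 - e^{-α}`. -/
def cofDen (i : ι) : WeightAlg k R := (den_dvd_weylDen_sq (k := k) b i).choose

theorem den_mul_cofDen (i : ι) : den k i * cofDen b k i = weylDen k b ^ 2 :=
  (den_dvd_weylDen_sq b i).choose_spec.symm

theorem wact_weylDen_sq (w : R.weylGroup) :
    wact w (weylDen k b ^ 2) = weylDen k b ^ 2 := by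
  rw [map_pow, wact_weylDen, smul_pow, pow_two, eps_sq, one_smul]

theorem wact_cofDen (w : R.weylGroup) (i : ι) :
    wact w (cofDen b k i) = cofDen b k (w • i) := by
  apply den_mul_left_cancel (i := w • i)
  rw [den_mul_cofDen, ← wact_den, ← map_mul, den_mul_cofDen, wact_weylDen_sq]

variable (b) in
/-- The leading coefficient of a Demazure–Lusztig operator, with cleared denominators. -/
def leadCoeff (a c : k) (i : ι) : WeightAlg k R := -(lin k c a i * cofDen b k i)

theorem wact_leadCoeff (a c : k) (w : R.weylGroup) (i : ι) :
    wact w (leadCoeff b a c i) = leadCoeff b a c (w • i) := by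
  rw [leadCoeff, map_neg, map_mul, wact_lin, wact_cofDen, leadCoeff]

theorem weylDen_sq_mul_rop (a c : k) (i : ι) (f : WeightAlg k R) :
    weylDen k b ^ 2 * rop a c i f =
      (a + c) • cofDen b k i * f + leadCoeff b a c i * wact (σ R i) f := by
  rw [← den_mul_cofDen i, mul_right_comm, den_mul_rop, leadCoeff, sub_mul, smul_mul_assoc,
    smul_mul_assoc, mul_comm f]
  ring

theorem prod_inversions_refl {i : ι} (hi : i ∈ b.support) {w : R.weylGroup}
    (hw : b.IsPos (w⁻¹ • i)) {M : Type*} [CommMonoid M] (F : ι → M) [DecidablePred b.IsPos] :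
    ∏ j ∈ posRoots b with ¬ b.IsPos ((σ R i * w)⁻¹ • j), F j =
      F i * ∏ j ∈ posRoots b with ¬ b.IsPos (w⁻¹ • j), F (σ R i • j) := by
  classical
  have hip := isPos_simple b hi
  have hmem : i ∈ (posRoots b).filter fun j => ¬ b.IsPos ((σ R i * w)⁻¹ • j) := by
    rw [Finset.mem_filter, mem_posRoots]
    exact ⟨hip, fun h => (isPos_refl_mul_inv_smul i w).1 h hw⟩
  have hsm : ∀ j : ι, (σ R i * w)⁻¹ • j = w⁻¹ • σ R i • j := fun j => by
    rw [mul_inv_rev, refl_inv, mul_smul]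
  have hss : ∀ j : ι, σ R i • σ R i • j = j := fun j => by
    rw [← mul_smul, refl_mul_self, one_smul]
  rw [← Finset.mul_prod_erase _ _ hmem]
  congr 1
  refine Finset.prod_bij' (fun j _ => σ R i • j) (fun j _ => σ R i • j) ?_ ?_ ?_ ?_ ?_
  · intro j hj
    rw [Finset.mem_erase, Finset.mem_filter, mem_posRoots, hsm] at hj
    rw [Finset.mem_filter, mem_posRoots]
    exact ⟨isPos_refl b hi hj.1 hj.2.1, hj.2.2⟩
  · intro j hj
    rw [Finset.mem_filter, mem_posRoots] at hj
    rw [Finset.mem_erase, Finset.mem_filter, mem_posRoots, hsm, hss]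
    have hji : j ≠ i := by
      rintro rfl; exact hj.2 hw
    refine ⟨fun h => ?_, isPos_refl b hi hji hj.1, hj.2⟩
    have h2 := congrArg (fun l => σ R i • l) h
    simp only [hss] at h2
    rw [refl_smul_self] at h2
    rw [h2, isPos_opp] at hj
    exact hj.1 hip
  · intro j _; exact hss j
  · intro j _; exact hss j
  · intro j _; rw [hss]

theorem len_le_len_refl_mul {i : ι} (hi : i ∈ b.support) (u : R.weylGroup) :
    len b (fin u) ≤ len b (fin (σ R i * u)) + 1 := by
  by_cases h : b.IsPos (u⁻¹ • i)
  · rw [len_refl_mul hi h]; omega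
  · exact (len_refl_mul_neg hi h).ge

open Classical in
/-- A Demazure–Lusztig operator is a combination of Weyl group translates. -/
theorem exists_phi_expansion (a c : k) (w : R.weylGroup) :
    ∃ K : R.weylGroup → WeightAlg k R,
      (∀ f, (weylDen k b ^ 2) ^ len b (fin w) * phi b a c w f = ∑ u, K u * wact u f) ∧
      (∀ u, len b (fin w) < len b (fin u) → K u = 0) ∧
      K w = ∏ j ∈ posRoots b with ¬ b.IsPos (w⁻¹ • j), leadCoeff b a c j := by
  unfold phi
  refine phi_induction (b := b) (p := fun w L => ∃ K : R.weylGroup → WeightAlg k R,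
      (∀ f, (weylDen k b ^ 2) ^ len b (fin w) * ropList a c L f = ∑ u, K u * wact u f) ∧
      (∀ u, len b (fin w) < len b (fin u) → K u = 0) ∧
      K w = ∏ j ∈ posRoots b with ¬ b.IsPos (w⁻¹ • j), leadCoeff b a c j) ?_ ?_ w
  · refine ⟨fun u => if u = 1 then 1 else 0, fun f => ?_, fun u hu => ?_, ?_⟩
    · rw [Finset.sum_eq_single 1]
      · simp [ropList]
      · intro u _ hu; simp only [if_neg hu, zero_mul]
      · intro h; exact absurd (Finset.mem_univ _) h
    · refine if_neg ?_
      rintro rfl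
      exact lt_irrefl _ hu
    · rw [Finset.filter_false_of_mem, Finset.prod_empty]
      · exact if_pos rfl
      intro j hj
      rw [inv_one, one_smul, not_not]
      exact (mem_posRoots b).1 hj
  · rintro i hi w L hw ⟨K, hK1, hK2, hK3⟩
    have hl := len_refl_mul hi hw
    -- The two terms come from `D² · rop = (a + c) · cofDen + leadCoeff · s` with `D` the Weyl
    -- denominator. At the new element only the second term contributes, as the old coefficients
    -- vanish beyond length `l(w)`.
    refine ⟨fun u => (a + c) • cofDen b k i * K u +
      leadCoeff b a c i * wact (σ R i) (K (σ R i * u)), fun f => ?_, fun u hu => ?_, ?_⟩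
    · rw [hl, pow_succ', ropList_cons, mul_right_comm, weylDen_sq_mul_rop, add_mul,
        mul_assoc _ (ropList a c L f), mul_comm (ropList a c L f), hK1, mul_assoc (leadCoeff b a c i)]
      have h1 : wact (σ R i) (ropList a c L f) * (weylDen k b ^ 2) ^ len b (fin w) =
          wact (σ R i) ((weylDen k b ^ 2) ^ len b (fin w) * ropList a c L f) := by
        rw [map_mul, map_pow, wact_weylDen_sq, mul_comm]
      rw [h1, hK1, map_sum, ← Equiv.sum_comp (Equiv.mulLeft (σ R i)) fun u =>
        wact (σ R i) (K u * wact u f), Finset.mul_sum, Finset.mul_sum, ← Finset.sum_add_distrib]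
      refine Finset.sum_congr rfl fun u _ => ?_
      rw [Equiv.coe_mulLeft, map_mul, ← wact_mul, ← mul_assoc (σ R i), refl_mul_self, one_mul]
      ring
    · have h1 := len_le_len_refl_mul hi u
      simp only [hK2 u (by omega), hK2 (σ R i * u) (by omega), map_zero, mul_zero, add_zero]
    · simp only [hK2 (σ R i * w) (by omega), mul_zero, zero_add, ← mul_assoc (σ R i),
        refl_mul_self, one_mul]
      rw [hK3, map_prod, prod_inversions_refl hi hw]
      simp only [wact_leadCoeff]

/-- Dedekind's independence of characters applies in the domain `k[P]`: the translates are
multiplicative, and they are distinct because the Weyl group acts faithfully on the roots. -/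
theorem wact_linearIndependent : LinearIndependent (WeightAlg k R)
    fun w : R.weylGroup => (wact w : WeightAlg k R → WeightAlg k R) := by
  have h := (linearIndependent_monoidHom (WeightAlg k R) (WeightAlg k R)).comp
    (fun w : R.weylGroup => ((wact w : WeightAlg k R →ₐ[k] WeightAlg k R) :
      WeightAlg k R →* WeightAlg k R)) ?_
  · exact h
  · intro u w h
    refine weyl_ext fun i => ?_
    have h1 := DFunLike.congr_fun h (ex k (rootWeight R i))
    change wact u (ex k (rootWeight R i)) = wact w (ex k (rootWeight R i)) at h1
    rw [wact_ex, wact_ex, smul_rootWeight, smul_rootWeight] at h1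
    have h2 := congrArg Subtype.val (ex_injective h1)
    exact R.root.injective h2

theorem eps_eq_pow (w : R.weylGroup) : eps b w = (-1) ^ len b (fin w) := by
  induction w using len_induction (b := b) with
  | one => simp
  | mul i hi u hu ih => rw [eps_refl_mul_simple hi, ih, len_refl_mul hi hu, pow_succ]; ring

theorem prod_posRoots_longest {M : Type*} [CommMonoid M] (F : ι → M) :
    ∏ j ∈ posRoots b, F (longest b • j) = ∏ j ∈ posRoots b, F (opp R j) := by
  refine Finset.prod_bij' (fun j _ => opp R (longest b • j))
    (fun j _ => (longest b)⁻¹ • opp R j) ?_ ?_ ?_ ?_ ?_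
  · intro j hj
    rw [mem_posRoots] at hj ⊢
    rw [isPos_opp, longest_smul, not_not]
    exact hj
  · intro j hj
    rw [mem_posRoots] at hj ⊢
    rw [smul_opp, isPos_opp]
    exact longest_inv_smul hj
  · intro j _
    rw [opp_opp, inv_smul_smul]
  · intro j _
    rw [smul_inv_smul, opp_opp]
  · intro j _
    rw [opp_opp]

theorem wact_longest_qprod (a c : k) : wact (longest b) (qprod b a c) = qprod b c a := by
  classical
  -- A simple reflection lowers the sum of the positive roots by `2 αᵢ`, so this sum pairs to `2`
  -- with every simple coroot.
  have h2rho : ∑ j ∈ posRoots b, rootWeight R j = rho b + rho b := by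
    refine weight_ext b fun i hi => ?_
    have h1 : σ R i • ∑ j ∈ posRoots b, rootWeight R j =
        ∑ j ∈ posRoots b, rootWeight R j - (2 : ℤ) • rootWeight R i := by
      have h2 := prod_posRoots_refl hi (M := Multiplicative (weightLattice R))
        (fun j => Multiplicative.ofAdd (rootWeight R j))
      have h3 := congrArg Multiplicative.toAdd h2
      simp only [toAdd_mul, toAdd_prod, toAdd_ofAdd, rootWeight_opp] at h3
      rw [Finset.smul_sum]
      simp only [smul_rootWeight]
      rw [eq_sub_iff_add_eq, two_zsmul, ← add_assoc, h3, neg_add_cancel_right]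
    rw [refl_smul, sub_right_inj] at h1
    have h4 := congrArg (fun x => pair x i) h1
    simp only [pair_zsmul, pair_rootWeight_self] at h4
    rw [pair_add, pair_rho hi]
    omega
  have hrho : longest b • rho b = -rho b := by
    have h1 : longest b • (rho b + rho b) = -(rho b + rho b) := by
      rw [← h2rho, Finset.smul_sum]
      simp only [smul_rootWeight]
      have h2 := congrArg Multiplicative.toAdd (prod_posRoots_longest (b := b) (M := Multiplicative (weightLattice R))
        (fun j => Multiplicative.ofAdd (rootWeight R j)))
      simp only [toAdd_prod, toAdd_ofAdd, rootWeight_opp, Finset.sum_neg_distrib] at h2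
      exact h2
    refine weight_ext b fun i hi => ?_
    have h2 := congrArg (fun x => pair x i) h1
    simp only [smul_add, pair_add, pair_neg] at h2
    rw [pair_neg]
    omega
  rw [qprod, map_mul, map_prod, wact_ex, hrho]
  simp only [wact_lin]
  rw [prod_posRoots_longest (b := b) fun j => (lin k a c j : WeightAlg k R)]
  simp only [lin_opp]
  rw [Finset.prod_mul_distrib, ← ex_sum, h2rho, ← mul_assoc, ← ex_add, neg_add_cancel_left, qprod]

theorem weylDen_mul_prod_leadCoeff (a c : k) :
    weylDen k b * ∏ j ∈ posRoots b, leadCoeff b a c j =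
      (-1) ^ len b (fin (longest b)) * (weylDen k b ^ 2) ^ len b (fin (longest b)) *
        qprod b c a := by
  rw [len_longest]
  conv_lhs => enter [1]; rw [weylDen_eq]
  rw [mul_assoc, ← Finset.prod_mul_distrib, qprod]
  have : ∀ j ∈ posRoots b, den k j * leadCoeff b a c j =
      -1 * weylDen k b ^ 2 * lin k c a j := fun j _ => by
    rw [leadCoeff, ← den_mul_cofDen j]; ring
  rw [Finset.prod_congr rfl this, Finset.prod_mul_distrib, Finset.prod_const, mul_pow]
  ring

open Classical in
/-- The symmetrizer of Demazure–Lusztig operators in terms of the Weyl character formula. -/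
theorem psiSum_eq_nrm (a c e : k)
    (hinv : ∀ (w : R.weylGroup) (f : WeightAlg k R),
      wact w (psiSum b a c e f) = psiSum b a c e f) (f : WeightAlg k R) :
    psiSum b a c e f = e ^ len b (fin (longest b)) • nrm b (qprod b a c * f) := by
  choose K hK1 hK2 hK3 using exists_phi_expansion (b := b) a c
  set l := len b (fin (longest b)) with hl
  set D2 := weylDen k b ^ 2 with hD2
  -- The coefficient of the translate by `u` in the whole sum, with all terms brought to the common
  -- denominator `D2 ^ l`.
  set S : R.weylGroup → WeightAlg k R := fun u =>
    ∑ w, e ^ len b (fin w) • (D2 ^ (l - len b (fin w)) * K w u) with hS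
  have hS1 : ∀ f, D2 ^ l * psiSum b a c e f = ∑ u, S u * wact u f := by
    intro f
    simp only [hS, psiSum, Finset.mul_sum, Finset.sum_mul]
    rw [Finset.sum_comm]
    refine Finset.sum_congr rfl fun w _ => ?_
    have hlw : len b (fin w) ≤ l := len_le_longest b w
    obtain ⟨n, hn⟩ := Nat.exists_eq_add_of_le hlw
    have h2 := hK1 w f
    simp only [smul_mul_assoc, mul_assoc]
    rw [← Finset.smul_sum, ← Finset.mul_sum, ← h2, mul_smul_comm, hn, Nat.add_sub_cancel_left,
      ← mul_assoc, ← pow_add, add_comm n]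
  have hS2 : S (longest b) = e ^ l • ∏ j ∈ posRoots b, leadCoeff b a c j := by
    simp only [hS]
    rw [Finset.sum_eq_single (longest b)]
    · rw [← hl, Nat.sub_self, pow_zero, one_mul, hK3, Finset.filter_true_of_mem]
      intro j hj
      exact longest_inv_smul ((mem_posRoots b).1 hj)
    · intro w _ hw
      rw [hK2 w _ (len_lt_longest hw), mul_zero, smul_zero]
    · intro h; exact absurd (Finset.mem_univ _) h
  -- Invariance of the sum and linear independence of the translates make the coefficients
  -- equivariant. They are all determined by the one at the longest element, to which only the
  -- operator of `w₀` contributes.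
  have hS3 : ∀ u w, S u = wact w (S (w⁻¹ * u)) := by
    intro u w
    have h1 : ∀ f, ∑ u, (S u - wact w (S (w⁻¹ * u))) * wact u f = 0 := by
      intro f
      have h2 := congrArg (wact w) (hS1 f)
      rw [map_mul, map_pow, wact_weylDen_sq, hinv, hS1, map_sum,
        ← Equiv.sum_comp (Equiv.mulLeft w⁻¹) fun u => wact w (S u * wact u f)] at h2
      simp only [sub_mul, Finset.sum_sub_distrib]
      rw [h2, sub_eq_zero]
      refine Finset.sum_congr rfl fun u _ => ?_
      rw [Equiv.coe_mulLeft, map_mul, ← wact_mul, mul_inv_cancel_left]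
    have h3 := Fintype.linearIndependent_iff.1 (wact_linearIndependent (R := R) (k := k))
      (fun u => S u - wact w (S (w⁻¹ * u))) (by
        funext f
        rw [Finset.sum_apply]
        exact h1 f) u
    exact sub_eq_zero.1 h3
  have hD : weylDen k b * S (longest b) =
      (e ^ l * (-1) ^ l) • (D2 ^ l * qprod b c a) := by
    rw [hS2, mul_smul_comm, weylDen_mul_prod_leadCoeff, mul_smul, ← hl, ← hD2, mul_assoc,
      Algebra.smul_def ((-1) ^ l), map_pow, map_neg, map_one]
  have hD2inv : ∀ w : R.weylGroup, wact w (D2 ^ l) = D2 ^ l := fun w => by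
    rw [map_pow, wact_weylDen_sq]
  have hterm : ∀ u : R.weylGroup, weylDen k b * S u =
      D2 ^ l * (e ^ l • (eps b u : k) • wact u (qprod b a c)) := by
    intro u
    have h1 := congrArg (wact (u * (longest b)⁻¹)) hD
    have h3 := hS3 u (u * (longest b)⁻¹)
    rw [mul_inv_rev, inv_inv, inv_mul_cancel_right] at h3
    rw [map_mul, wact_weylDen, ← h3, map_smul, map_mul, hD2inv, wact_mul,
      longest_inv, wact_longest_qprod, smul_mul_assoc] at h1
    have h2 := congrArg (fun g => (eps b (u * (longest b)⁻¹) : k) • g) h1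
    simp only [longest_inv] at h2
    rw [smul_smul, eps_sq, one_smul] at h2
    rw [h2, eps_mul, eps_eq_pow (b := b) (longest b), ← hl, Int.cast_mul, Int.cast_pow, Int.cast_neg,
      Int.cast_one, mul_smul_comm, mul_smul_comm, smul_smul, smul_smul]
    congr 1
    have h4 : ((-1 : k) ^ l) * (-1) ^ l = 1 := by rw [← mul_pow]; simp
    linear_combination eps b u * e ^ l * h4
  apply eq_of_weylDen_mul (b := b)
  refine mul_left_cancel₀ (pow_ne_zero l (pow_ne_zero 2 (weylDen_ne_zero (k := k) (b := b)))) ?_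
  rw [← hD2, mul_left_comm, hS1, mul_smul_comm, weylDen_mul_nrm, alt, Finset.mul_sum,
    Finset.smul_sum, Finset.mul_sum]
  refine Finset.sum_congr rfl fun u _ => ?_
  rw [← mul_assoc, hterm, map_mul]
  simp only [mul_smul_comm, smul_mul_assoc, mul_assoc]

end Demazure

/-! ### Products with symmetrizers and the center -/

section Symmetrizers

variable {ι V V' : Type*} [AddCommGroup V] [Module ℝ V] [AddCommGroup V'] [Module ℝ V']
  {R : RootPairing ι ℝ V V'} [Finite ι] [R.IsRootSystem] [R.IsCrystallographic] [R.IsReduced]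
  [R.IsIrreducible] {b : R.Base} {k : Type*} [Field k] {q v a c : k}

/-- The numbers `a` and `c` are the eigenvalues `q` and `-1` of the generators, in some order. -/
structure IsEigenPair (q a c : k) : Prop where
  add : a + c = q - 1
  mul : a * c = -q

theorem isEigenPair_self : IsEigenPair q q (-1) := ⟨by ring, by ring⟩

namespace IsEigenPair

theorem swap (h : IsEigenPair q a c) : IsEigenPair q c a :=
  ⟨by rw [add_comm, h.add], by rw [mul_comm, h.mul]⟩

theorem ne_zero (h : IsEigenPair q a c) (hq : q ≠ 0) : a ≠ 0 := by
  rintro rfl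
  have := h.mul
  rw [zero_mul, eq_comm, neg_eq_zero] at this
  exact hq this

theorem neg_inv_mul (h : IsEigenPair q a c) (hq : q ≠ 0) : -c⁻¹ * c = -1 := by
  rw [neg_mul, inv_mul_cancel₀ (h.swap.ne_zero hq)]

end IsEigenPair

theorem dem_refl (i : ι) (f : WeightAlg k R) : dem i (wact (σ R i) f) = -dem i f := by
  apply den_mul_left_cancel (i := i)
  rw [mul_neg, den_mul_dem, den_mul_dem, wact_refl_refl]
  ring

section
variable (hq : q ≠ 0) (hv : v ^ 2 = q) (h : IsEigenPair q a c)
include h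

/-- Bernstein's relation moves `T_s` past `Θ(f)`, where the symmetrizer absorbs it as `a`; with `q -
1 = a + c` the outcome is the Demazure–Lusztig operator. The mirror statement below applies the
relation to `s f` instead. -/
theorem T_mul_Theta_mul_symm {i : ι} (hi : i ∈ b.support) (f : WeightAlg k R) :
    T b k q (fin (σ R i)) * (Theta hq hv b f * symm b q (-c⁻¹)) =
      Theta hq hv b (rop a c i f) * symm b q (-c⁻¹) := by
  rw [← mul_assoc, T_mul_Theta hq hv hi, add_mul, mul_assoc,
    T_refl_mul_symm h.add h.mul (h.neg_inv_mul hq) hi, rop_apply, map_add, map_smul, map_smul,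
    add_mul, mul_smul_comm, smul_mul_assoc, h.add]
  rw [smul_mul_assoc, smul_mul_assoc]

theorem symm_mul_Theta_mul_T {i : ι} (hi : i ∈ b.support) (f : WeightAlg k R) :
    symm b q (-c⁻¹) * Theta hq hv b f * T b k q (fin (σ R i)) =
      symm b q (-c⁻¹) * Theta hq hv b (rop a c i f) := by
  have h1 := T_mul_Theta hq hv hi (wact (σ R i) f)
  rw [wact_refl_refl, dem_refl, map_neg, smul_neg, ← sub_eq_add_neg, eq_sub_iff_add_eq] at h1
  rw [mul_assoc, ← h1, mul_add, ← mul_assoc, symm_mul_T_refl h.add h.mul (h.neg_inv_mul hq) hi,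
    rop_apply, map_add, map_smul, map_smul, mul_add, mul_smul_comm, smul_mul_assoc, h.add,
    mul_smul_comm, mul_smul_comm]

theorem T_fin_mul_Theta_mul_symm (w : R.weylGroup) (f : WeightAlg k R) :
    T b k q (fin w) * (Theta hq hv b f * symm b q (-c⁻¹)) =
      Theta hq hv b (phi b a c w f) * symm b q (-c⁻¹) := by
  unfold phi
  refine phi_induction (b := b) (p := fun w L =>
    T b k q (fin w) * (Theta hq hv b f * symm b q (-c⁻¹)) =
      Theta hq hv b (ropList a c L f) * symm b q (-c⁻¹)) ?_ ?_ w
  · rw [fin_one, T_one, one_mul]; rfl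
  · intro i hi w L hw ih
    rw [← T_refl_mul q hi hw, mul_assoc, ih, T_mul_Theta_mul_symm hq hv h hi, ropList_cons]

theorem symm_mul_Theta_mul_T_fin (w : R.weylGroup) (f : WeightAlg k R) :
    symm b q (-c⁻¹) * Theta hq hv b f * T b k q (fin w⁻¹) =
      symm b q (-c⁻¹) * Theta hq hv b (phi b a c w f) := by
  unfold phi
  refine phi_induction (b := b) (p := fun w L =>
    symm b q (-c⁻¹) * Theta hq hv b f * T b k q (fin w⁻¹) =
      symm b q (-c⁻¹) * Theta hq hv b (ropList a c L f)) ?_ ?_ w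
  · rw [inv_one, fin_one, T_one, mul_one]; rfl
  · intro i hi w L hw ih
    rw [mul_inv_rev, refl_inv, ← T_mul_refl q hi hw, ← mul_assoc, ih,
      symm_mul_Theta_mul_T hq hv h hi, ropList_cons]

theorem symm_mul_Theta_mul_symm (e : k) (f : WeightAlg k R) :
    symm b q (-c⁻¹) * Theta hq hv b f * symm b q e =
      symm b q (-c⁻¹) * Theta hq hv b (psiSum b a c e f) := by
  conv_lhs => enter [2]; rw [symm, ← Equiv.sum_comp (Equiv.inv R.weylGroup)]
  rw [Finset.mul_sum, psiSum, map_sum, Finset.mul_sum]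
  refine Finset.sum_congr rfl fun w _ => ?_
  rw [Equiv.inv_apply, mul_smul_comm, symm_mul_Theta_mul_T_fin hq hv h, len_fin_inv, map_smul,
    mul_smul_comm]

theorem symm_mul_Theta_mul_symm_left (e : k) (f : WeightAlg k R) :
    symm b q e * Theta hq hv b f * symm b q (-c⁻¹) =
      Theta hq hv b (psiSum b a c e f) * symm b q (-c⁻¹) := by
  rw [symm, Finset.sum_mul, Finset.sum_mul, psiSum, map_sum, Finset.sum_mul]
  refine Finset.sum_congr rfl fun w _ => ?_
  rw [smul_mul_assoc, smul_mul_assoc, mul_assoc, T_fin_mul_Theta_mul_symm hq hv h, map_smul,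
    smul_mul_assoc]

include hq in
theorem lin_eq_zero_of_mul (i : ι) {f : WeightAlg k R} (hf : lin k c a i * f = 0) : f = 0 :=
  (mul_eq_zero.1 hf).resolve_left (lin_ne_zero (h.ne_zero hq) i)

omit h in
theorem symm_mul_Theta_cancel (e : k) {f g : WeightAlg k R}
    (hfg : symm b q e * Theta hq hv b f = symm b q e * Theta hq hv b g) : f = g := by
  rw [← sub_eq_zero, ← mul_sub, ← map_sub] at hfg
  exact sub_eq_zero.1 (symm_mul_Theta_injective hq hv e hfg)

omit h in
theorem wact_eq_of_simple {f : WeightAlg k R} (hf : ∀ i ∈ b.support, wact (σ R i) f = f)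
    (w : R.weylGroup) : wact w f = f := by
  induction w using weyl_induction b with
  | one => rw [wact_one]
  | mul i hi w ih => rw [wact_mul, ih, hf i hi]

include hq hv in
-- The product `X Θ(f) X` is an eigenvector of right multiplication by `T_s`, so injectivity gives
-- `rop a c i g = a g`. After clearing `1 - e^{-α}` this reads `(c + a e^{-α}) (s g - g) = 0`.
theorem wact_psiSum (w : R.weylGroup) (f : WeightAlg k R) :
    wact w (psiSum b a c (-c⁻¹) f) = psiSum b a c (-c⁻¹) f := by
  refine wact_eq_of_simple (b := b) (fun i hi => ?_) w
  set g := psiSum b a c (-c⁻¹) f with hg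
  have h1 : rop a c i g = a • g := by
    apply symm_mul_Theta_cancel (b := b) hq hv (-c⁻¹)
    rw [← symm_mul_Theta_mul_T hq hv h hi, hg, ← symm_mul_Theta_mul_symm hq hv h, mul_assoc,
      symm_mul_T_refl h.add h.mul (h.neg_inv_mul hq) hi, map_smul, mul_smul_comm, mul_smul_comm,
      symm_mul_Theta_mul_symm hq hv h]
  have h2 := den_mul_rop a c i g
  rw [h1] at h2
  have h3 : lin k c a i * (wact (σ R i) g - g) = 0 := by
    rw [lin, den] at *
    simp only [Algebra.smul_def, map_add] at h2 ⊢
    linear_combination h2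
  exact sub_eq_zero.1 (lin_eq_zero_of_mul hq h i h3)

include hq hv in
theorem psiSum_self (f : WeightAlg k R) : psiSum b a c (-c⁻¹) f =
    (-c⁻¹) ^ len b (fin (longest b)) • nrm b (qprod b a c * f) :=
  psiSum_eq_nrm a c _ (fun w f => wact_psiSum hq hv h w f) f

omit h in
theorem psiSum_mul_of_invariant (e : k) {g : WeightAlg k R} (hg : ∀ w, wact w g = g)
    (f : WeightAlg k R) : psiSum b a c e (g * f) = g * psiSum b a c e f := by
  simp only [psiSum, Finset.mul_sum, phi_mul_of_invariant a c hg, mul_smul_comm]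

include hq hv in
-- On multiples of `Q = qprod b c a` the conjugation formula reduces the sum to the other
-- symmetrizer, where `psiSum_self` applies. The product `M` of all translates of `Q` is an
-- invariant multiple of `Q`; since everything is linear over invariants, `f` may be replaced by `M
-- f` and `M` cancelled.
theorem psiSum_other (f : WeightAlg k R) : psiSum b a c (-a⁻¹) f =
    (-a⁻¹) ^ len b (fin (longest b)) • (qprod b c a * nrm b f) := by
  classical
  have h1 : ∀ g : WeightAlg k R, psiSum b a c (-a⁻¹) (qprod b c a * g) =
      (-a⁻¹) ^ len b (fin (longest b)) • (qprod b c a * nrm b (qprod b c a * g)) := by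
    intro g
    rw [← mul_smul_comm, ← psiSum_self hq hv h.swap, psiSum, psiSum, Finset.mul_sum]
    exact Finset.sum_congr rfl fun w _ => by rw [phi_qprod_mul, mul_smul_comm]
  set M : WeightAlg k R := ∏ w : R.weylGroup, wact w (qprod b c a) with hM
  have hMinv : ∀ w, wact w M = M := by
    intro w
    rw [hM, map_prod, ← Equiv.prod_comp (Equiv.mulLeft w) fun u => wact u (qprod b c a)]
    exact Finset.prod_congr rfl fun u _ => by rw [Equiv.coe_mulLeft, wact_mul]
  have hM0 : M ≠ 0 := by
    rw [hM, Finset.prod_ne_zero_iff]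
    intro w _ h0
    exact qprod_ne_zero (h.ne_zero hq) (wact_injective w (by rw [h0, map_zero]))
  obtain ⟨M', hM'⟩ : qprod b c a ∣ M := by
    have := Finset.dvd_prod_of_mem (fun w : R.weylGroup => wact w (qprod b c a : WeightAlg k R))
      (Finset.mem_univ 1)
    rwa [wact_one] at this
  apply mul_left_cancel₀ hM0
  rw [← psiSum_mul_of_invariant _ hMinv, hM', mul_assoc, h1, ← mul_assoc (qprod b c a) M' f, ← hM',
    nrm_mul_of_invariant hMinv, mul_smul_comm, mul_left_comm]

theorem sandwich_right (f : WeightAlg k R) :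
    symm b q (-c⁻¹) * Theta hq hv b f * symm b q (-a⁻¹) =
      (-a⁻¹) ^ len b (fin (longest b)) •
        (symm b q (-c⁻¹) * Theta hq hv b (qprod b c a * nrm b f)) := by
  rw [symm_mul_Theta_mul_symm hq hv h, psiSum_other hq hv h, map_smul, mul_smul_comm]

theorem sandwich_left (f : WeightAlg k R) :
    symm b q (-c⁻¹) * Theta hq hv b f * symm b q (-a⁻¹) =
      (-c⁻¹) ^ len b (fin (longest b)) •
        (Theta hq hv b (qprod b a c * nrm b f) * symm b q (-a⁻¹)) := by
  rw [symm_mul_Theta_mul_symm_left hq hv h.swap, psiSum_other hq hv h.swap, map_smul,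
    smul_mul_assoc]

include hq hv in
/-- The Weyl character formula for the values of the symmetrizer at a special point. -/
theorem ev_nrm_qprod {t : Multiplicative (weightLattice R) →* kˣ}
    (ht : ∀ i ∈ b.support, a * ev t (ex k (-rootWeight R i)) = -c) (f : WeightAlg k R) :
    (-c⁻¹) ^ len b (fin (longest b)) * ev t (nrm b (qprod b a c * f)) =
      (∑ w : R.weylGroup, (-c⁻¹ * a) ^ len b (fin w)) * ev t f := by
  have h1 := congrArg (ev t) (psiSum_self (b := b) hq hv h f)
  rw [map_smul, smul_eq_mul] at h1
  rw [← h1, psiSum, map_sum, Finset.sum_mul]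
  refine Finset.sum_congr rfl fun w _ => ?_
  rw [map_smul, ev_phi ht, smul_eq_mul, mul_pow, mul_assoc]

omit h in
theorem Theta_mem_center {f : WeightAlg k R} (hf : ∀ w, wact w f = f) :
    Theta hq hv b f ∈ Subalgebra.center k (Hecke b k q) := by
  rw [Subalgebra.mem_center_iff]
  intro x
  have h1 : x ∈ Subalgebra.centralizer k {Theta hq hv b f} := by
    refine mem_of_generators hq hv ?_ ?_ x
    · intro i hi
      rw [Subalgebra.mem_centralizer_iff]
      rintro _ rfl
      rw [T_mul_Theta hq hv hi, hf, dem_of_invariant (hf _), map_zero, smul_zero, add_zero]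
    · intro g
      rw [Subalgebra.mem_centralizer_iff]
      rintro _ rfl
      rw [← map_mul, ← map_mul, mul_comm]
  exact ((Subalgebra.mem_centralizer_iff k).1 h1 _ rfl).symm

omit h in
-- Commutation with `T_s`, read through the injective map `f ↦ X Θ(f)`, reduces to `(1 - q e^{-α})
-- ∂f = 0`, so the divided difference vanishes. Hence only invariants enter the central ideal.
theorem wact_eq_of_mem_center {f : WeightAlg k R}
    (hf : Theta hq hv b f ∈ Subalgebra.center k (Hecke b k q)) (w : R.weylGroup) :
    wact w f = f := by
  have h : IsEigenPair q q (-1) := isEigenPair_self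
  refine wact_eq_of_simple (b := b) (fun i hi => ?_) w
  have h1 := (Subalgebra.mem_center_iff.1 hf) (T b k q (fin (σ R i)))
  rw [T_mul_Theta hq hv hi] at h1
  have h2 := congrArg (fun x => symm b q (-(-1)⁻¹) * x) h1
  simp only [mul_add, mul_smul_comm, ← mul_assoc] at h2
  rw [symm_mul_Theta_mul_T hq hv h hi, symm_mul_Theta_mul_T hq hv h hi, ← mul_smul_comm, ← map_smul,
    ← mul_add, ← map_add] at h2
  have h3 := symm_mul_Theta_cancel hq hv _ h2
  rw [rop_apply, rop_apply, wact_refl_refl, dem_refl] at h3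
  have h4 := den_mul_dem i f
  have h5 : lin k (-1) q i * dem i f = 0 := by
    rw [lin]
    rw [den] at h4
    simp only [Algebra.smul_def, map_add, map_sub, map_neg, map_one] at h3 ⊢
    linear_combination -h3 - (algebraMap k (WeightAlg k R) q) * h4
  have h6 := lin_eq_zero_of_mul hq h i h5
  rw [h6, mul_zero] at h4
  exact (sub_eq_zero.1 h4.symm).symm

end

end Symmetrizers

/-! ### Leading terms with respect to ξ -/

section Grading

variable {ι V V' : Type*} [AddCommGroup V] [Module ℝ V] [AddCommGroup V'] [Module ℝ V']
  {R : RootPairing ι ℝ V V'} [Finite ι] {b : R.Base} {k : Type*} [Field k]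

variable (b k) in
/-- The elements of `k[P]` supported on weights `x` with `ξ(x) ≤ n`. -/
def xiLE (n : ℤ) : Submodule k (WeightAlg k R) where
  carrier := {f | ∀ x, f.coeff x ≠ 0 → xi b x ≤ n}
  zero_mem' := fun x hx => absurd rfl hx
  add_mem' := by
    intro f g hf hg x hx
    by_cases h : f.coeff x = 0
    · refine hg x fun h2 => hx ?_
      rw [AddMonoidAlgebra.coeff_add, Finsupp.add_apply, h, h2, add_zero]
    · exact hf x h
  smul_mem' := by
    intro r f hf x hx
    refine hf x fun h => hx ?_
    rw [AddMonoidAlgebra.coeff_smul, Finsupp.smul_apply, h, smul_zero]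

theorem xiLE_mono {m n : ℤ} (h : m ≤ n) : xiLE b k m ≤ xiLE b k n :=
  fun _ hf x hx => (hf x hx).trans h

open Classical in
theorem coeff_ex (x y : weightLattice R) : (ex k x).coeff y = if x = y then 1 else 0 := by
  rw [ex, AddMonoidAlgebra.coeff_single, Finsupp.single_apply]

theorem ex_mem_xiLE {x : weightLattice R} {n : ℤ} (h : xi b x ≤ n) : ex k x ∈ xiLE b k n := by
  intro y hy
  rw [coeff_ex] at hy
  by_cases hxy : x = y
  · rwa [← hxy]
  · rw [if_neg hxy] at hy; exact absurd rfl hy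

theorem mul_mem_xiLE {m n : ℤ} {f g : WeightAlg k R} (hf : f ∈ xiLE b k m) (hg : g ∈ xiLE b k n) :
    f * g ∈ xiLE b k (m + n) := by
  classical
  intro x hx
  have h1 := AddMonoidAlgebra.support_coeff_mul_subset f g (Finsupp.mem_support_iff.2 hx)
  obtain ⟨y, hy, z, hz, rfl⟩ := Finset.mem_add.1 h1
  rw [xi_add]
  exact add_le_add (hf y (Finsupp.mem_support_iff.1 hy)) (hg z (Finsupp.mem_support_iff.1 hz))

variable (b) in
/-- The element `e^z` is the leading term of `f` with respect to `ξ`. -/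
def IsTop (z : weightLattice R) (f : WeightAlg k R) : Prop := f - ex k z ∈ xiLE b k (xi b z - 1)

theorem isTop_ex (z : weightLattice R) : IsTop b z (ex k z) := by
  rw [IsTop, sub_self]; exact zero_mem _

theorem IsTop.mul {y z : weightLattice R} {f g : WeightAlg k R} (hf : IsTop b y f)
    (hg : IsTop b z g) : IsTop b (y + z) (f * g) := by
  have e : f * g - ex k (y + z) =
      (f - ex k y) * (g - ex k z) + ex k y * (g - ex k z) + (f - ex k y) * ex k z := by
    rw [ex_add]; ring
  rw [IsTop, e, xi_add]
  have hy := ex_mem_xiLE (k := k) (b := b) (x := y) le_rfl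
  have hz := ex_mem_xiLE (k := k) (b := b) (x := z) le_rfl
  exact add_mem (add_mem (xiLE_mono (by omega) (mul_mem_xiLE hf hg))
    (xiLE_mono (by omega) (mul_mem_xiLE hy hg))) (xiLE_mono (by omega) (mul_mem_xiLE hf hz))

theorem IsTop.pow {z : weightLattice R} {f : WeightAlg k R} (hf : IsTop b z f) (n : ℕ) :
    IsTop b (n • z) (f ^ n) := by
  induction n with
  | zero => rw [zero_smul, pow_zero, ← ex_zero]; exact isTop_ex 0
  | succ n ih => rw [succ_nsmul, pow_succ]; exact ih.mul hf

theorem isTop_prod {κ : Type*} {S : Finset κ} {F : κ → WeightAlg k R}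
    (h : ∀ i ∈ S, IsTop b 0 (F i)) : IsTop b 0 (∏ i ∈ S, F i) := by
  classical
  induction S using Finset.induction_on with
  | empty => rw [Finset.prod_empty, ← ex_zero]; exact isTop_ex 0
  | insert i S hi ih =>
    rw [Finset.prod_insert hi]
    have := (h i (Finset.mem_insert_self _ _)).mul
      (ih fun j hj => h j (Finset.mem_insert_of_mem hj))
    rwa [add_zero] at this

theorem IsTop.mem {z : weightLattice R} {f : WeightAlg k R} (hf : IsTop b z f) :
    f ∈ xiLE b k (xi b z) := by
  have := add_mem (xiLE_mono (by omega) hf) (ex_mem_xiLE (k := k) (b := b) (x := z) le_rfl)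
  rwa [sub_add_cancel] at this

theorem IsTop.ne_zero {z : weightLattice R} {f : WeightAlg k R} (hf : IsTop b z f) : f ≠ 0 := by
  rintro rfl
  rw [IsTop, zero_sub, neg_mem_iff] at hf
  have := hf z (by rw [coeff_ex, if_pos rfl]; exact one_ne_zero)
  omega

/-- The coefficient of the product of a polynomial with leading term `e^z` and a term of maximal
degree. -/
theorem IsTop.coeff_mul {z x : weightLattice R} {f g : WeightAlg k R} (hf : IsTop b z f)
    (hg : g ∈ xiLE b k (xi b x)) : (f * g).coeff (z + x) = g.coeff x := by
  have e : f * g = ex k z * g + (f - ex k z) * g := by ring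
  have h1 : ((f - ex k z) * g).coeff (z + x) = 0 := by
    by_contra h
    have := mul_mem_xiLE hf hg _ h
    rw [xi_add] at this
    omega
  rw [e, AddMonoidAlgebra.coeff_add, Finsupp.add_apply, h1, add_zero, ex,
    AddMonoidAlgebra.coeff_single_mul_apply, one_mul, neg_add_cancel_left]

end Grading

/-! ### Steinberg's basis and its leading term -/

section Steinberg

variable {ι V V' : Type*} [AddCommGroup V] [Module ℝ V] [AddCommGroup V'] [Module ℝ V']
  {R : RootPairing ι ℝ V V'} [Finite ι] [R.IsRootSystem] [R.IsCrystallographic] [R.IsReduced]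
  {b : R.Base} {k : Type*} [Field k]

theorem isTop_weylDen : IsTop b (rho b) (weylDen k b) := by
  rw [weylDen_eq]
  have h : IsTop b 0 (∏ i ∈ posRoots b, (den k i : WeightAlg k R)) := by
    refine isTop_prod fun i hi => ?_
    rw [IsTop, den, ex_zero, sub_sub_cancel_left, neg_mem_iff]
    refine ex_mem_xiLE ?_
    have h1 : 0 < b.height i := (mem_posRoots b).1 hi
    rw [xi_neg, xi_rootWeight, xi_zero]
    omega
  have := (isTop_ex (k := k) (b := b) (rho b)).mul h
  rwa [add_zero] at this

theorem exists_pair_eq_sum {j : ι} (hj : b.IsPos j) : ∃ f : ι → ℤ, (∀ i, 0 ≤ f i) ∧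
    ∀ x : weightLattice R, pair x j = ∑ i ∈ b.support, f i * pair x i := by
  obtain ⟨f, hf, h⟩ := exists_coroot_sum_nonneg b hj
  refine ⟨f, hf, fun x => ?_⟩
  rw [pair_eq_iff, coroot'_eq, h, map_sum]
  push_cast
  refine Finset.sum_congr rfl fun i _ => ?_
  rw [map_zsmul, ← coroot'_eq, pair_spec, zsmul_eq_mul]

variable (b) in
open Classical in
theorem exists_descentWeight (w : R.weylGroup) : ∃ x : weightLattice R,
    ∀ i ∈ b.support, pair x i = if b.IsPos (w⁻¹ • i) then 0 else 1 :=
  exists_weight b fun i => if b.IsPos (w⁻¹ • i) then 0 else 1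

variable (b) in
/-- The sum of the fundamental weights at the left descents of `w`. -/
def descentWeight (w : R.weylGroup) : weightLattice R := (exists_descentWeight b w).choose

open Classical in
theorem pair_descentWeight (w : R.weylGroup) {i : ι} (hi : i ∈ b.support) :
    pair (descentWeight b w) i = if b.IsPos (w⁻¹ • i) then 0 else 1 := by
  exact (exists_descentWeight b w).choose_spec i hi

theorem isDominant_descentWeight (w : R.weylGroup) : IsDominant b (descentWeight b w) := by
  intro i hi
  rw [pair_descentWeight w hi]
  split_ifs <;> norm_num

/-- A positive coroot with zero pairing is a combination of simple coroots that are not descents.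
Those stay positive under `w⁻¹`, hence so does their nonnegative combination. -/
theorem isPos_of_pair_descentWeight {w : R.weylGroup} {j : ι} (hj : b.IsPos j)
    (h : pair (descentWeight b w) j = 0) : b.IsPos (w⁻¹ • j) := by
  obtain ⟨f, hf, hsum⟩ := exists_pair_eq_sum hj
  rw [hsum, Finset.sum_eq_zero_iff_of_nonneg fun i hi =>
    mul_nonneg (hf i) (isDominant_descentWeight w i hi)] at h
  by_contra hneg
  have h1 : 0 ≤ pair (w • rho b) j := by
    rw [hsum]
    refine Finset.sum_nonneg fun i hi => ?_
    have h2 := h i hi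
    rw [pair_descentWeight w hi] at h2
    by_cases hpos : b.IsPos (w⁻¹ • i)
    · refine mul_nonneg (hf i) ?_
      rw [pair_smul]
      exact (isPos_iff_pair_rho.1 hpos).le
    · rw [if_neg hpos, mul_one] at h2
      rw [h2, zero_mul]
  rw [pair_smul] at h1
  rw [← isPos_opp, isPos_iff_pair_rho, pair_opp] at hneg
  omega

/-- Absolute values depend on the roots only up to sign, and the Weyl group permutes the pairs `±α`.
For dominant `x` the sum is `ξ(x)`, which bounds `ξ` on the whole orbit. -/
theorem sum_abs_pair_smul (x : weightLattice R) (w : R.weylGroup) :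
    ∑ j ∈ posRoots b, |pair x (w • j)| = ∑ j ∈ posRoots b, |pair x j| := by
  classical
  have hinv : ∀ (u : R.weylGroup) (j : ι), b.IsPos j →
      (if b.IsPos (u⁻¹ • (if b.IsPos (u • j) then u • j else opp R (u • j))) then
        u⁻¹ • (if b.IsPos (u • j) then u • j else opp R (u • j)) else
        opp R (u⁻¹ • (if b.IsPos (u • j) then u • j else opp R (u • j)))) = j := by
    intro u j hj
    by_cases h : b.IsPos (u • j)
    · rw [if_pos h, inv_smul_smul, if_pos hj]
    · rw [if_neg h, smul_opp, inv_smul_smul, opp_opp, if_neg]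
      rw [isPos_opp]; exact not_not.2 hj
  have hmem : ∀ (u : R.weylGroup) (j : ι),
      b.IsPos (if b.IsPos (u • j) then u • j else opp R (u • j)) := by
    intro u j
    split_ifs with h
    · exact h
    · rwa [isPos_opp]
  refine Finset.sum_bij' (fun j _ => if b.IsPos (w • j) then w • j else opp R (w • j))
    (fun j _ => if b.IsPos (w⁻¹ • j) then w⁻¹ • j else opp R (w⁻¹ • j)) ?_ ?_ ?_ ?_ ?_
  · intro j _; rw [mem_posRoots]; exact hmem w j
  · intro j _; rw [mem_posRoots]; exact hmem w⁻¹ j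
  · intro j hj; exact hinv w j ((mem_posRoots b).1 hj)
  · intro j hj
    have := hinv w⁻¹ j ((mem_posRoots b).1 hj)
    rwa [inv_inv] at this
  · intro j _
    split_ifs
    · rfl
    · rw [pair_opp, abs_neg]

theorem xi_eq_sum_abs {x : weightLattice R} (hx : IsDominant b x) :
    xi b x = ∑ j ∈ posRoots b, |pair x j| := by
  rw [xi]
  exact Finset.sum_congr rfl fun j hj =>
    (abs_of_nonneg (pair_nonneg b hx ((mem_posRoots b).1 hj))).symm

theorem xi_smul_le {x : weightLattice R} (hx : IsDominant b x) (w : R.weylGroup) :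
    xi b (w • x) ≤ xi b x := by
  rw [xi_eq_sum_abs hx, ← sum_abs_pair_smul x w⁻¹, xi]
  exact Finset.sum_le_sum fun j _ => by rw [pair_smul]; exact le_abs_self _

theorem pair_nonneg_of_xi_smul_eq {x : weightLattice R} (hx : IsDominant b x) {w : R.weylGroup}
    (h : xi b (w • x) = xi b x) {j : ι} (hj : b.IsPos j) : 0 ≤ pair x (w⁻¹ • j) := by
  rw [xi_eq_sum_abs hx, ← sum_abs_pair_smul x w⁻¹, xi, Finset.sum_eq_sum_iff_of_le] at h
  · have := h j ((mem_posRoots b).2 hj)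
    rw [pair_smul] at this
    exact abs_eq_self.1 this.symm
  · intro j _; rw [pair_smul]; exact le_abs_self _

/-- If `v` fixes the degree of the descent weight of `w`, then `l(v w) ≥ l(w)`, with equality only
for `v = 1`. -/
theorem len_le_of_xi_smul_descentWeight {v w : R.weylGroup}
    (h : xi b (v • descentWeight b w) = xi b (descentWeight b w)) :
    len b (fin w) ≤ len b (fin (v * w)) ∧ (len b (fin (v * w)) = len b (fin w) → v = 1) := by
  classical
  have hnn := fun (j : ι) (hj : b.IsPos j) =>
    pair_nonneg_of_xi_smul_eq (isDominant_descentWeight w) h hj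
  -- A positive root `l` made negative by `v` pairs with the descent weight both nonnegatively and
  -- nonpositively, so the pairing is zero.
  have hneg : ∀ l : ι, b.IsPos l → ¬ b.IsPos (v • l) → b.IsPos (w⁻¹ • l) := by
    intro l hl hvl
    apply isPos_of_pair_descentWeight hl
    have h1 := hnn (opp R (v • l)) ((isPos_opp b _).2 hvl)
    rw [smul_opp, inv_smul_smul, pair_opp] at h1
    have h2 := pair_nonneg b (isDominant_descentWeight w) hl
    omega
  rw [len_fin, len_fin]
  set N : R.weylGroup → Finset ι := fun w => (posRoots b).filter fun i => ¬ b.IsPos (w⁻¹ • i)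
    with hN
  have hsub : (N w).image (fun l => v • l) ⊆ N (v * w) := by
    intro j hj
    obtain ⟨l, hl, rfl⟩ := Finset.mem_image.1 hj
    simp only [hN, Finset.mem_filter, mem_posRoots] at hl ⊢
    refine ⟨?_, ?_⟩
    · by_contra hc
      exact hl.2 (hneg l hl.1 hc)
    · rw [mul_inv_rev, mul_smul, inv_smul_smul]; exact hl.2
  have hcard : ((N w).image (fun l => v • l)).card = (N w).card :=
    Finset.card_image_of_injective _ (MulAction.injective v)
  refine ⟨?_, fun heq => ?_⟩
  · have := Finset.card_le_card hsub
    rw [hcard] at this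
    convert this
  · have heq' : (N w).image (fun l => v • l) = N (v * w) := by
      refine Finset.eq_of_subset_of_card_le hsub ?_
      rw [hcard]
      exact le_of_eq (by convert heq)
    by_contra hv1
    -- If `v ≠ 1`, some simple `i` has `v⁻¹ i` negative, and `hneg` at `-v⁻¹ i` puts `i` into `N (v
    -- * w)`. Its preimage in `N w` would be `v⁻¹ i`, which is not positive.
    have : ∃ i ∈ b.support, ¬ b.IsPos (v⁻¹ • i) := by
      by_contra! h1
      exact hv1 (inv_eq_one.1 (eq_one_of_isPos b h1))
    obtain ⟨i, hi, hvi⟩ := this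
    have h1 : b.IsPos (w⁻¹ • opp R (v⁻¹ • i)) := by
      refine hneg _ ((isPos_opp b _).2 hvi) ?_
      rw [smul_opp, smul_inv_smul, isPos_opp, not_not]
      exact isPos_simple b hi
    have h2 : i ∈ N (v * w) := by
      simp only [hN, Finset.mem_filter, mem_posRoots]
      refine ⟨isPos_simple b hi, ?_⟩
      rw [mul_inv_rev, mul_smul]
      rwa [smul_opp, isPos_opp] at h1
    rw [← heq'] at h2
    obtain ⟨l, hl, hli⟩ := Finset.mem_image.1 h2
    simp only [hN, Finset.mem_filter, mem_posRoots] at hl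
    refine hvi ?_
    rw [← hli, inv_smul_smul]
    exact hl.1

open Classical in
theorem two_mul_card_neg (j : ι) :
    2 * (Finset.univ.filter fun u : R.weylGroup => ¬ b.IsPos (u⁻¹ • j)).card =
      Fintype.card R.weylGroup := by
  have h := Finset.card_filter_add_card_filter_not (s := (Finset.univ : Finset R.weylGroup))
    (fun u : R.weylGroup => b.IsPos (u⁻¹ • j))
  have h2 : (Finset.univ.filter fun u : R.weylGroup => b.IsPos (u⁻¹ • j)).card =
      (Finset.univ.filter fun u : R.weylGroup => ¬ b.IsPos (u⁻¹ • j)).card := by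
    refine Finset.card_bij (fun u _ => σ R j * u) ?_ ?_ ?_
    · intro u hu
      rw [Finset.mem_filter] at hu ⊢
      exact ⟨Finset.mem_univ _, fun h => (isPos_refl_mul_inv_smul j u).1 h hu.2⟩
    · intro u _ w _ h; exact mul_left_cancel h
    · intro u hu
      rw [Finset.mem_filter] at hu
      refine ⟨σ R j * u, ?_, by rw [← mul_assoc, refl_mul_self, one_mul]⟩
      rw [Finset.mem_filter]
      exact ⟨Finset.mem_univ _, (isPos_refl_mul_inv_smul j u).2 hu.2⟩
  rw [Finset.card_univ] at h
  omega

variable (R) in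
/-- Half the order of the Weyl group. -/
def halfCard : ℕ := Fintype.card R.weylGroup / 2

open Classical in
theorem card_neg (j : ι) :
    (Finset.univ.filter fun u : R.weylGroup => ¬ b.IsPos (u⁻¹ • j)).card = halfCard R := by
  have := two_mul_card_neg (b := b) j
  rw [halfCard]
  omega

/-- Each simple root is a left descent of exactly half of the elements. -/
theorem sum_descentWeight : ∑ w : R.weylGroup, descentWeight b w = halfCard R • rho b := by
  classical
  refine weight_ext b fun i hi => ?_
  rw [pair_sum, pair_nsmul, pair_rho hi, mul_one, ← card_neg (b := b) i, Finset.card_filter]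
  push_cast
  refine Finset.sum_congr rfl fun w _ => ?_
  rw [pair_descentWeight w hi]
  split_ifs <;> rfl

/-- Steinberg's basis of `k[P]` over the invariants. -/
def steinberg (b : R.Base) (k : Type*) [Field k] (w : R.weylGroup) : WeightAlg k R :=
  ex k (w⁻¹ • descentWeight b w)

/-- The matrix of the Weyl group translates of Steinberg's basis. -/
def steinbergMatrix (b : R.Base) (k : Type*) [Field k] :
    Matrix R.weylGroup R.weylGroup (WeightAlg k R) :=
  Matrix.of fun w u => wact u (steinberg b k w)

open Classical in
-- In the Leibniz expansion the permutation `π` contributes the weight `∑ π(w) w⁻¹ x_w`, where `x_w`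
-- is dominant, so its `ξ` is at most that of the identity. Equality would give `l(w) ≤ l(π w)` for
-- all `w`; as the total lengths agree, the lengths are then equal and `π = 1`.
theorem isTop_det_steinbergMatrix :
    IsTop b (halfCard R • rho b) (steinbergMatrix b k).det := by
  rw [← Matrix.det_transpose, Matrix.det_apply, IsTop, ← sum_descentWeight]
  have hterm : ∀ π : Equiv.Perm R.weylGroup,
      ∏ w, (steinbergMatrix b k).transpose (π w) w =
        ex k (∑ w, (π w * w⁻¹) • descentWeight b w) := by
    intro π
    rw [ex_sum]
    refine Finset.prod_congr rfl fun w _ => ?_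
    rw [Matrix.transpose_apply, steinbergMatrix, Matrix.of_apply, steinberg, wact_ex, mul_smul]
  rw [← Finset.add_sum_erase _ _ (Finset.mem_univ (1 : Equiv.Perm R.weylGroup)), hterm,
    Equiv.Perm.sign_one, one_smul]
  have h1 : ∑ w : R.weylGroup, ((1 : Equiv.Perm R.weylGroup) w * w⁻¹) • descentWeight b w =
      ∑ w : R.weylGroup, descentWeight b w :=
    Finset.sum_congr rfl fun w _ => by rw [Equiv.Perm.one_apply, mul_inv_cancel, one_smul]
  rw [h1, add_sub_cancel_left]
  refine Submodule.sum_mem _ fun π hπ => ?_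
  have hπ1 : π ≠ 1 := (Finset.mem_erase.1 hπ).1
  rw [hterm]
  have hmem : ex k (∑ w, (π w * w⁻¹) • descentWeight b w) ∈
      xiLE b k (xi b (∑ w : R.weylGroup, descentWeight b w) - 1) := by
    refine ex_mem_xiLE ?_
    by_contra hlt
    have hle : ∀ w ∈ (Finset.univ : Finset R.weylGroup),
        xi b ((π w * w⁻¹) • descentWeight b w) ≤ xi b (descentWeight b w) :=
      fun w _ => xi_smul_le (isDominant_descentWeight w) _
    rw [xi_sum, xi_sum] at hlt
    have heq := (Finset.sum_eq_sum_iff_of_le hle).1 (le_antisymm (Finset.sum_le_sum hle) (by omega))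
    have hlen : ∀ w ∈ (Finset.univ : Finset R.weylGroup), len b (fin w) ≤ len b (fin (π w)) := by
      intro w hw
      have := (len_le_of_xi_smul_descentWeight (heq w hw)).1
      rwa [inv_mul_cancel_right] at this
    have hlen2 := (Finset.sum_eq_sum_iff_of_le hlen).1
      (Equiv.sum_comp π fun w => len b (fin w)).symm
    refine hπ1 (Equiv.ext fun w => ?_)
    have := (len_le_of_xi_smul_descentWeight (heq w (Finset.mem_univ w))).2 (by
      rw [inv_mul_cancel_right, hlen2 w (Finset.mem_univ w)])
    rw [Equiv.Perm.one_apply]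
    exact mul_inv_eq_one.1 this
  rcases Int.units_eq_one_or (Equiv.Perm.sign π) with hs | hs
  · rw [hs, one_smul]; exact hmem
  · rw [hs, Units.neg_smul, one_smul]; exact neg_mem hmem

/-- Subtract column `s u` from column `u` for all `u ∈ S` at once, that is, multiply by `1 - Z`.
Since `s` leads out of `S`, `Z² = 0` and this changes the determinant only by a unit, while the
columns in `S` become divisible by `p`. -/
theorem pow_card_dvd_det {A n : Type*} [CommRing A] [Fintype n] [DecidableEq n] {N : Matrix n n A} {p : A}
    (S : Finset n) (s : n → n) (hs : ∀ u ∈ S, s u ∉ S)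
    (h : ∀ w, ∀ u ∈ S, p ∣ N w u - N w (s u)) : p ^ S.card ∣ N.det := by
  set Z : Matrix n n A := Matrix.of fun x u => if u ∈ S ∧ x = s u then 1 else 0 with hZ
  have hZZ : Z * Z = 0 := by
    ext x u
    rw [Matrix.mul_apply, Matrix.zero_apply]
    refine Finset.sum_eq_zero fun y _ => ?_
    simp only [hZ, Matrix.of_apply]
    by_cases h1 : y ∈ S ∧ x = s y
    · rw [if_neg (fun h2 : u ∈ S ∧ y = s u => hs u h2.1 (h2.2 ▸ h1.1)), mul_zero]
    · rw [if_neg h1, zero_mul]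
  have hunit : IsUnit (1 - Z).det := by
    have : (1 - Z) * (1 + Z) = 1 := by
      rw [sub_mul, mul_add, mul_add, hZZ]; simp
    have h2 := congrArg Matrix.det this
    rw [Matrix.det_mul, Matrix.det_one] at h2
    exact IsUnit.of_mul_eq_one _ h2
  have hNZ : ∀ w u, (N * (1 - Z)) w u = if u ∈ S then N w u - N w (s u) else N w u := by
    intro w u
    rw [mul_sub, mul_one, Matrix.sub_apply, Matrix.mul_apply]
    by_cases hu : u ∈ S
    · rw [if_pos hu, Finset.sum_eq_single (s u)]
      · simp [hZ, hu]
      · intro y _ hy; simp [hZ, hy]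
      · intro h; exact absurd (Finset.mem_univ _) h
    · rw [if_neg hu, Finset.sum_eq_zero, sub_zero]
      intro y _; simp [hZ, hu]
  choose! Q hQ using h
  have hfac : N * (1 - Z) = (Matrix.of fun w u => if u ∈ S then Q w u else N w u) *
      Matrix.diagonal fun u => if u ∈ S then p else 1 := by
    ext w u
    rw [hNZ, Matrix.mul_diagonal, Matrix.of_apply]
    by_cases hu : u ∈ S
    · rw [if_pos hu, if_pos hu, if_pos hu, hQ w u hu, mul_comm]
    · rw [if_neg hu, if_neg hu, if_neg hu, mul_one]
  have hdet := congrArg Matrix.det hfac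
  rw [Matrix.det_mul, Matrix.det_mul, Matrix.det_diagonal, Finset.prod_ite_mem, Finset.univ_inter,
    Finset.prod_const] at hdet
  rw [← hunit.dvd_mul_right, hdet]
  exact Dvd.intro_left _ rfl

theorem wact_coeff (w : R.weylGroup) (f : WeightAlg k R) (x : weightLattice R) :
    (wact w f).coeff (w • x) = f.coeff x := by
  have hinj : Function.Injective (fun x : weightLattice R => w • x) := MulAction.injective w
  exact Finsupp.mapDomain_apply hinj f.coeff x

theorem xi_longest_smul (x : weightLattice R) : xi b (longest b • x) = -xi b x := by
  rw [xi, xi, ← Finset.sum_neg_distrib]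
  simp only [pair_smul, longest_inv]
  have h := congrArg Multiplicative.toAdd (prod_posRoots_longest (b := b) (M := Multiplicative ℤ)
    (fun j => Multiplicative.ofAdd (pair x j)))
  simp only [toAdd_prod, toAdd_ofAdd, pair_opp] at h
  exact h

end Steinberg

/-! ### Steinberg's determinant and the Pittie–Steinberg theorem -/

section Determinant

variable {ι V V' : Type*} [AddCommGroup V] [Module ℝ V] [AddCommGroup V'] [Module ℝ V']
  {R : RootPairing ι ℝ V V'} [Finite ι] [R.IsRootSystem] [R.IsCrystallographic] [R.IsReduced]
  {b : R.Base} {k : Type*} [Field k]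

open Classical in
theorem den_pow_dvd_det {j : ι} {S : Finset R.weylGroup}
    (hS : ∀ u ∈ S, ¬ b.IsPos (u⁻¹ • j)) {N : Matrix R.weylGroup R.weylGroup (WeightAlg k R)}
    (h : ∀ w, ∀ u ∈ S, den k j ∣ N w u - N w (σ R j * u)) : den k j ^ S.card ∣ N.det :=
  pow_card_dvd_det (N := N) (p := den k j) S (fun u => σ R j * u)
    (fun u hu h2 => hS _ h2 ((isPos_refl_mul_inv_smul j u).2 (hS u hu))) h

theorem den_dvd_steinbergMatrix_sub (j : ι) (w u : R.weylGroup) :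
    den k j ∣ steinbergMatrix b k w u - steinbergMatrix b k w (σ R j * u) :=
  den_dvd_sub_refl j u (steinberg b k w)

open Classical in
theorem weylDen_pow_dvd_det_steinbergMatrix :
    weylDen k b ^ halfCard R ∣ (steinbergMatrix b k).det := by
  refine weylDen_pow_dvd fun j hj => ?_
  have h := den_pow_dvd_det (b := b) (j := j) (N := steinbergMatrix b k)
    (S := Finset.univ.filter fun u : R.weylGroup => ¬ b.IsPos (u⁻¹ • j))
    (fun u hu => (Finset.mem_filter.1 hu).2) (fun w u _ => den_dvd_steinbergMatrix_sub j w u)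
  rwa [card_neg] at h

open Classical in
theorem wact_det_steinbergMatrix (v : R.weylGroup) :
    ∃ s : k, s ≠ 0 ∧ wact v (steinbergMatrix b k).det = s • (steinbergMatrix b k).det := by
  have h1 : wact v (steinbergMatrix b k).det =
      ((Equiv.Perm.sign (Equiv.mulLeft v) : ℤ) : WeightAlg k R) * (steinbergMatrix b k).det := by
    rw [AlgHom.map_det, ← Matrix.det_permute']
    refine congrArg Matrix.det (Matrix.ext fun w u => ?_)
    change wact v (wact u (steinberg b k w)) = wact (v * u) (steinberg b k w)
    rw [wact_mul]
  rw [h1]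
  rcases Int.units_eq_one_or (Equiv.Perm.sign (Equiv.mulLeft v)) with hs | hs
  · exact ⟨1, one_ne_zero, by rw [hs, Units.val_one, Int.cast_one, one_mul, one_smul]⟩
  · exact ⟨-1, neg_ne_zero.2 one_ne_zero, by
      rw [hs, Units.val_neg, Units.val_one, Int.cast_neg, Int.cast_one, neg_one_mul, neg_one_smul]⟩

/-- The support is stable under the Weyl group. The longest element negates `ξ`, so `ξ` vanishes on
the support; a simple reflection changes `ξ` by `-2⟨x, αᵢ^∨⟩`, so these pairings vanish as well. -/
theorem eq_algebraMap_of_wact {f : WeightAlg k R} (hle : f ∈ xiLE b k 0)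
    (hinv : ∀ v : R.weylGroup, ∃ s : k, s ≠ 0 ∧ wact v f = s • f) :
    f = algebraMap k _ (f.coeff 0) := by
  classical
  have hsupp : ∀ v : R.weylGroup, ∀ x, f.coeff x ≠ 0 → f.coeff (v • x) ≠ 0 := by
    intro v x hx h0
    obtain ⟨s, hs0, hs⟩ := hinv v
    refine hx ?_
    rw [← wact_coeff v, hs, AddMonoidAlgebra.coeff_smul, Finsupp.smul_apply, h0, smul_zero]
  have hxi : ∀ x, f.coeff x ≠ 0 → xi b x = 0 := by
    intro x hx
    have h1 := hle _ (hsupp (longest b) x hx)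
    rw [xi_longest_smul] at h1
    have := hle x hx
    omega
  have hzero : ∀ x, f.coeff x ≠ 0 → x = 0 := by
    intro x hx
    refine weight_ext b fun i hi => ?_
    have h1 := hxi _ (hsupp (σ R i) x hx)
    rw [xi_refl_smul hi, hxi x hx] at h1
    rw [pair_zero]
    omega
  ext x
  have h1 : (algebraMap k (WeightAlg k R) (f.coeff 0)) = AddMonoidAlgebra.single 0 (f.coeff 0) :=
    rfl
  rw [h1, AddMonoidAlgebra.coeff_single, Finsupp.single_apply]
  split_ifs with h
  · rw [h]
  · by_contra hx; exact h (hzero x hx).symm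

open Classical in
/-- The determinant of Steinberg's matrix is a power of the Weyl denominator. -/
theorem det_steinbergMatrix : ∃ r : k, r ≠ 0 ∧
    (steinbergMatrix b k).det = r • weylDen k b ^ halfCard R := by
  obtain ⟨f, hf⟩ := weylDen_pow_dvd_det_steinbergMatrix (b := b) (k := k)
  have htop := isTop_det_steinbergMatrix (b := b) (k := k)
  have hDtop := (isTop_weylDen (b := b) (k := k)).pow (halfCard R)
  have hD0 : weylDen k b ^ halfCard R ≠ (0 : WeightAlg k R) := pow_ne_zero _ weylDen_ne_zero
  have hf0 : f ≠ 0 := by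
    rintro rfl
    exact htop.ne_zero (by rw [hf, mul_zero])
  -- The determinant and the power of the Weyl denominator have the same leading weight, so their
  -- quotient `f` has no terms of positive degree. Being invariant up to scalars, it is then
  -- constant.
  have hle : f ∈ xiLE b k 0 := by
    have hne : f.coeff.support.Nonempty :=
      Finsupp.support_nonempty_iff.2 fun h => hf0 (AddMonoidAlgebra.coeff_eq_zero.1 h)
    obtain ⟨x, hx, hmax⟩ := f.coeff.support.exists_max_image (xi b) hne
    have h1 := hDtop.coeff_mul (x := x) (g := f) fun y hy =>
      hmax y (Finsupp.mem_support_iff.2 hy)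
    rw [← hf] at h1
    have h2 := htop.mem (halfCard R • rho b + x) (by
      rw [h1]; exact Finsupp.mem_support_iff.1 hx)
    rw [xi_add] at h2
    intro y hy
    have := hmax y (Finsupp.mem_support_iff.2 hy)
    omega
  have hinv : ∀ v : R.weylGroup, ∃ s : k, s ≠ 0 ∧ wact v f = s • f := by
    intro v
    obtain ⟨s, hs0, hs⟩ := wact_det_steinbergMatrix (b := b) (k := k) v
    have he := eps_sq (k := k) (b := b) v
    have he0 : (eps b v : k) ^ halfCard R ≠ 0 := by
      refine pow_ne_zero _ fun h0 => ?_
      rw [h0, zero_mul] at he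
      exact zero_ne_one he
    refine ⟨((eps b v : k) ^ halfCard R)⁻¹ * s, mul_ne_zero (inv_ne_zero he0) hs0, ?_⟩
    apply mul_left_cancel₀ hD0
    rw [hf, map_mul, map_pow, wact_weylDen, smul_pow, smul_mul_assoc] at hs
    rw [mul_smul_comm, mul_smul, ← hs, smul_smul, inv_mul_cancel₀ he0, one_smul]
  have hfc := eq_algebraMap_of_wact hle hinv
  refine ⟨f.coeff 0, fun h0 => hf0 (by rw [hfc, h0, map_zero]), ?_⟩
  rw [hf, Algebra.smul_def, mul_comm, ← hfc]

theorem eq_one_of_halfCard_eq_zero (b : R.Base) (h : halfCard R = 0) (u : R.weylGroup) :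
    u = 1 := by
  classical
  refine eq_one_of_isPos b fun i hi => ?_
  by_contra hneg
  have h1 := card_neg (b := b) i
  rw [h, Finset.card_eq_zero, Finset.filter_eq_empty_iff] at h1
  have h2 := h1 (Finset.mem_univ u⁻¹)
  rw [inv_inv] at h2
  exact h2 hneg

open Classical in
-- A cofactor is the determinant with one row replaced by the unit vector at `1`. The difference of
-- the columns `u` and `σ R j * u` stays divisible unless one of them is the column `1`. That
-- excludes a single pair, with `u = σ R j`, and costs one power.
theorem weylDen_pow_dvd_adjugate {m : ℕ} (hm : halfCard R = m + 1) (w : R.weylGroup) :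
    weylDen k b ^ m ∣ (steinbergMatrix b k).adjugate 1 w := by
  rw [Matrix.adjugate_apply]
  refine weylDen_pow_dvd fun j hj => ?_
  set S := Finset.univ.filter fun u : R.weylGroup => ¬ b.IsPos (u⁻¹ • j) with hS
  have hmem : σ R j ∈ S := by
    rw [hS, Finset.mem_filter, refl_inv, refl_smul_self, isPos_opp, not_not]
    exact ⟨Finset.mem_univ _, hj⟩
  have hcard : (S.erase (σ R j)).card = m := by
    rw [Finset.card_erase_of_mem hmem, hS, card_neg, hm, Nat.add_sub_cancel]
  have hneg : ∀ u ∈ S.erase (σ R j), ¬ b.IsPos (u⁻¹ • j) := fun u hu =>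
    (Finset.mem_filter.1 (Finset.mem_of_mem_erase hu)).2
  rw [← hcard]
  refine den_pow_dvd_det (b := b) hneg fun w' u hu => ?_
  by_cases hw : w' = w
  · have h1 : u ≠ 1 := by
      rintro rfl
      refine hneg _ hu ?_
      rwa [inv_one, one_smul]
    have h2 : σ R j * u ≠ 1 := by
      intro h1
      refine Finset.ne_of_mem_erase hu ?_
      rw [mul_eq_one_iff_eq_inv] at h1
      rw [← inv_inj, ← h1, refl_inv]
    rw [hw, Matrix.updateRow_self, Pi.single_eq_of_ne h1, Pi.single_eq_of_ne h2, sub_zero]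
    exact dvd_zero _
  · rw [Matrix.updateRow_ne hw]
    exact den_dvd_steinbergMatrix_sub j w' u

open Classical in
variable (b k) in
-- The required vector is the row at `1` of the adjugate, divided by one power of the Weyl
-- denominator less than the determinant contains. This leaves exactly one factor `weylDen k b`.
theorem exists_dual_steinberg : ∃ a : R.weylGroup → WeightAlg k R, ∀ u : R.weylGroup,
    ∑ w, a w * wact u (steinberg b k w) = if u = 1 then weylDen k b else 0 := by
  by_cases hm : halfCard R = 0
  · have hsub := eq_one_of_halfCard_eq_zero b hm
    refine ⟨fun w => ex k (-(w⁻¹ • descentWeight b w)) * weylDen k b, fun u => ?_⟩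
    rw [if_pos (hsub u), Finset.sum_eq_single 1, hsub u, wact_one, steinberg, mul_right_comm,
      ex_neg_mul, one_mul]
    · intro w _ hw; exact absurd (hsub w) hw
    · intro h; exact absurd (Finset.mem_univ _) h
  · obtain ⟨r, hr, hdet⟩ := det_steinbergMatrix (b := b) (k := k)
    obtain ⟨m, hm⟩ := Nat.exists_eq_succ_of_ne_zero hm
    choose a ha using weylDen_pow_dvd_adjugate (b := b) (k := k) hm
    refine ⟨fun w => r⁻¹ • a w, fun u => ?_⟩
    have h1 := congrFun (congrFun (Matrix.adjugate_mul (steinbergMatrix b k)) 1) u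
    rw [Matrix.mul_apply, Matrix.smul_apply, Matrix.one_apply, hdet, hm, pow_succ] at h1
    have h2 : weylDen k b ^ m * ∑ w, a w * wact u (steinberg b k w) =
        weylDen k b ^ m * (r • if u = 1 then weylDen k b else 0) := by
      rw [Finset.mul_sum]
      have h3 : ∀ w, weylDen k b ^ m * (a w * wact u (steinberg b k w)) =
          (steinbergMatrix b k).adjugate 1 w * steinbergMatrix b k w u := fun w => by
        rw [ha, mul_assoc]; rfl
      rw [Finset.sum_congr rfl fun w _ => h3 w, h1]
      by_cases hu : u = 1
      · rw [if_pos hu.symm, if_pos hu, smul_eq_mul, mul_one, mul_smul_comm]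
      · rw [if_neg (Ne.symm hu), if_neg hu, smul_zero, smul_zero, mul_zero]
    have h3 := mul_left_cancel₀ (pow_ne_zero m weylDen_ne_zero) h2
    simp only [smul_mul_assoc]
    rw [← Finset.smul_sum, h3, smul_smul, inv_mul_cancel₀ hr, one_smul]

variable (b k) in
/-- The Pittie–Steinberg theorem: `k[P]` is spanned over the invariants by Steinberg's basis, and
the coordinates are given by the Weyl character formula. -/
theorem exists_steinberg_expansion : ∃ a : R.weylGroup → WeightAlg k R, ∀ f : WeightAlg k R,
    f = ∑ w, nrm b (f * a w) * steinberg b k w := by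
  classical
  obtain ⟨a, ha⟩ := exists_dual_steinberg b k
  refine ⟨a, fun f => ?_⟩
  apply eq_of_weylDen_mul (b := b)
  rw [Finset.mul_sum]
  simp only [← mul_assoc, weylDen_mul_nrm, alt, Finset.sum_mul]
  -- After multiplication by the Weyl denominator, the summand of `u` is `± u(f)` times the
  -- `u`-translate of the duality relation at `u⁻¹`. Only `u = 1` survives.
  rw [Finset.sum_comm, Finset.sum_eq_single 1]
  · simp only [eps_one, Int.cast_one, one_smul, wact_one, mul_assoc]
    have h1 := ha 1
    simp only [wact_one, if_pos] at h1
    rw [← Finset.mul_sum, h1, mul_comm]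
  · intro u _ hu
    have h1 := congrArg (wact u) (ha u⁻¹)
    rw [if_neg (inv_ne_one.2 hu), map_zero, map_sum] at h1
    simp only [map_mul, wact_wact_inv] at h1
    simp only [map_mul, smul_mul_assoc, mul_assoc]
    rw [← Finset.smul_sum, ← Finset.mul_sum, h1, mul_zero, smul_zero]
  · intro h; exact absurd (Finset.mem_univ _) h

end Determinant

/-! ### The ideal of a central character -/

section Specialization

variable {ι V V' : Type*} [AddCommGroup V] [Module ℝ V] [AddCommGroup V'] [Module ℝ V']
  {R : RootPairing ι ℝ V V'} {k : Type*} [Field k]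
  {t τ : Multiplicative (weightLattice R) →* kˣ}

variable (t) in
/-- The ideal of `k[P]` generated by the invariants that vanish at `t`. -/
def invIdeal : Ideal (WeightAlg k R) :=
  Ideal.span {f | ∃ z : WeightAlg k R, (∀ w, wact w z = z) ∧ f = z - algebraMap k _ (ev t z)}

theorem sub_mem_invIdeal {z : WeightAlg k R} (hz : ∀ w, wact w z = z) :
    z - algebraMap k _ (ev t z) ∈ invIdeal t :=
  Ideal.subset_span ⟨z, hz, rfl⟩

theorem mem_invIdeal_of_ev_eq_zero {z : WeightAlg k R} (hz : ∀ w, wact w z = z)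
    (h : ev t z = 0) : z ∈ invIdeal t := by
  have := sub_mem_invIdeal (t := t) hz
  rwa [h, map_zero, sub_zero] at this

theorem wact_sub_algebraMap {z : WeightAlg k R} (hz : ∀ w, wact w z = z) (r : k)
    (w : R.weylGroup) : wact w (z - algebraMap k _ r) = z - algebraMap k _ r := by
  rw [map_sub, hz, AlgHom.commutes]

/-- To map the ideal into a subgroup it is enough that an additive map sends the multiples of the
generators there. -/
theorem map_mem_of_mem_invIdeal {M : Type*} [AddCommGroup M] (N : AddSubgroup M)
    (F : WeightAlg k R →+ M)
    (h : ∀ z : WeightAlg k R, (∀ w, wact w z = z) → ∀ g,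
      F (g * (z - algebraMap k _ (ev t z))) ∈ N)
    {f : WeightAlg k R} (hf : f ∈ invIdeal t) : F f ∈ N := by
  suffices hs : ∀ g, F (g * f) ∈ N by
    have := hs 1
    rwa [one_mul] at this
  refine Submodule.span_induction ?_ ?_ ?_ ?_ hf
  · rintro _ ⟨z, hz, rfl⟩ g
    exact h z hz g
  · intro g; rw [mul_zero, map_zero]; exact zero_mem _
  · intro x y _ _ hx hy g
    rw [mul_add, map_add]
    exact add_mem (hx g) (hy g)
  · intro r x _ hx g
    rw [smul_eq_mul, ← mul_assoc]
    exact hx _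

variable [Finite ι] [R.IsRootSystem] [R.IsCrystallographic] [R.IsReduced] {b : R.Base}

theorem rop_mem_invIdeal (a c : k) (i : ι) {f : WeightAlg k R} (hf : f ∈ invIdeal t) :
    rop a c i f ∈ invIdeal t := by
  refine map_mem_of_mem_invIdeal (invIdeal t).toAddSubgroup (rop a c i).toAddMonoidHom
    (fun z hz g => ?_) hf
  change rop a c i (g * _) ∈ invIdeal t
  rw [mul_comm, rop_mul_of_invariant a c (wact_sub_algebraMap hz _ _)]
  exact Ideal.mul_mem_right _ _ (sub_mem_invIdeal hz)

theorem ev_nrm_of_mem_invIdeal (hτ : ∀ z : WeightAlg k R, (∀ w, wact w z = z) → ev τ z = ev t z)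
    {f : WeightAlg k R} (hf : f ∈ invIdeal t) : ev τ (nrm b f) = 0 := by
  have h := map_mem_of_mem_invIdeal (⊥ : AddSubgroup k)
    (((ev τ : WeightAlg k R →ₐ[k] k) : WeightAlg k R →+ k).comp
      (AddMonoidHom.mk' (nrm b) nrm_add)) (fun z hz g => ?_) hf
  · exact AddSubgroup.mem_bot.1 h
  · rw [AddSubgroup.mem_bot]
    change ev τ (nrm b (g * _)) = 0
    rw [mul_comm, nrm_mul_of_invariant (wact_sub_algebraMap hz _), map_mul, map_sub,
      AlgHom.commutes, hτ z hz, Algebra.algebraMap_self, RingHom.id_apply, sub_self, zero_mul]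

variable [R.IsIrreducible] {q v a c : k}

variable (b) in
/-- The point `τ` gives a one-dimensional character of `H` with `T_s ↦ a`, and lies over the same
central character as `t`. -/
structure IsCharPoint (a c : k) (t τ : Multiplicative (weightLattice R) →* kˣ) : Prop where
  simple : ∀ i ∈ b.support, a * ev τ (ex k (-rootWeight R i)) = -c
  invariant : ∀ z : WeightAlg k R, (∀ w, wact w z = z) → ev τ z = ev t z

/-- The coefficients in Steinberg's basis are the invariants `nrm (Q f s_w)`, and by the character
formula their values at `τ` are proportional to `P · f(τ) · s_w(τ)`, which vanishes by `hf`. Both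
the case `f(τ) = 0` and the case `P = 0` are used. -/
theorem qprod_mul_mem_invIdeal (hq : q ≠ 0) (hv : v ^ 2 = q) (h : IsEigenPair q a c)
    (ht : IsCharPoint b a c t τ) {f : WeightAlg k R}
    (hf : (∑ w : R.weylGroup, (-c⁻¹ * a) ^ len b (fin w)) * ev τ f = 0) :
    qprod b a c * f ∈ invIdeal t := by
  obtain ⟨s, hs⟩ := exists_steinberg_expansion b k
  rw [hs (qprod b a c * f)]
  refine Ideal.sum_mem _ fun w _ => Ideal.mul_mem_right _ _ ?_
  refine mem_invIdeal_of_ev_eq_zero (fun u => wact_nrm u _) ?_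
  rw [← ht.invariant _ fun u => wact_nrm u _]
  have h1 := ev_nrm_qprod hq hv h ht.simple (f * s w)
  rw [map_mul, ← mul_assoc _ _ (ev τ (s w)), hf, zero_mul, ← mul_assoc] at h1
  exact (mul_eq_zero.1 h1).resolve_left
    (pow_ne_zero _ (neg_ne_zero.2 (inv_ne_zero (h.swap.ne_zero hq))))

theorem qprod_mul_sub_mem_invIdeal (hq : q ≠ 0) (hv : v ^ 2 = q) (h : IsEigenPair q a c)
    (ht : IsCharPoint b a c t τ) (f : WeightAlg k R) :
    qprod b a c * f - ev τ f • qprod b a c ∈ invIdeal t := by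
  have := qprod_mul_mem_invIdeal hq hv h ht (f := f - algebraMap k _ (ev τ f)) (by
    rw [map_sub, AlgHom.commutes, Algebra.algebraMap_self, RingHom.id_apply, sub_self, mul_zero])
  rwa [mul_sub, mul_comm _ (algebraMap _ _ _), ← Algebra.smul_def] at this

/-- By linearity over invariants `nrm` sends the ideal to functions vanishing at `τ`, whereas `nrm`
of the product takes there a nonzero multiple of the Poincaré sum. -/
theorem qprod_notMem_invIdeal (hq : q ≠ 0) (hv : v ^ 2 = q) (h : IsEigenPair q a c)
    (ht : IsCharPoint b a c t τ) (hP : (∑ w : R.weylGroup, (-c⁻¹ * a) ^ len b (fin w)) ≠ 0) :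
    qprod b a c ∉ invIdeal t := by
  intro hmem
  have h1 := ev_nrm_qprod hq hv h ht.simple 1
  rw [mul_one, ev_nrm_of_mem_invIdeal ht.invariant hmem, mul_zero, map_one, mul_one] at h1
  exact hP h1.symm

/-- Otherwise every coefficient in the Steinberg expansion of `1` would vanish at `t`. -/
theorem exists_ev_nrm_ne_zero (b : R.Base) (t : Multiplicative (weightLattice R) →* kˣ) :
    ∃ f : WeightAlg k R, ev t (nrm b f) ≠ 0 := by
  by_contra! h
  obtain ⟨s, hs⟩ := exists_steinberg_expansion b k
  have h1 := congrArg (ev t) (hs 1)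
  rw [map_one, map_sum, Finset.sum_eq_zero fun w _ => by rw [map_mul, h, zero_mul]] at h1
  exact one_ne_zero h1

end Specialization

/-! ### The quotient by the central character -/

section Quotient

variable {ι V V' : Type*} [AddCommGroup V] [Module ℝ V] [AddCommGroup V'] [Module ℝ V']
  {R : RootPairing ι ℝ V V'} [Finite ι] [R.IsRootSystem] [R.IsCrystallographic] [R.IsReduced]
  [R.IsIrreducible] {b : R.Base} {k : Type*} [Field k] {q v a c : k}
  {t τ τ' : Multiplicative (weightLattice R) →* kˣ}

variable (b q v t) in
/-- The canonical homomorphism `H → H_t`. -/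
def proj : Hecke b k q →ₐ[k] HeckeAt b q v t := RingCon.mkₐ k (centralIdeal b q v t).ringCon

theorem proj_apply (h : Hecke b k q) : proj b q v t h = toHeckeAt b q v t h := rfl

theorem proj_surjective : Function.Surjective (proj b q v t) :=
  RingCon.mkₐ_surjective (α := k) _

theorem proj_eq_zero_iff {h : Hecke b k q} : proj b q v t h = 0 ↔ h ∈ centralIdeal b q v t := by
  rw [TwoSidedIdeal.mem_iff, ← map_zero (proj b q v t)]
  exact RingCon.eq _

theorem ev_ofCoeff (f : weightLattice R →₀ k) : ev t (.ofCoeff f) =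
    f.sum fun x a => a * (t (Multiplicative.ofAdd x) : k) := by
  rw [ev, AddMonoidAlgebra.lift_apply]
  rfl

theorem proj_Theta_of_mem (hq : q ≠ 0) (hv : v ^ 2 = q) {f : WeightAlg k R}
    (hf : f ∈ invIdeal t) : proj b q v t (Theta hq hv b f) = 0 := by
  have hle : invIdeal t ≤ RingHom.ker ((proj b q v t).comp (Theta hq hv b)) := by
    refine Ideal.span_le.2 ?_
    rintro _ ⟨z, hz, rfl⟩
    change proj b q v t (Theta hq hv b _) = 0
    rw [proj_eq_zero_iff]
    refine TwoSidedIdeal.subset_span ⟨z.coeff, ?_, ?_⟩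
    · rw [← Theta_ofCoeff hq hv]
      exact Theta_mem_center hq hv hz
    · rw [← Theta_ofCoeff hq hv, ← ev_ofCoeff, map_sub, AlgHom.commutes]
  exact hle hf

theorem proj_Theta_congr (hq : q ≠ 0) (hv : v ^ 2 = q) {f g : WeightAlg k R}
    (h : f - g ∈ invIdeal t) : proj b q v t (Theta hq hv b f) = proj b q v t (Theta hq hv b g) := by
  have := proj_Theta_of_mem (b := b) hq hv h
  rwa [map_sub, map_sub, sub_eq_zero] at this

theorem proj_Theta_mul_of_invariant (hq : q ≠ 0) (hv : v ^ 2 = q) {z : WeightAlg k R}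
    (hz : ∀ w, wact w z = z) (f : WeightAlg k R) :
    proj b q v t (Theta hq hv b (f * z)) = ev t z • proj b q v t (Theta hq hv b f) := by
  rw [← map_smul, ← map_smul]
  refine proj_Theta_congr hq hv ?_
  rw [Algebra.smul_def, mul_comm f, ← sub_mul]
  exact Ideal.mul_mem_right _ _ (sub_mem_invIdeal hz)

/-- Stability of `I` under the Demazure–Lusztig operators makes `X Θ(I)` stable under right
multiplication by all generators of `H`. The whole algebra `I = ⊤` gives `X H = X Θ`, and the ideal
`invIdeal t` serves to compute `X` times the central ideal. -/
theorem exists_symm_mul_Theta_mul (hq : q ≠ 0) (hv : v ^ 2 = q) (h : IsEigenPair q a c)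
    {I : Submodule (WeightAlg k R) (WeightAlg k R)}
    (hI : ∀ i ∈ b.support, ∀ f ∈ I, rop a c i f ∈ I) (x : Hecke b k q) {f : WeightAlg k R}
    (hf : f ∈ I) : ∃ g ∈ I, symm b q (-c⁻¹) * Theta hq hv b f * x =
      symm b q (-c⁻¹) * Theta hq hv b g := by
  let B : Subalgebra k (Hecke b k q) :=
    { carrier := {x | ∀ f ∈ I, ∃ g ∈ I, symm b q (-c⁻¹) * Theta hq hv b f * x =
        symm b q (-c⁻¹) * Theta hq hv b g}
      mul_mem' := by
        intro x y hx hy f hf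
        obtain ⟨g, hg, h1⟩ := hx f hf
        obtain ⟨g', hg', h2⟩ := hy g hg
        exact ⟨g', hg', by rw [← mul_assoc, h1, h2]⟩
      add_mem' := by
        intro x y hx hy f hf
        obtain ⟨g, hg, h1⟩ := hx f hf
        obtain ⟨g', hg', h2⟩ := hy f hf
        exact ⟨g + g', add_mem hg hg', by rw [mul_add, h1, h2, map_add, mul_add]⟩
      algebraMap_mem' := by
        intro r f hf
        refine ⟨algebraMap k _ r * f, I.smul_mem _ hf, ?_⟩
        rw [map_mul, AlgHom.commutes, mul_assoc, Algebra.commutes r] }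
  refine mem_of_generators hq hv (B := B) (fun i hi f hf => ?_) (fun e f hf => ?_) x f hf
  · exact ⟨_, hI i hi f hf, symm_mul_Theta_mul_T hq hv h hi f⟩
  · refine ⟨e * f, I.smul_mem _ hf, ?_⟩
    rw [mul_comm, map_mul, mul_assoc]

theorem exists_symm_mul (hq : q ≠ 0) (hv : v ^ 2 = q) (h : IsEigenPair q a c) (x : Hecke b k q) :
    ∃ g, symm b q (-c⁻¹) * x = symm b q (-c⁻¹) * Theta hq hv b g := by
  obtain ⟨g, -, hg⟩ := exists_symm_mul_Theta_mul hq hv h (I := ⊤)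
    (fun _ _ _ _ => Submodule.mem_top) x (f := 1) Submodule.mem_top
  exact ⟨g, by rwa [map_one, mul_one] at hg⟩

theorem exists_symm_mul_Theta_sub (hq : q ≠ 0) (hv : v ^ 2 = q) (h : IsEigenPair q a c)
    {f : WeightAlg k R} (hf : Theta hq hv b f ∈ Subalgebra.center k (Hecke b k q))
    (r : Hecke b k q) : ∃ g ∈ invIdeal t,
      symm b q (-c⁻¹) * (r * (Theta hq hv b f - algebraMap k _ (ev t f))) =
        symm b q (-c⁻¹) * Theta hq hv b g := by
  obtain ⟨g, hg⟩ := exists_symm_mul hq hv h r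
  have hinv := wact_eq_of_mem_center hq hv hf
  refine ⟨g * (f - algebraMap k _ (ev t f)),
    Ideal.mul_mem_left _ _ (sub_mem_invIdeal hinv), ?_⟩
  rw [map_mul, map_sub, AlgHom.commutes, ← mul_assoc, ← mul_assoc, hg]

/-- Right multiplication by the central ideal maps `X H` to `X Θ(I)`. -/
theorem exists_symm_mul_of_mem_centralIdeal (hq : q ≠ 0) (hv : v ^ 2 = q) (h : IsEigenPair q a c)
    {x : Hecke b k q} (hx : x ∈ centralIdeal b q v t) :
    ∃ g ∈ invIdeal t, symm b q (-c⁻¹) * x = symm b q (-c⁻¹) * Theta hq hv b g := by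
  -- The arbitrary factor `r` makes this set a left ideal, and the stability of `invIdeal t` under
  -- the operators makes it a right ideal. It then suffices to check the generators of the central
  -- ideal.
  let U : TwoSidedIdeal (Hecke b k q) := TwoSidedIdeal.mk'
    {x | ∀ r, ∃ g ∈ invIdeal t, symm b q (-c⁻¹) * (r * x) = symm b q (-c⁻¹) * Theta hq hv b g}
    (fun r => ⟨0, zero_mem _, by rw [map_zero, mul_zero]⟩)
    (by
      intro x y hx hy r
      obtain ⟨g, hg, h1⟩ := hx r
      obtain ⟨g', hg', h2⟩ := hy r
      exact ⟨g + g', add_mem hg hg', by rw [mul_add, mul_add, h1, h2, map_add, mul_add]⟩)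
    (by
      intro x hx r
      obtain ⟨g, hg, h1⟩ := hx (r * (-1))
      have e : r * -x = r * (-1) * x := by
        rw [mul_assoc]
        exact congrArg (fun y => r * y) (neg_one_mul x).symm
      exact ⟨g, hg, (congrArg (fun y => symm b q (-c⁻¹) * y) e).trans h1⟩)
    (by
      intro y x hx r
      obtain ⟨g, hg, h1⟩ := hx (r * y)
      exact ⟨g, hg, by rw [← h1, mul_assoc]⟩)
    (by
      intro x y hx r
      obtain ⟨g, hg, h1⟩ := hx r
      obtain ⟨g', hg', h2⟩ := exists_symm_mul_Theta_mul hq hv h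
        (fun i _ f hf => rop_mem_invIdeal a c i hf) y hg
      exact ⟨g', hg', by rw [← h2, ← h1, mul_assoc, mul_assoc]⟩)
  have hle : centralIdeal b q v t ≤ U := by
    refine TwoSidedIdeal.span_le.2 ?_
    rintro _ ⟨f, hf, rfl⟩
    change _ ∈ U
    rw [TwoSidedIdeal.mem_mk']
    intro r
    rw [← Theta_ofCoeff hq hv] at hf ⊢
    rw [← ev_ofCoeff]
    exact exists_symm_mul_Theta_sub hq hv h hf r
  have h1 := (TwoSidedIdeal.mem_mk' _ _ _ _ _ _ _).1 (hle hx) 1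
  rwa [one_mul] at h1

end Quotient

/-! ### Characters from common eigenvectors -/

section Algebra

variable {k A M : Type*} [Field k] [Ring A] [Algebra k A] [Ring M] [Algebra k M]

/-- A vector on which all elements act by scalars defines a character. -/
theorem exists_char_left (π : A →ₐ[k] M) {x : M} (hx : x ≠ 0)
    (h : ∀ a, ∃ r : k, π a * x = r • x) : ∃ χ : A →ₐ[k] k, ∀ a, π a * x = χ a • x := by
  choose r hr using h
  have hinj : Function.Injective fun s : k => s • x := smul_left_injective k hx
  refine ⟨AlgHom.ofLinearMap
    { toFun := r
      map_add' := fun a a' => hinj ?_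
      map_smul' := fun s a => hinj ?_ } (hinj ?_) (fun a a' => hinj ?_), hr⟩
  · simp only [add_smul, ← hr, map_add, add_mul]
  · simp only [RingHom.id_apply, smul_eq_mul, mul_smul, ← hr, map_smul, smul_mul_assoc]
  · change r 1 • x = (1 : k) • x
    rw [← hr, map_one, one_mul, one_smul]
  · change r (a * a') • x = (r a * r a') • x
    rw [← hr, map_mul, mul_assoc, hr, mul_smul_comm, hr, smul_smul, mul_comm]

theorem exists_char_right (π : A →ₐ[k] M) {x : M} (hx : x ≠ 0)
    (h : ∀ a, ∃ r : k, x * π a = r • x) : ∃ χ : A →ₐ[k] k, ∀ a, x * π a = χ a • x := by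
  choose r hr using h
  have hinj : Function.Injective fun s : k => s • x := smul_left_injective k hx
  refine ⟨AlgHom.ofLinearMap
    { toFun := r
      map_add' := fun a a' => hinj ?_
      map_smul' := fun s a => hinj ?_ } (hinj ?_) (fun a a' => hinj ?_), hr⟩
  · simp only [add_smul, ← hr, map_add, mul_add]
  · simp only [RingHom.id_apply, smul_eq_mul, mul_smul, ← hr, map_smul, mul_smul_comm]
  · change r 1 • x = (1 : k) • x
    rw [← hr, map_one, mul_one, one_smul]
  · change r (a * a') • x = (r a * r a') • x
    rw [← hr, map_mul, ← mul_assoc, hr, smul_mul_assoc, hr, smul_smul]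

theorem smul_left_cancel_of_ne_zero {x : M} (hx : x ≠ 0) {r s : k} (h : r • x = s • x) : r = s :=
  smul_left_injective k hx h

theorem sandwich_smul_smul {r s : k} (hr : r ≠ 0) (hs : s ≠ 0) (x y : M) :
    sandwich k (r • x) (s • y) = sandwich k x y := by
  apply le_antisymm
  · rintro _ ⟨m, rfl⟩
    refine ⟨(r * s) • m, ?_⟩
    simp only [LinearMap.mulLeftRight_apply, smul_mul_assoc, mul_smul_comm, smul_smul]
    rw [mul_comm]
  · rintro _ ⟨m, rfl⟩
    refine ⟨(r * s)⁻¹ • m, ?_⟩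
    simp only [LinearMap.mulLeftRight_apply, smul_mul_assoc, mul_smul_comm, smul_smul]
    rw [show s * ((r * s)⁻¹ * r) = 1 by field_simp, one_smul]

end Algebra

/-! ### The special points and the values of the characters -/

section Characters

variable {ι V V' : Type*} [AddCommGroup V] [Module ℝ V] [AddCommGroup V'] [Module ℝ V']
  {R : RootPairing ι ℝ V V'} [Finite ι] [R.IsRootSystem] [R.IsCrystallographic] [R.IsReduced]
  {b : R.Base} {k : Type*} [Field k] {q v a c : k}
  {t τ τ' : Multiplicative (weightLattice R) →* kˣ}

theorem ev_ex_rootWeight {j : ι} (hj : b.IsPos j) {r : k}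
    (h : ∀ i ∈ b.support, ev t (ex k (rootWeight R i)) = r) :
    ev t (ex k (rootWeight R j)) = r ^ (b.height j).toNat := by
  obtain ⟨f, hf, hsum⟩ := exists_root_sum_nonneg b hj
  rw [b.height_eq_sum hsum, rootWeight_eq_sum hsum, ex_sum, map_prod]
  have e : (∑ l ∈ b.support, f l).toNat = ∑ l ∈ b.support, (f l).toNat := by
    have : ∑ l ∈ b.support, f l = ((∑ l ∈ b.support, (f l).toNat : ℕ) : ℤ) := by
      push_cast
      exact Finset.sum_congr rfl fun l _ => (Int.toNat_of_nonneg (hf l)).symm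
    rw [this, Int.toNat_natCast]
  rw [e, ← Finset.prod_pow_eq_pow_sum]
  refine Finset.prod_congr rfl fun l hl => ?_
  obtain ⟨n, hn⟩ := Int.eq_ofNat_of_zero_le (hf l)
  rw [hn, Int.toNat_natCast, natCast_zsmul, ex_nsmul, map_pow, h l hl]

theorem ev_ex_neg (x : weightLattice R) : ev t (ex k (-x)) = (ev t (ex k x))⁻¹ := by
  have h := congrArg (ev t) (ex_neg_mul (k := k) x)
  rw [map_mul, map_one] at h
  exact eq_inv_of_mul_eq_one_left h

/-- The translate of a point of the torus by the longest element. -/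
def longestTwist (b : R.Base) (t : Multiplicative (weightLattice R) →* kˣ) :
    Multiplicative (weightLattice R) →* kˣ :=
  t.comp (weylAction R (longest b)).toMonoidHom

theorem ev_longestTwist (f : WeightAlg k R) :
    ev (longestTwist b t) f = ev t (wact (longest b) f) := by
  induction f using weightAlg_induction with
  | hex x => rw [wact_ex, ev_ex, ev_ex]; rfl
  | hadd f g hf hg => rw [map_add, map_add, map_add, hf, hg]
  | hsmul r f hf => rw [map_smul, map_smul, map_smul, hf]

variable (hq : q ≠ 0) (ht : ∀ i ∈ b.support, ev t (ex k (rootWeight R i)) = q)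
include hq ht

theorem isCharPoint_self : IsCharPoint b q (-1) t t where
  simple i hi := by rw [ev_ex_neg, ht i hi, mul_inv_cancel₀ hq, neg_neg]
  invariant _ _ := rfl

/-- The longest element sends simple roots to negatives of simple roots, so the simple roots take
the value `q⁻¹` at `w₀ t`, as the pair `(-1, q)` requires. Invariants do not see the twist. -/
theorem isCharPoint_longestTwist : IsCharPoint b (-1) q t (longestTwist b t) where
  simple i hi := by
    have h1 : b.height (opp R (longest b • i)) = 1 := by
      rw [show b.height (opp R (longest b • i)) = _ from b.height_reflectionPerm_self _,
        height_longest_smul hi, neg_neg]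
    have h2 : b.IsPos (opp R (longest b • i)) := by
      rw [b.isPos_iff, h1]; exact one_pos
    rw [ev_longestTwist, wact_ex, smul_neg, smul_rootWeight, ← rootWeight_opp,
      ev_ex_rootWeight h2 ht, h1, Int.toNat_one, pow_one, neg_one_mul]
  invariant z hz := by rw [ev_longestTwist, hz]

omit hq ht

/-- The substitution `w ↦ w₀ w` and `l(w₀ w) = l(w₀) - l(w)` give `P(r) = r^{l(w₀)} P(r⁻¹)`. -/
theorem sum_pow_len_eq_zero_iff {r s : k} (hrs : r * s = 1) :
    ∑ w : R.weylGroup, r ^ len b (fin w) = 0 ↔ ∑ w : R.weylGroup, s ^ len b (fin w) = 0 := by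
  have key : ∑ w : R.weylGroup, r ^ len b (fin w) =
      r ^ len b (fin (longest b)) * ∑ w : R.weylGroup, s ^ len b (fin w) := by
    rw [Finset.mul_sum]
    refine Fintype.sum_equiv (Equiv.mulLeft (longest b)) _ _ fun w => ?_
    have h1 : longest b * (longest b * w) = w := by
      rw [← mul_assoc, mul_eq_one_iff_eq_inv.2 longest_inv.symm, one_mul]
    have h2 : r ^ len b (fin (longest b * w)) * s ^ len b (fin (longest b * w)) = 1 := by
      rw [← mul_pow, hrs, one_pow]
    rw [Equiv.coe_mulLeft, ← len_longest_mul (longest b * w), h1, pow_add, mul_assoc, h2, mul_one]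
  rw [key, mul_eq_zero, or_iff_right]
  exact pow_ne_zero _ (left_ne_zero_of_mul_eq_one hrs)

variable [R.IsIrreducible]

theorem char_T_fin {χ : Hecke b k q →ₐ[k] k} (h : ∀ i ∈ b.support, χ (T b k q (fin (σ R i))) = a)
    (w : R.weylGroup) : χ (T b k q (fin w)) = a ^ len b (fin w) := by
  induction w using len_induction (b := b) with
  | one => rw [fin_one, T_one, map_one, len_one, pow_zero]
  | mul i hi u hu ih => rw [← T_refl_mul q hi hu, map_mul, h i hi, ih, len_refl_mul hi hu, pow_succ']

/-- For the affine reflection use `T_{s₀} T_{σ_β} = T_β`. With `n` the height of `β`, `l(β) = 2n`,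
and `T_β = q^n θ_β` acts by `q^n (-a/c)^n = a^{2n}`, since `q = -a c`. As `σ_β` has length `2n - 1`,
the value `a` remains for `T_{s₀}`. -/
theorem char_T_simpleReflection (hq : q ≠ 0) (hv : v ^ 2 = q) (h : IsEigenPair q a c)
    (hτ : ∀ i ∈ b.support, a * ev τ (ex k (-rootWeight R i)) = -c) {χ : Hecke b k q →ₐ[k] k}
    (h1 : ∀ i ∈ b.support, χ (T b k q (fin (σ R i))) = a)
    (h2 : ∀ f, χ (Theta hq hv b f) = ev τ f) {s : ExtAffineWeyl R}
    (hs : s ∈ simpleReflections b) : χ (T b k q s) = a := by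
  have ha := h.ne_zero hq
  have hc := h.swap.ne_zero hq
  rcases hs with ⟨i, hi, rfl⟩ | ⟨β, hβ, rfl⟩
  · exact h1 i hi
  set s := transl (rootWeight R β) * fin (σ R β) with hs
  have hlen := hβ.len_mul
  rw [← hs] at hlen
  have hls : len b s = 1 := by
    rw [hs, ← aref_opp_one]
    exact len_aref (Or.inr ⟨β, hβ, rfl⟩)
  have hmul : s * fin (σ R β) = transl (rootWeight R β) := by
    rw [hs, mul_assoc, ← fin_mul, refl_mul_self, fin_one, mul_one]
  have hT : T b k q s * T b k q (fin (σ R β)) = T b k q (transl (rootWeight R β)) := by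
    rw [T_mul q (by rw [hmul, ← hlen]), hmul]
  have hval : ∀ i ∈ b.support, ev τ (ex k (rootWeight R i)) = -(a * c⁻¹) := by
    intro i hi
    have := hτ i hi
    rw [ev_ex_neg] at this
    have h3 : ev τ (ex k (rootWeight R i)) ≠ 0 := by rw [ev_ex]; exact Units.ne_zero _
    field_simp at this ⊢
    linear_combination this
  have hth := h2 (ex k (rootWeight R β))
  rw [Theta_ex, theta_of_isDominant hq hv hβ.isDominant, normT, map_smul, smul_eq_mul,
    ev_ex_rootWeight hβ.isPos hval, ← hT, map_mul, char_T_fin h1] at hth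
  have hxi := len_transl (b := b) hβ.isDominant
  rw [xi_rootWeight] at hxi
  have hpos : 0 < b.height β := hβ.isPos
  obtain ⟨n, hn⟩ := Int.eq_ofNat_of_zero_le hpos.le
  rw [hn] at hxi hth
  have h5 : len b (transl (rootWeight R β)) = 2 * n := by exact_mod_cast hxi
  have h6 : len b (fin (σ R β)) + 1 = 2 * n := by omega
  have hv0 := root_ne_zero hq hv
  rw [Int.toNat_natCast, h5, pow_mul, inv_pow, hv] at hth
  have h7 : χ (T b k q s) * a ^ len b (fin (σ R β)) = a * a ^ len b (fin (σ R β)) := by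
    rw [← pow_succ', h6, pow_mul]
    have h8 : q ^ n * (-(a * c⁻¹)) ^ n = (a ^ 2) ^ n := by
      rw [← mul_pow]
      congr 1
      have := h.mul
      field_simp
      linear_combination -this
    rw [← h8, ← hth, inv_pow, ← mul_assoc, mul_inv_cancel₀ (pow_ne_zero _ hq), one_mul]
  exact mul_right_cancel₀ (pow_ne_zero _ ha) h7

end Characters

/-! ### The line `X H_t X'` -/

section Main

variable {ι V V' : Type*} [AddCommGroup V] [Module ℝ V] [AddCommGroup V'] [Module ℝ V']
  {R : RootPairing ι ℝ V V'} [Finite ι] [R.IsRootSystem] [R.IsCrystallographic] [R.IsReduced]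
  [R.IsIrreducible] {b : R.Base} {k : Type*} [Field k] {q v a c : k}
  {t τ τ' : Multiplicative (weightLattice R) →* kˣ}
  (hq : q ≠ 0) (hv : v ^ 2 = q)

variable (b a c t) in
/-- The generator `X Θ(Q)` of `X H_t X'`, for the symmetrizers `X`, `X'` with eigenvalues `a`,
`c`. -/
def sandwichGen : HeckeAt b q v t :=
  proj b q v t (symm b q (-c⁻¹) * Theta hq hv b (qprod b c a))

variable (b a c t) in
/-- The generator `Θ(Q') X'` of `X H_t X'`. -/
def sandwichGenLeft : HeckeAt b q v t :=
  proj b q v t (Theta hq hv b (qprod b a c) * symm b q (-a⁻¹))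

variable (h : IsEigenPair q a c)
include h

theorem proj_sandwich_right (f : WeightAlg k R) :
    proj b q v t (symm b q (-c⁻¹) * Theta hq hv b f * symm b q (-a⁻¹)) =
      ((-a⁻¹) ^ len b (fin (longest b)) * ev t (nrm b f)) • sandwichGen b a c t hq hv := by
  rw [sandwich_right hq hv h, map_smul, map_mul,
    proj_Theta_mul_of_invariant hq hv fun w => wact_nrm w f, mul_smul_comm, ← map_mul, smul_smul, sandwichGen]

theorem proj_sandwich_left (f : WeightAlg k R) :
    proj b q v t (symm b q (-c⁻¹) * Theta hq hv b f * symm b q (-a⁻¹)) =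
      ((-c⁻¹) ^ len b (fin (longest b)) * ev t (nrm b f)) • sandwichGenLeft b a c t hq hv := by
  rw [sandwich_left hq hv h, map_smul, map_mul,
    proj_Theta_mul_of_invariant hq hv fun w => wact_nrm w f, smul_mul_assoc, ← map_mul, smul_smul, sandwichGenLeft]

theorem sandwich_eq_span :
    sandwich k (proj b q v t (symm b q (-c⁻¹))) (proj b q v t (symm b q (-a⁻¹))) =
      Submodule.span k {sandwichGen b a c t hq hv} := by
  apply le_antisymm
  · rintro _ ⟨m, rfl⟩
    obtain ⟨x, rfl⟩ := proj_surjective m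
    obtain ⟨g, hg⟩ := exists_symm_mul hq hv h x
    rw [LinearMap.mulLeftRight_apply, ← map_mul, ← map_mul, hg, proj_sandwich_right hq hv h]
    exact Submodule.smul_mem _ _ (Submodule.mem_span_singleton_self _)
  · rw [Submodule.span_singleton_le_iff_mem]
    obtain ⟨f, hf⟩ := exists_ev_nrm_ne_zero b t
    have hr : (-a⁻¹) ^ len b (fin (longest b)) * ev t (nrm b f) ≠ 0 :=
      mul_ne_zero (pow_ne_zero _ (neg_ne_zero.2 (inv_ne_zero (h.ne_zero hq)))) hf
    refine ⟨((-a⁻¹) ^ len b (fin (longest b)) * ev t (nrm b f))⁻¹ •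
      proj b q v t (Theta hq hv b f), ?_⟩
    rw [map_smul, LinearMap.mulLeftRight_apply, ← map_mul, ← map_mul, proj_sandwich_right hq hv h,
      smul_smul, inv_mul_cancel₀ hr, one_smul]

/-- The same element `X Θ(f) X'` is evaluated from both sides, for an `f` whose scalar is nonzero.
This gives access to the action on the side where the first shape says nothing. -/
theorem exists_sandwichGen_eq_smul : ∃ r : k,
    sandwichGen b a c t hq hv = r • sandwichGenLeft b a c t hq hv := by
  obtain ⟨f, hf⟩ := exists_ev_nrm_ne_zero b t
  have hr : (-a⁻¹) ^ len b (fin (longest b)) * ev t (nrm b f) ≠ 0 :=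
    mul_ne_zero (pow_ne_zero _ (neg_ne_zero.2 (inv_ne_zero (h.ne_zero hq)))) hf
  have h1 := proj_sandwich_right (b := b) (t := t) hq hv h f
  rw [proj_sandwich_left hq hv h] at h1
  refine ⟨((-a⁻¹) ^ len b (fin (longest b)) * ev t (nrm b f))⁻¹ *
    ((-c⁻¹) ^ len b (fin (longest b)) * ev t (nrm b f)), ?_⟩
  rw [mul_smul, h1, smul_smul, inv_mul_cancel₀ hr, one_smul]

theorem proj_T_mul_sandwichGen {i : ι} (hi : i ∈ b.support) :
    proj b q v t (T b k q (fin (σ R i))) * sandwichGen b a c t hq hv =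
      a • sandwichGen b a c t hq hv := by
  rw [sandwichGen, ← map_mul, ← mul_assoc, T_refl_mul_symm h.add h.mul (h.neg_inv_mul hq) hi,
    smul_mul_assoc, map_smul]

theorem sandwichGen_mul_proj_T {i : ι} (hi : i ∈ b.support) :
    sandwichGen b a c t hq hv * proj b q v t (T b k q (fin (σ R i))) =
      c • sandwichGen b a c t hq hv := by
  obtain ⟨r, hr⟩ := exists_sandwichGen_eq_smul (b := b) (t := t) hq hv h
  rw [hr, sandwichGenLeft, smul_mul_assoc, ← map_mul, mul_assoc,
    symm_mul_T_refl h.swap.add h.swap.mul (h.swap.neg_inv_mul hq) hi, mul_smul_comm, map_smul,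
    smul_comm]

theorem sandwichGen_mul_proj_Theta (hτ' : IsCharPoint b c a t τ') (f : WeightAlg k R) :
    sandwichGen b a c t hq hv * proj b q v t (Theta hq hv b f) =
      ev τ' f • sandwichGen b a c t hq hv := by
  rw [sandwichGen, ← map_mul, mul_assoc, ← map_mul, map_mul (proj b q v t),
    proj_Theta_congr hq hv (qprod_mul_sub_mem_invIdeal hq hv h.swap hτ' f), map_smul, map_smul,
    mul_smul_comm, ← map_mul]

theorem proj_Theta_mul_sandwichGen (hτ : IsCharPoint b a c t τ) (f : WeightAlg k R) :
    proj b q v t (Theta hq hv b f) * sandwichGen b a c t hq hv =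
      ev τ f • sandwichGen b a c t hq hv := by
  obtain ⟨r, hr⟩ := exists_sandwichGen_eq_smul (b := b) (t := t) hq hv h
  rw [hr, sandwichGenLeft, mul_smul_comm, ← map_mul, ← mul_assoc, ← map_mul, mul_comm f,
    map_mul (proj b q v t), proj_Theta_congr hq hv (qprod_mul_sub_mem_invIdeal hq hv h hτ f),
    map_smul, map_smul, smul_mul_assoc, ← map_mul, smul_comm]

theorem exists_proj_mul_sandwichGen (hτ : IsCharPoint b a c t τ) (x : Hecke b k q) :
    ∃ r : k, proj b q v t x * sandwichGen b a c t hq hv = r • sandwichGen b a c t hq hv := by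
  let B : Subalgebra k (Hecke b k q) :=
    { carrier := {x | ∃ r : k, proj b q v t x * sandwichGen b a c t hq hv =
        r • sandwichGen b a c t hq hv}
      mul_mem' := by
        rintro x y ⟨r, hr⟩ ⟨s, hs⟩
        exact ⟨s * r, by rw [map_mul, mul_assoc, hs, mul_smul_comm, hr, smul_smul]⟩
      add_mem' := by
        rintro x y ⟨r, hr⟩ ⟨s, hs⟩
        exact ⟨r + s, by rw [map_add, add_mul, hr, hs, add_smul]⟩
      algebraMap_mem' := fun r => ⟨r, by rw [AlgHom.commutes, Algebra.smul_def]⟩ }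
  exact mem_of_generators hq hv (B := B) (fun i hi => ⟨a, proj_T_mul_sandwichGen hq hv h hi⟩)
    (fun f => ⟨_, proj_Theta_mul_sandwichGen hq hv h hτ f⟩) x

theorem exists_sandwichGen_mul_proj (hτ' : IsCharPoint b c a t τ') (x : Hecke b k q) :
    ∃ r : k, sandwichGen b a c t hq hv * proj b q v t x = r • sandwichGen b a c t hq hv := by
  let B : Subalgebra k (Hecke b k q) :=
    { carrier := {x | ∃ r : k, sandwichGen b a c t hq hv * proj b q v t x =
        r • sandwichGen b a c t hq hv}
      mul_mem' := by
        rintro x y ⟨r, hr⟩ ⟨s, hs⟩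
        exact ⟨r * s, by rw [map_mul, ← mul_assoc, hr, smul_mul_assoc, hs, smul_smul]⟩
      add_mem' := by
        rintro x y ⟨r, hr⟩ ⟨s, hs⟩
        exact ⟨r + s, by rw [map_add, mul_add, hr, hs, add_smul]⟩
      algebraMap_mem' := fun r =>
        ⟨r, by rw [AlgHom.commutes, ← Algebra.commutes, Algebra.smul_def]⟩ }
  exact mem_of_generators hq hv (B := B) (fun i hi => ⟨c, sandwichGen_mul_proj_T hq hv h hi⟩)
    (fun f => ⟨_, sandwichGen_mul_proj_Theta hq hv h hτ' f⟩) x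

/-- If `X Θ(Q)` lay in the central ideal, then `X · X Θ(Q) = P · X Θ(Q)` would be of the form `X
Θ(g)` with `g` in `invIdeal t`. Injectivity and `P ≠ 0` would put `Q` into that ideal. -/
theorem sandwichGen_ne_zero (hτ' : IsCharPoint b c a t τ')
    (hP : (∑ w : R.weylGroup, (-c⁻¹ * a) ^ len b (fin w)) ≠ 0) :
    sandwichGen b a c t hq hv ≠ 0 := by
  intro h0
  rw [sandwichGen, proj_eq_zero_iff] at h0
  obtain ⟨g, hg, hg2⟩ := exists_symm_mul_of_mem_centralIdeal hq hv h h0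
  rw [← mul_assoc, symm_mul_symm h.add h.mul (h.neg_inv_mul hq), smul_mul_assoc, ← mul_smul_comm,
    ← map_smul] at hg2
  have h1 := symm_mul_Theta_cancel hq hv _ hg2
  rw [← h1, Algebra.smul_def] at hg
  have h2 := Ideal.mul_mem_left _ (algebraMap k _
    (∑ w : R.weylGroup, (-c⁻¹ * a) ^ len b (fin w))⁻¹) hg
  rw [← mul_assoc, ← map_mul, inv_mul_cancel₀ hP, map_one, one_mul] at h2
  refine qprod_notMem_invIdeal hq hv h.swap hτ' (fun h3 => hP ?_) h2
  have ha := h.ne_zero hq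
  have hc := h.swap.ne_zero hq
  exact (sum_pow_len_eq_zero_iff (by field_simp)).1 h3

include hq hv

/-- When the Poincaré sum vanishes, `Q` itself lies in `invIdeal t`, so the generator `X Θ(Q)` is
zero in `H_t`. -/
theorem sandwich_eq_bot (hτ' : IsCharPoint b c a t τ')
    (hP : (∑ w : R.weylGroup, (-c⁻¹ * a) ^ len b (fin w)) = 0) :
    sandwich k (proj b q v t (symm b q (-c⁻¹))) (proj b q v t (symm b q (-a⁻¹))) = ⊥ := by
  have ha := h.ne_zero hq
  have hc := h.swap.ne_zero hq
  have h1 := qprod_mul_mem_invIdeal hq hv h.swap hτ' (f := 1) (by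
    rw [(sum_pow_len_eq_zero_iff (by field_simp)).1 hP, zero_mul])
  rw [mul_one] at h1
  rw [sandwich_eq_span hq hv h, sandwichGen, map_mul, proj_Theta_of_mem hq hv h1, mul_zero,
    Submodule.span_zero_singleton]

theorem sandwich_oneDimensional (hτ : IsCharPoint b a c t τ) (hτ' : IsCharPoint b c a t τ')
    (hP : (∑ w : R.weylGroup, (-c⁻¹ * a) ^ len b (fin w)) ≠ 0) {S : Submodule k (HeckeAt b q v t)}
    (hS : S = sandwich k (proj b q v t (symm b q (-c⁻¹))) (proj b q v t (symm b q (-a⁻¹)))) :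
    IsTwoSidedIdeal S ∧ Module.finrank k S = 1 ∧ ∃ χ χ' : Hecke b k q →ₐ[k] k,
      (∀ s ∈ simpleReflections b, χ (T b k q s) = a ∧ χ' (T b k q s) = c) ∧
      ∀ h, ∀ x ∈ S, toHeckeAt b q v t h * x = χ h • x ∧ x * toHeckeAt b q v t h = χ' h • x := by
  rw [sandwich_eq_span hq hv h] at hS
  have hne := sandwichGen_ne_zero (b := b) hq hv h hτ' hP
  obtain ⟨χ, hχ⟩ := exists_char_left (proj b q v t) hne (exists_proj_mul_sandwichGen hq hv h hτ)
  obtain ⟨χ', hχ'⟩ := exists_char_right (proj b q v t) hne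
    (exists_sandwichGen_mul_proj hq hv h hτ')
  have hact : ∀ h, ∀ x ∈ S,
      toHeckeAt b q v t h * x = χ h • x ∧ x * toHeckeAt b q v t h = χ' h • x := by
    intro y x hx
    rw [hS, Submodule.mem_span_singleton] at hx
    obtain ⟨r, rfl⟩ := hx
    rw [← proj_apply, mul_smul_comm, smul_mul_assoc, hχ, hχ', smul_comm, smul_comm r]
    exact ⟨rfl, rfl⟩
  refine ⟨fun m x hx => ?_, ?_, χ, χ', fun s hs => ⟨?_, ?_⟩, hact⟩
  · obtain ⟨y, rfl⟩ := proj_surjective m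
    rw [proj_apply, (hact y x hx).1, (hact y x hx).2]
    exact ⟨S.smul_mem _ hx, S.smul_mem _ hx⟩
  · rw [hS]; exact finrank_span_singleton hne
  · refine char_T_simpleReflection hq hv h hτ.simple (fun i hi => ?_) (fun f => ?_) hs
    · exact smul_left_cancel_of_ne_zero hne
        ((hχ _).symm.trans (proj_T_mul_sandwichGen hq hv h hi))
    · exact smul_left_cancel_of_ne_zero hne
        ((hχ _).symm.trans (proj_Theta_mul_sandwichGen hq hv h hτ f))
  · refine char_T_simpleReflection hq hv h.swap hτ'.simple (fun i hi => ?_) (fun f => ?_) hs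
    · exact smul_left_cancel_of_ne_zero hne
        ((hχ' _).symm.trans (sandwichGen_mul_proj_T hq hv h hi))
    · exact smul_left_cancel_of_ne_zero hne
        ((hχ' _).symm.trans (sandwichGen_mul_proj_Theta hq hv h hτ' f))

end Main

end

end AffineHecke

/-! ### The theorem -/

open AffineHecke in
theorem theorem3p5 {ι V V' : Type*} [Finite ι] [AddCommGroup V] [Module ℝ V] [AddCommGroup V']
    [Module ℝ V'] (R : RootPairing ι ℝ V V') [R.IsRootSystem] [R.IsCrystallographic]
    [R.IsReduced] [R.IsIrreducible] (b : R.Base)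
    {k : Type*} [Field k] [IsAlgClosed k] (q v : k) (hq : q ≠ 0) (hv : v ^ 2 = q)
    (t : Multiplicative (weightLattice R) →* kˣ)
    (ht : ∀ i ∈ b.support, (t (Multiplicative.ofAdd (rootWeight R i)) : k) = q) :
    let c : HeckeAt b q v t := toHeckeAt b q v t (C b q v (fin (longest b)))
    let c' : HeckeAt b q v t := toHeckeAt b q v t (C' b q v (fin (longest b)))
    ((∑ w : R.weylGroup, q ^ len b (fin w)) ≠ 0 →
      (IsTwoSidedIdeal (sandwich k c c') ∧ Module.finrank k (sandwich k c c') = 1 ∧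
        ∃ χ χ' : Hecke b k q →ₐ[k] k,
          (∀ s ∈ simpleReflections b, χ (T b k q s) = q ∧ χ' (T b k q s) = -1) ∧
          ∀ h, ∀ x ∈ sandwich k c c',
            toHeckeAt b q v t h * x = χ h • x ∧ x * toHeckeAt b q v t h = χ' h • x) ∧
      (IsTwoSidedIdeal (sandwich k c' c) ∧ Module.finrank k (sandwich k c' c) = 1 ∧
        ∃ χ χ' : Hecke b k q →ₐ[k] k,
          (∀ s ∈ simpleReflections b, χ (T b k q s) = -1 ∧ χ' (T b k q s) = q) ∧
          ∀ h, ∀ x ∈ sandwich k c' c,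
            toHeckeAt b q v t h * x = χ h • x ∧ x * toHeckeAt b q v t h = χ' h • x)) ∧
    ((∑ w : R.weylGroup, q ^ len b (fin w)) = 0 → sandwich k c c' = ⊥) := by
  intro c c'
  have hv0 : v ≠ 0 := root_ne_zero hq hv
  have hself : IsEigenPair q q (-1) := isEigenPair_self
  have ht' : ∀ i ∈ b.support, ev t (ex k (rootWeight R i)) = q := fun i hi => by
    rw [ev_ex, ht i hi]
  have hτ := isCharPoint_self hq ht'
  -- The special points for the eigenvalue pairs `(q, -1)` and `(-1, q)` are `t` and `w₀ t`.
  -- Swapping the pairs and the points gives the statement for `C' H_t C`.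
  have hτ' := isCharPoint_longestTwist hq ht'
  have hr : v⁻¹ ^ len b (fin (longest b)) ≠ 0 := pow_ne_zero _ (inv_ne_zero hv0)
  have hs : v ^ len b (fin (longest b)) * (-1) ^ len b (fin (longest b)) ≠ 0 :=
    mul_ne_zero (pow_ne_zero _ hv0) (pow_ne_zero _ (neg_ne_zero.2 one_ne_zero))
  have h1 : -(-1 : k)⁻¹ = 1 := by rw [inv_neg, inv_one, neg_neg]
  have hc : c = v⁻¹ ^ len b (fin (longest b)) • proj b q v t (symm b q (-(-1)⁻¹)) := by
    rw [h1, ← map_smul, ← C_longest]; rfl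
  have hc' : c' = (v ^ len b (fin (longest b)) * (-1) ^ len b (fin (longest b))) •
      proj b q v t (symm b q (-q⁻¹)) := by
    rw [← map_smul, ← C'_longest]; rfl
  have hS : sandwich k c c' =
      sandwich k (proj b q v t (symm b q (-(-1)⁻¹))) (proj b q v t (symm b q (-q⁻¹))) := by
    rw [hc, hc', sandwich_smul_smul hr hs]
  have hS' : sandwich k c' c =
      sandwich k (proj b q v t (symm b q (-q⁻¹))) (proj b q v t (symm b q (-(-1)⁻¹))) := by
    rw [hc, hc', sandwich_smul_smul hs hr]
  have hsum : ∑ w : R.weylGroup, (-(-1 : k)⁻¹ * q) ^ len b (fin w) =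
      ∑ w : R.weylGroup, q ^ len b (fin w) := by rw [h1, one_mul]
  have hsum' : ∑ w : R.weylGroup, (-q⁻¹ * -1) ^ len b (fin w) = 0 ↔
      ∑ w : R.weylGroup, q ^ len b (fin w) = 0 := sum_pow_len_eq_zero_iff (by field_simp)
  refine ⟨fun hP => ⟨?_, ?_⟩, fun hP => ?_⟩
  · exact sandwich_oneDimensional hq hv hself hτ hτ' (by rwa [hsum]) hS
  · exact sandwich_oneDimensional hq hv hself.swap hτ' hτ (fun h => hP (hsum'.1 h)) hS'
  · rw [hS]
    exact sandwich_eq_bot hq hv hself hτ' (by rwa [hsum])
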